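/- **Setting.** Let $n\ge 1$, $1\le r\le d$, and let $\mathrm{St}(d,r)=\{x\in\mathbb R^{d\times r}: x^\top x=I_r\}$ carry the Frobenius metric, with tangent spaces $T_x=\{\xi: x^\top\xi+\xi^\top x=0\}$, orthogonal projections $P_{T_x}z=z-\tfrac12x(x^\top z+z^\top x)$, and a smooth retraction $\mathcal R$ ($\mathcal R_x(\xi)\in \mathrm{St}(d,r)$, $\mathcal R_x(0)=x$, $\frac{d}{ds}\mathcal R_x(s\xi)|_{s=0}=\xi$). Let $W\in\mathbb R^{n\times n}$ be symmetric and doubly stochastic with second largest singular value $\lambda_2<1$ ($\lambda_2=0$ if $n=1$), and let $k\ge1$, $k\ge\lceil\log_{\lambda_2}(1/(2\sqrt n))\rceil$. For $z=(z_1,\dots,z_n)$ write $\bar z=\frac1n\sum_i z_i$ and $\|z-c\|^2=\sum_i\|z_i-c\|^2$; for $x\in\mathrm{St}(d,r)^n$ let $\hat x$ be a minimizer of $\|x-c\|^2$ over $c\in \mathrm{St}(d,r)$ (induced arithmetic mean). Let $0<\delta_1\le\delta_2/(5\sqrt r)$, $\delta_2\le\frac16$ and $$\mathcal N=\{x\in\mathrm{St}(d,r)^n:\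 \|x-\bar x\|^2\le n\delta_1^2,\ \max_i\|x_i-\bar x\|\le\delta_2\}.$$ Let $Y\subseteq\mathbb R^p$ be convex and $f_1,\dots,f_n:\mathrm{St}(d,r)\times Y\to\mathbb R$ be differentiable in $x$ and in $y$, such that for every $i$ the Riemannian gradient $\mathrm{grad}_xf_i$ is $L_{11}$-Lipschitz in $x$ and $L_{12}$-Lipschitz in $y$, $\nabla_yf_i$ is $L_{21}$-Lipschitz in $x$ and $L_{22}$-Lipschitz in $y$ (for the ambient Euclidean norms), and $\|\mathrm{grad}_xf_i\|\le D$. Let $F=\frac1n\sum_if_i$ be $\mu$-strongly concave in $y$ with $\mu>0$ and have, for each $x$, a maximizer $y^*(x)$ over $Y$; put $\Phi(x)=F(x,y^*(x))$ and $L=\max(1,L_{11},L_{12},L_{21},L_{22})$. **Algorithm (DRGDA).** With step sizes $\alpha,\beta,\eta>0$, starting from $x_0\in\mathcal N$, $y_0\in Y^n$, $u_0^i=\mathrm{grad}_xf_i(x_0^i,y_0^i)$, $v_0^i=\nabla_yf_i(x_0^i,y_0^i)$, for $0\le t<T$: $$x_{t+1}^i=\mathcal R_{x_t^i}\Big(\alpha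 P_{T_{x_t^i}}\big(\textstyle\sum_jW^k_{ij}x_t^j\big)-\beta P_{T_{x_t^i}}u_t^i\Big),\qquad y_{t+1}^i=\textstyle\sum_jW_{ij}y_t^j+\eta v_t^i,$$ $$u_{t+1}^i=\textstyle\sum_jW^k_{ij}u_t^j+\mathrm{grad}_xf_i(x_{t+1}^i,y_{t+1}^i)-\mathrm{grad}_xf_i(x_t^i,y_t^i),$$ $$v_{t+1}^i=\textstyle\sum_jW_{ij}v_t^j+\nabla_yf_i(x_{t+1}^i,y_{t+1}^i)-\nabla_yf_i(x_t^i,y_t^i),$$ and suppose that $y_t^i\in Y$ for all $i$ and $t\le T$ (automatic if $Y=\mathbb R^p$). Let $\bar g_t=\frac1n\sum_i\mathrm{grad}_xf_i(x_t^i,y_t^i)$ and $$\mathfrak M_t=\|\bar g_t\|^2+\tfrac1n\|x_t-\hat x_t\|^2+\tfrac Ln\|\bar y_t-y^*(\hat x_t)\|^2,$$ $$H_t=\Phi(\hat x_t)+\tfrac{8L}{\mu\eta}\|\bar y_t-y^*(\hat x_t)\|^2+\tfrac Qn\|y_t-\bar y_t\|^2+\tfrac{\eta Q}n\|v_t-\bar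 v_t\|^2 .$$ **Theorem (convergence of DRGDA).** There is $\alpha_0>0$, depending only on $n,d,r,W,k,\mathcal R,\delta_1,\delta_2$, such that for every $0<\alpha\le\alpha_0$ there is $\rho=\rho(\alpha)\in(0,1)$ which is a linear rate of consensus on $\mathcal N$: for $x\in\mathcal N$ the point $x^+$ with $x_i^+=\mathcal R_{x_i}(\alpha P_{T_{x_i}}(\sum_jW^k_{ij}x_j))$ lies in $\mathcal N$ and $\|x^+-\widehat{x^+}\|\le\rho\|x-\hat x\|$. Moreover, for all Lipschitz constants and $\mu$ there are $Q>0$ and $\eta_0>0$ (independent of $\alpha$ and $D$) such that for all $0<\alpha\le\alpha_0$, $0<\eta\le\eta_0$ and $D\ge 0$ there are $C_4>0$ and $\beta_0>0$ such that for all $0<\beta\le\beta_0$, all $p$, all $Y,f_1,\dots,f_n$ as above, all $x_0\in\mathcal N$ and all $y_0$, every $T\ge1$ and every run of the algorithm satisfy, with $C_3=2/(1-\rho(\alpha))^2$, $$\frac1T\sum_{t=0}^{T-1}\mathfrak M_t\le\frac{10(H_0-H_T+C_4)}{T\beta}+\frac{10\beta C_3(H_0-H_T+C_4)}{T},$$ and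 the left-hand side is at most $K/T$ with $K$ independent of $T$, that is, it is $O(1/T)$. -/

import Mathlib

open scoped ContDiff

noncomputable section

namespace DRGDA

/-- Real `d × r` matrices with the Frobenius inner product and norm. -/
abbrev Mat (d r : ℕ) : Type := EuclideanSpace ℝ (Fin d × Fin r)

/-- An element of `Mat d r` as a matrix. -/
def mat {d r : ℕ} (x : Mat d r) : Matrix (Fin d) (Fin r) ℝ :=
  Matrix.of fun a b => x (a, b)

/-- A matrix as an element of `Mat d r`. -/
def unmat {d r : ℕ} (A : Matrix (Fin d) (Fin r) ℝ) : Mat d r :=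
  WithLp.toLp 2 fun ab => A ab.1 ab.2

/-- The Stiefel manifold `St(d,r) = {x : xᵀ x = I}`. -/
def stiefel (d r : ℕ) : Set (Mat d r) :=
  {x | (mat x).transpose * mat x = 1}

/-- The tangent space of the Stiefel manifold at `x`, namely `{ξ : xᵀ ξ + ξᵀ x = 0}`. -/
def tangent {d r : ℕ} (x : Mat d r) : Set (Mat d r) :=
  {ξ | (mat x).transpose * mat ξ + (mat ξ).transpose * mat x = 0}

/-- The orthogonal projection onto the tangent space at `x ∈ St(d,r)`:
`z ↦ z - (1/2) x (xᵀ z + zᵀ x)`. -/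
def tangentProj {d r : ℕ} (x z : Mat d r) : Mat d r :=
  z - (1 / 2 : ℝ) •
    unmat (mat x * ((mat x).transpose * mat z + (mat z).transpose * mat x))

/-- `g` is the Riemannian gradient at `x ∈ St(d,r)` of the function `φ` on `St(d,r)`: it is
tangent, and `φ z = φ x + ⟪g, z - x⟫ + o(‖z - x‖)` as `z → x` within `St(d,r)`. Only the values of
`φ` on the manifold matter. -/
def IsRiemannianGradient {d r : ℕ} (φ : Mat d r → ℝ) (g x : Mat d r) : Prop :=
  g ∈ tangent x ∧ HasGradientWithinAt φ g (stiefel d r) x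

/-- `R` is a (smooth) retraction on the Stiefel manifold; `R x ξ` is `R_x(ξ)`, and only its
values for `x ∈ St(d,r)` and `ξ` tangent at `x` matter. -/
structure IsRetraction {d r : ℕ} (R : Mat d r → Mat d r → Mat d r) : Prop where
  mem : ∀ x ∈ stiefel d r, ∀ ξ ∈ tangent x, R x ξ ∈ stiefel d r
  zero : ∀ x ∈ stiefel d r, R x 0 = x
  deriv : ∀ x ∈ stiefel d r, ∀ ξ ∈ tangent x, HasDerivAt (fun s : ℝ => R x (s • ξ)) ξ 0
  smooth : ContDiffOn ℝ ∞ (fun q : Mat d r × Mat d r => R q.1 q.2)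
    {q | q.1 ∈ stiefel d r ∧ q.2 ∈ tangent q.1}

/-- The Euclidean mean `(1/n) ∑ᵢ zᵢ`. -/
def avg {n : ℕ} {E : Type*} [AddCommGroup E] [Module ℝ E] (z : Fin n → E) : E :=
  (n : ℝ)⁻¹ • ∑ i, z i

/-- `‖z - 1 ⊗ c‖² = ∑ᵢ ‖zᵢ - c‖²`. -/
def sqDist {n : ℕ} {E : Type*} [NormedAddCommGroup E] (z : Fin n → E) (c : E) : ℝ :=
  ∑ i, ‖z i - c‖ ^ 2

/-- One communication round with weights `W`: `(W z)ᵢ = ∑ⱼ Wᵢⱼ zⱼ`. -/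
def mix {n : ℕ} {E : Type*} [AddCommGroup E] [Module ℝ E] (W : Matrix (Fin n) (Fin n) ℝ)
    (z : Fin n → E) (i : Fin n) : E :=
  ∑ j, W i j • z j

/-- The second largest singular value of `W` (`0` if `n = 1`); singular values are indexed
from `0`. For symmetric `W` it is the second largest modulus of an eigenvalue. -/
def lambda₂ {n : ℕ} (W : Matrix (Fin n) (Fin n) ℝ) : ℝ :=
  (Matrix.toEuclideanLin W).singularValues 1

/-- `c` is an induced arithmetic mean of `x₁, …, xₙ` on the Stiefel manifold: a minimizer over
`St(d,r)` of the sum of the squared distances to the `xᵢ`. -/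
def IsIAM {n d r : ℕ} (x : Fin n → Mat d r) (c : Mat d r) : Prop :=
  c ∈ stiefel d r ∧ ∀ z ∈ stiefel d r, sqDist x c ≤ sqDist x z

/-- The local consensus region `N = N₁ ∩ N₂` in `St(d,r)ⁿ`. -/
def consensusRegion (n d r : ℕ) (δ₁ δ₂ : ℝ) : Set (Fin n → Mat d r) :=
  {x | (∀ i, x i ∈ stiefel d r) ∧ sqDist x (avg x) ≤ n * δ₁ ^ 2 ∧ ∀ i, ‖x i - avg x‖ ≤ δ₂}

/-- One step of Riemannian consensus on the Stiefel manifold with step size `α` and `k`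
communication rounds: `xᵢ ↦ R_{xᵢ}(α P_{T_{xᵢ}}(∑ⱼ (Wᵏ)ᵢⱼ xⱼ))`. -/
def consensusStep {n d r : ℕ} (W : Matrix (Fin n) (Fin n) ℝ) (k : ℕ)
    (R : Mat d r → Mat d r → Mat d r) (α : ℝ) (x : Fin n → Mat d r) (i : Fin n) : Mat d r :=
  R (x i) (α • tangentProj (x i) (mix (W ^ k) x i))

/-- `ρ` is a linear consensus rate on the local region: the consensus step leaves the region
invariant and contracts the distance to the induced arithmetic mean by the factor `ρ`. -/
def IsConsensusRate {n d r : ℕ} (W : Matrix (Fin n) (Fin n) ℝ) (k : ℕ)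
    (R : Mat d r → Mat d r → Mat d r) (δ₁ δ₂ α ρ : ℝ) : Prop :=
  ∀ x ∈ consensusRegion n d r δ₁ δ₂,
    consensusStep W k R α x ∈ consensusRegion n d r δ₁ δ₂ ∧
    ∀ c c' : Mat d r, IsIAM x c → IsIAM (consensusStep W k R α x) c' →
      √(sqDist (consensusStep W k R α x) c') ≤ ρ * √(sqDist x c)

/-- Decentralized nonconvex-strongly-concave minimax problems over `St(d,r) × Y`, with local
functions `f i` on `St(d,r) × Y` (values elsewhere are irrelevant), their Riemannian gradients
`gradX` in `x`, their gradients `gradY` in `y`, and the maximizer `yStar x` of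
`F(x,y) = (1/n) ∑ᵢ fᵢ(x,y)` over `y ∈ Y`. -/
structure Problem (n d r p : ℕ) (L₁₁ L₁₂ L₂₁ L₂₂ μ D : ℝ) where
  f : Fin n → Mat d r → EuclideanSpace ℝ (Fin p) → ℝ
  gradX : Fin n → Mat d r → EuclideanSpace ℝ (Fin p) → Mat d r
  gradY : Fin n → Mat d r → EuclideanSpace ℝ (Fin p) → EuclideanSpace ℝ (Fin p)
  Y : Set (EuclideanSpace ℝ (Fin p))
  yStar : Mat d r → EuclideanSpace ℝ (Fin p)
  convex_Y : Convex ℝ Y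
  gradX_spec : ∀ i, ∀ x ∈ stiefel d r, ∀ y ∈ Y,
    IsRiemannianGradient (fun z => f i z y) (gradX i x y) x
  gradY_spec : ∀ i, ∀ x ∈ stiefel d r, ∀ y ∈ Y, HasGradientWithinAt (f i x) (gradY i x y) Y y
  lip₁₁ : ∀ i, ∀ x ∈ stiefel d r, ∀ x' ∈ stiefel d r, ∀ y ∈ Y,
    ‖gradX i x y - gradX i x' y‖ ≤ L₁₁ * ‖x - x'‖
  lip₁₂ : ∀ i, ∀ x ∈ stiefel d r, ∀ y ∈ Y, ∀ y' ∈ Y,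
    ‖gradX i x y - gradX i x y'‖ ≤ L₁₂ * ‖y - y'‖
  lip₂₁ : ∀ i, ∀ x ∈ stiefel d r, ∀ x' ∈ stiefel d r, ∀ y ∈ Y,
    ‖gradY i x y - gradY i x' y‖ ≤ L₂₁ * ‖x - x'‖
  lip₂₂ : ∀ i, ∀ x ∈ stiefel d r, ∀ y ∈ Y, ∀ y' ∈ Y,
    ‖gradY i x y - gradY i x y'‖ ≤ L₂₂ * ‖y - y'‖
  bound : ∀ i, ∀ x ∈ stiefel d r, ∀ y ∈ Y, ‖gradX i x y‖ ≤ D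
  strongConcave : ∀ x ∈ stiefel d r, StrongConcaveOn Y μ (fun y => (n : ℝ)⁻¹ * ∑ i, f i x y)
  yStar_mem : ∀ x ∈ stiefel d r, yStar x ∈ Y
  yStar_max : ∀ x ∈ stiefel d r, IsMaxOn (fun y => (n : ℝ)⁻¹ * ∑ i, f i x y) Y (yStar x)

/-- `L = max(1, L₁₁, L₁₂, L₂₁, L₂₂)`. -/
def maxLip (L₁₁ L₁₂ L₂₁ L₂₂ : ℝ) : ℝ :=
  max 1 (max (max L₁₁ L₁₂) (max L₂₁ L₂₂))

section Run

variable {n d r p : ℕ} {L₁₁ L₁₂ L₂₁ L₂₂ μ D : ℝ}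

/-- The global function `F(x,y) = (1/n) ∑ᵢ fᵢ(x,y)`. -/
def Problem.F (P : Problem n d r p L₁₁ L₁₂ L₂₁ L₂₂ μ D) (x : Mat d r)
    (y : EuclideanSpace ℝ (Fin p)) : ℝ :=
  (n : ℝ)⁻¹ * ∑ i, P.f i x y

/-- `Φ(x) = max_{y ∈ Y} F(x,y) = F(x, y*(x))`. -/
def Problem.Phi (P : Problem n d r p L₁₁ L₁₂ L₂₁ L₂₂ μ D) (x : Mat d r) : ℝ :=
  P.F x (P.yStar x)

/-- `T` iterations of the deterministic decentralized Riemannian gradient descent ascent method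
with gradient tracking; `x t i`, `y t i` are the iterates of node `i`, and `u`, `v` its trackers of
the two gradients. The `y`-iterates are assumed to stay in `Y`, where the functions live. -/
structure IsRun (P : Problem n d r p L₁₁ L₁₂ L₂₁ L₂₂ μ D) (W : Matrix (Fin n) (Fin n) ℝ) (k : ℕ)
    (R : Mat d r → Mat d r → Mat d r) (α β η : ℝ) (T : ℕ)
    (x : ℕ → Fin n → Mat d r) (y : ℕ → Fin n → EuclideanSpace ℝ (Fin p))
    (u : ℕ → Fin n → Mat d r) (v : ℕ → Fin n → EuclideanSpace ℝ (Fin p)) : Prop where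
  y_mem : ∀ t ≤ T, ∀ i, y t i ∈ P.Y
  u_zero : ∀ i, u 0 i = P.gradX i (x 0 i) (y 0 i)
  v_zero : ∀ i, v 0 i = P.gradY i (x 0 i) (y 0 i)
  x_succ : ∀ t < T, ∀ i, x (t + 1) i = R (x t i)
    (α • tangentProj (x t i) (mix (W ^ k) (x t) i) - β • tangentProj (x t i) (u t i))
  y_succ : ∀ t < T, ∀ i, y (t + 1) i = mix W (y t) i + η • v t i
  u_succ : ∀ t < T, ∀ i, u (t + 1) i = mix (W ^ k) (u t) i
    + P.gradX i (x (t + 1) i) (y (t + 1) i) - P.gradX i (x t i) (y t i)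
  v_succ : ∀ t < T, ∀ i, v (t + 1) i = mix W (v t) i
    + P.gradY i (x (t + 1) i) (y (t + 1) i) - P.gradY i (x t i) (y t i)

/-- The potential
`H = Φ(x̂) + (8L/(μη)) ‖ȳ - y*(x̂)‖² + (Q/n) ‖y - 1⊗ȳ‖² + (ηQ/n) ‖v - 1⊗v̄‖²`. -/
def Problem.H (P : Problem n d r p L₁₁ L₁₂ L₂₁ L₂₂ μ D) (Q η : ℝ) (xhat : Mat d r)
    (y v : Fin n → EuclideanSpace ℝ (Fin p)) : ℝ :=
  P.Phi xhat
    + 8 * maxLip L₁₁ L₁₂ L₂₁ L₂₂ / (μ * η) * ‖avg y - P.yStar xhat‖ ^ 2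
    + Q / n * sqDist y (avg y)
    + η * Q / n * sqDist v (avg v)

/-- The convergence measure
`M = ‖(1/n) ∑ᵢ grad_x fᵢ(xᵢ,yᵢ)‖² + (1/n) ‖x - 1⊗x̂‖² + (L/n) ‖ȳ - y*(x̂)‖²`. -/
def Problem.M (P : Problem n d r p L₁₁ L₁₂ L₂₁ L₂₂ μ D) (xhat : Mat d r)
    (x : Fin n → Mat d r) (y : Fin n → EuclideanSpace ℝ (Fin p)) : ℝ :=
  ‖avg (fun i => P.gradX i (x i) (y i))‖ ^ 2
    + 1 / n * sqDist x xhat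
    + maxLip L₁₁ L₁₂ L₂₁ L₂₂ / n * ‖avg y - P.yStar xhat‖ ^ 2

end Run

end DRGDA

end

/-! The proof is a Lyapunov argument. Let X be the mean square distance of the nodes to the induced
mean, G the squared norm of the averaged gradient, Z the squared distance of ȳ to y*(x̂), and S, V,
U the mean square deviations of y, v, u from their averages. In one iteration X, Z, S, V, U contract
by factors 1 − α/30, 1 − ημ/4, λ₂, λ₂, 1/2, and Φ(x̂) drops by (β/2)G, up to multiples of the other
quantities and of w = β²(G + U), the mean square of the perturbation βu. With suitable weights, the
potential H plus (30/α)(c + 2)X + Bβ²U drops by (β/4)G + X + (L/2)Z, which is at least (β/4)𝔐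
(`lyapunov_step`). Telescoping gives the first term of the bound, even with 4 in place of 10; the
second term is nonnegative. The O(1/T) rate follows because Φ is bounded below on the compact
manifold.

The geometry rests on two second-order facts: the normal part of x' − x is quadratic in ‖x' − x‖
(`norm_normalProj_sub_le`), and a retraction is x + ξ up to O(‖ξ‖²) uniformly
(`IsRetraction.exists_second_order_bound`). Hence x̄ and x̂ differ quadratically, the nearest-point
projection is 4/3-Lipschitz near the manifold, and, since averaging cancels the mixing term, x̄
moves against the averaged projected trackers up to errors in X and w (`norm_avg_step_expansion_le`,
`inner_gX_displacement_le`). A perturbed consensus step contracts the distance to x̂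
(`l2norm_step_sub_iam_le`) and preserves the region while β‖uᵢ‖ ≤ τ (`perturbedStep_mem`); the bound
D alone ensures the latter, before any descent is known.

The order of the constants matters: Q and η₀ use only L, μ and λ₂; the weights c and B then depend
on α, η, D but not on β, which is chosen last. -/

noncomputable section

namespace DRGDA

/-! ### Tangent and normal projections on the Stiefel manifold -/

section Stiefel

open Matrix

variable {d r s : ℕ}

@[simp] lemma mat_unmat (A : Matrix (Fin d) (Fin r) ℝ) : mat (unmat A) = A := rfl

@[simp] lemma unmat_mat (x : Mat d r) : unmat (mat x) = x := rfl

lemma mat_add (x y : Mat d r) : mat (x + y) = mat x + mat y := rfl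

lemma mat_sub (x y : Mat d r) : mat (x - y) = mat x - mat y := rfl

lemma mat_smul (c : ℝ) (x : Mat d r) : mat (c • x) = c • mat x := rfl

lemma unmat_add (A B : Matrix (Fin d) (Fin r) ℝ) : unmat (A + B) = unmat A + unmat B := rfl

lemma unmat_smul (c : ℝ) (A : Matrix (Fin d) (Fin r) ℝ) : unmat (c • A) = c • unmat A := rfl

lemma inner_unmat (A B : Matrix (Fin d) (Fin r) ℝ) :
    inner ℝ (unmat A) (unmat B) = (Aᵀ * B).trace := by
  simp only [unmat, PiLp.inner_apply, RCLike.inner_apply, conj_trivial, Matrix.trace,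
    Matrix.diag_apply, Matrix.mul_apply, Matrix.transpose_apply, Fintype.sum_prod_type]
  rw [Finset.sum_comm]
  exact Finset.sum_congr rfl fun _ _ => Finset.sum_congr rfl fun _ _ => mul_comm _ _

lemma inner_unmat_mul_left (C : Matrix (Fin d) (Fin s) ℝ) (A : Matrix (Fin s) (Fin r) ℝ)
    (B : Matrix (Fin d) (Fin r) ℝ) :
    inner ℝ (unmat (C * A)) (unmat B) = inner ℝ (unmat A) (unmat (Cᵀ * B)) := by
  rw [inner_unmat, inner_unmat, Matrix.transpose_mul, Matrix.mul_assoc]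

lemma inner_unmat_transpose (A B : Matrix (Fin d) (Fin r) ℝ) :
    inner ℝ (unmat Aᵀ) (unmat Bᵀ) = inner ℝ (unmat A) (unmat B) := by
  rw [inner_unmat, inner_unmat, Matrix.transpose_transpose, Matrix.trace_mul_comm,
    ← Matrix.trace_transpose, Matrix.transpose_mul, Matrix.transpose_transpose]

lemma norm_unmat_transpose (A : Matrix (Fin d) (Fin r) ℝ) : ‖unmat Aᵀ‖ = ‖unmat A‖ := by
  rw [@norm_eq_sqrt_real_inner (Mat r d), @norm_eq_sqrt_real_inner (Mat d r),
    inner_unmat_transpose]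

lemma norm_unmat_mul_le (A : Matrix (Fin d) (Fin s) ℝ) (B : Matrix (Fin s) (Fin r) ℝ) :
    ‖unmat (A * B)‖ ≤ ‖unmat A‖ * ‖unmat B‖ := by
  have key : ∀ {a b : ℕ} (M : Matrix (Fin a) (Fin b) ℝ),
      ‖unmat M‖ = (@norm _ (Matrix.frobeniusNormedAddCommGroup (α := ℝ)).toNorm M) := by
    intro a b M
    rw [Matrix.frobenius_norm_def, EuclideanSpace.norm_eq, Real.sqrt_eq_rpow,
      Fintype.sum_prod_type]
    simp [unmat]
  rw [key, key, key]
  exact Matrix.frobenius_norm_mul A B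

/-- The symmetric part `xᵀ z + zᵀ x`, which vanishes exactly on tangent vectors. -/
def symPart (x z : Mat d r) : Matrix (Fin r) (Fin r) ℝ :=
  (mat x)ᵀ * mat z + (mat z)ᵀ * mat x

/-- The projection onto the normal space of the Stiefel manifold. -/
def normalProj (x z : Mat d r) : Mat d r :=
  (1 / 2 : ℝ) • unmat (mat x * symPart x z)

lemma tangentProj_eq (x z : Mat d r) : tangentProj x z = z - normalProj x z := rfl

lemma mem_tangent_iff {x ξ : Mat d r} : ξ ∈ tangent x ↔ symPart x ξ = 0 := Iff.rfl

lemma symPart_transpose (x z : Mat d r) : (symPart x z)ᵀ = symPart x z := by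
  simp [symPart, Matrix.transpose_mul, add_comm]

lemma symPart_add (x z w : Mat d r) : symPart x (z + w) = symPart x z + symPart x w := by
  simp only [symPart, mat_add, Matrix.mul_add, Matrix.transpose_add, Matrix.add_mul]; abel

lemma symPart_smul (x z : Mat d r) (c : ℝ) : symPart x (c • z) = c • symPart x z := by
  simp [symPart, mat_smul]

/-- The right-hand side is symmetric in z and w, which makes both projections self-adjoint; x need
not lie on the manifold. -/
lemma inner_normalProj (x z w : Mat d r) :
    inner ℝ (normalProj x z) w = 1 / 4 * inner ℝ (unmat (symPart x z)) (unmat (symPart x w)) := by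
  have h1 : inner ℝ (unmat (mat x * symPart x z)) w
      = inner ℝ (unmat (symPart x z)) (unmat ((mat x)ᵀ * mat w)) := by
    rw [← inner_unmat_mul_left, unmat_mat]
  have h2 : inner ℝ (unmat (symPart x z)) (unmat ((mat w)ᵀ * mat x))
      = inner ℝ (unmat (symPart x z)) (unmat ((mat x)ᵀ * mat w)) := by
    rw [← inner_unmat_transpose (symPart x z), symPart_transpose, Matrix.transpose_mul,
      Matrix.transpose_transpose]
  rw [normalProj, real_inner_smul_left, h1, symPart, symPart, unmat_add ((mat x)ᵀ * mat w),
    inner_add_right]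
  change _ = 1 / 4 * (_ + inner ℝ (unmat (symPart x z)) (unmat ((mat w)ᵀ * mat x)))
  rw [h2, symPart]; ring

lemma inner_normalProj_comm (x z w : Mat d r) :
    inner ℝ (normalProj x z) w = inner ℝ z (normalProj x w) := by
  rw [inner_normalProj, real_inner_comm _ z, inner_normalProj, real_inner_comm]

lemma inner_tangentProj_comm (x z w : Mat d r) :
    inner ℝ (tangentProj x z) w = inner ℝ z (tangentProj x w) := by
  rw [tangentProj_eq, tangentProj_eq, inner_sub_left, inner_sub_right, inner_normalProj_comm]

lemma normalProj_add (x z w : Mat d r) : normalProj x (z + w) = normalProj x z + normalProj x w := by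
  simp only [normalProj, symPart_add, Matrix.mul_add, unmat_add, smul_add]

lemma normalProj_smul (x z : Mat d r) (c : ℝ) : normalProj x (c • z) = c • normalProj x z := by
  simp only [normalProj, symPart_smul, Matrix.mul_smul, unmat_smul, smul_comm c]

/-- `normalProj x` as a linear map. -/
def normalProjₗ (x : Mat d r) : Mat d r →ₗ[ℝ] Mat d r where
  toFun := normalProj x
  map_add' := normalProj_add x
  map_smul' c z := normalProj_smul x z c

/-- `tangentProj x` as a linear map. -/
def tangentProjₗ (x : Mat d r) : Mat d r →ₗ[ℝ] Mat d r := LinearMap.id - normalProjₗ x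

lemma normalProjₗ_apply (x z : Mat d r) : normalProjₗ x z = normalProj x z := rfl

lemma tangentProjₗ_apply (x z : Mat d r) : tangentProjₗ x z = tangentProj x z := rfl

lemma tangentProj_of_mem_tangent {x ξ : Mat d r} (h : ξ ∈ tangent x) : tangentProj x ξ = ξ := by
  rw [mem_tangent_iff] at h
  simp [tangentProj_eq, normalProj, h, unmat, ← Pi.zero_def]

lemma tangent_smul {x ξ : Mat d r} (c : ℝ) (h : ξ ∈ tangent x) : c • ξ ∈ tangent x := by
  rw [mem_tangent_iff] at h ⊢; rw [symPart_smul, h, smul_zero]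

lemma tangent_add {x ξ ζ : Mat d r} (h : ξ ∈ tangent x) (h' : ζ ∈ tangent x) :
    ξ + ζ ∈ tangent x := by
  rw [mem_tangent_iff] at h h' ⊢; rw [symPart_add, h, h', zero_add]

lemma tangent_sum {ι : Type*} {x : Mat d r} (t : Finset ι) (ξ : ι → Mat d r)
    (h : ∀ i, ξ i ∈ tangent x) : ∑ i ∈ t, ξ i ∈ tangent x :=
  Finset.sum_induction ξ (· ∈ tangent x) (fun _ _ => tangent_add)
    (by rw [mem_tangent_iff]; simpa using symPart_smul x 0 0) fun i _ => h i

variable {x : Mat d r} (hx : x ∈ stiefel d r)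
include hx

lemma norm_normalProj (z : Mat d r) : ‖normalProj x z‖ = 1 / 2 * ‖unmat (symPart x z)‖ := by
  have hx' : (mat x)ᵀ * mat x = 1 := hx
  have h : ‖unmat (mat x * symPart x z)‖ = ‖unmat (symPart x z)‖ := by
    rw [@norm_eq_sqrt_real_inner (Mat d r), @norm_eq_sqrt_real_inner (Mat r r),
      inner_unmat_mul_left, ← Matrix.mul_assoc, hx', Matrix.one_mul]
  rw [normalProj, norm_smul, h]; norm_num

lemma norm_sq_tangentProj (z : Mat d r) :
    ‖tangentProj x z‖ ^ 2 = ‖z‖ ^ 2 - ‖normalProj x z‖ ^ 2 := by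
  have h : inner ℝ z (normalProj x z) = ‖normalProj x z‖ ^ 2 := by
    rw [real_inner_comm, inner_normalProj, norm_normalProj hx, real_inner_self_eq_norm_sq]; ring
  rw [tangentProj_eq, norm_sub_sq_real, h]; ring

lemma norm_tangentProj_le (z : Mat d r) : ‖tangentProj x z‖ ≤ ‖z‖ := by
  refine abs_le_of_sq_le_sq' ?_ (norm_nonneg _) |>.2
  rw [norm_sq_tangentProj hx]; nlinarith [sq_nonneg ‖normalProj x z‖]

lemma tangentProj_mem_tangent (z : Mat d r) : tangentProj x z ∈ tangent x := by
  have hx' : (mat x)ᵀ * mat x = 1 := hx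
  have h : symPart x (normalProj x z) = symPart x z := by
    rw [normalProj, symPart_smul, symPart, mat_unmat, ← Matrix.mul_assoc, hx', Matrix.one_mul,
      Matrix.transpose_mul, Matrix.mul_assoc, hx', Matrix.mul_one, symPart_transpose,
      ← two_smul ℝ, smul_smul]
    norm_num
  rw [mem_tangent_iff, tangentProj_eq, sub_eq_add_neg, ← neg_one_smul ℝ, symPart_add, symPart_smul,
    h]
  simp

lemma tangentProj_self : tangentProj x x = 0 := by
  have hx' : (mat x)ᵀ * mat x = 1 := hx
  rw [tangentProj_eq, normalProj, symPart, hx', ← two_smul ℝ, Matrix.mul_smul, unmat_smul,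
    Matrix.mul_one, unmat_mat, smul_smul]
  norm_num

/-- Subtracting the two constraints leaves −(x' − x)ᵀ(x' − x) as symmetric part: chords are tangent
up to second order. -/
lemma norm_normalProj_sub_le {x' : Mat d r} (hx' : x' ∈ stiefel d r) :
    ‖normalProj x (x' - x)‖ ≤ 1 / 2 * ‖x' - x‖ ^ 2 := by
  have h1 : (mat x)ᵀ * mat x = 1 := hx
  have h2 : (mat x')ᵀ * mat x' = 1 := hx'
  have h : symPart x (x' - x) = (-1 : ℝ) • ((mat (x' - x))ᵀ * mat (x' - x)) := by
    simp only [symPart, mat_sub, Matrix.transpose_sub, Matrix.mul_sub, Matrix.sub_mul, h1, h2,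
      neg_one_smul]
    abel
  rw [norm_normalProj hx, h, unmat_smul, norm_smul]
  have := norm_unmat_mul_le (mat (x' - x))ᵀ (mat (x' - x))
  rw [norm_unmat_transpose, unmat_mat] at this
  norm_num
  nlinarith

/-- The symmetric part of g at c vanishes, so at x only x − c contributes. This serves to pair a
gradient at the induced mean with normal vectors at the nodes. -/
lemma norm_normalProj_of_mem_tangent {c g : Mat d r} (hg : g ∈ tangent c) :
    ‖normalProj x g‖ ≤ ‖x - c‖ * ‖g‖ := by
  rw [mem_tangent_iff] at hg
  have h : symPart x g = (mat (x - c))ᵀ * mat g + ((mat (x - c))ᵀ * mat g)ᵀ := by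
    rw [← sub_zero (symPart x g), ← hg]
    simp only [symPart, mat_sub, Matrix.transpose_sub, Matrix.transpose_mul,
      Matrix.transpose_transpose, Matrix.sub_mul]
    abel
  have h3 := norm_unmat_mul_le (mat (x - c))ᵀ (mat g)
  rw [norm_unmat_transpose, unmat_mat, unmat_mat] at h3
  rw [norm_normalProj hx, h, unmat_add]
  have h4 := norm_add_le (unmat ((mat (x - c))ᵀ * mat g)) (unmat ((mat (x - c))ᵀ * mat g)ᵀ)
  rw [norm_unmat_transpose] at h4
  linarith

lemma norm_sq_of_mem_stiefel : ‖x‖ ^ 2 = r := by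
  have h1 : (mat x)ᵀ * mat x = 1 := hx
  rw [← real_inner_self_eq_norm_sq, ← unmat_mat x, inner_unmat, h1]
  simp

omit hx

lemma isCompact_stiefel : IsCompact (stiefel d r) := by
  have hcont : Continuous fun x : Mat d r => (mat x)ᵀ * mat x := by
    unfold mat
    fun_prop
  refine Metric.isCompact_of_isClosed_isBounded (isClosed_singleton.preimage hcont) ?_
  refine isBounded_iff_forall_norm_le.2 ⟨√r, fun x hx => ?_⟩
  exact Real.le_sqrt_of_sq_le (norm_sq_of_mem_stiefel hx).le

end Stiefel

/-! ### Uniform second-order expansion of a retraction -/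

section Retraction

open Topology

variable {d r : ℕ} {R : Mat d r → Mat d r → Mat d r}

/-- Taylor's estimate along s ↦ R x (s ξ). Smoothness is given only within the tangent bundle, where
derivatives need not be unique, so two successive derivatives `f'`, `f''` are chosen locally. -/
lemma IsRetraction.exists_local_second_order_bound (hR : IsRetraction R) {x₀ : Mat d r}
    (hx₀ : x₀ ∈ stiefel d r) :
    ∃ ε > 0, ∃ M : ℝ, ∀ x ∈ stiefel d r, ‖x - x₀‖ < ε → ∀ ξ ∈ tangent x, ‖ξ‖ < ε →
      ‖R x ξ - x - ξ‖ ≤ M * ‖ξ‖ ^ 2 := by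
  set K : Set (Mat d r × Mat d r) := {q | q.1 ∈ stiefel d r ∧ q.2 ∈ tangent q.1} with hK
  set f : Mat d r × Mat d r → Mat d r := fun q => R q.1 q.2 with hf
  have h0 : (0 : Mat d r) ∈ tangent x₀ := by
    simpa using tangent_smul 0 (tangentProj_mem_tangent hx₀ 0)
  have hq : (x₀, (0 : Mat d r)) ∈ K := ⟨hx₀, h0⟩
  have h2 : ContDiffWithinAt ℝ (1 + 1) f K (x₀, 0) :=
    (hR.smooth _ hq).of_le (by norm_cast)
  obtain ⟨u, hu, -, -, f', hf', hf'C⟩ :=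
    (contDiffWithinAt_succ_iff_hasFDerivWithinAt' (by norm_num)).1 h2
  have h1 : ContDiffWithinAt ℝ (0 + 1) f' K (x₀, 0) := by simpa using hf'C
  obtain ⟨u', hu', -, -, f'', hf'', hf''C⟩ :=
    (contDiffWithinAt_succ_iff_hasFDerivWithinAt' (by norm_num)).1 h1
  rw [Set.insert_eq_of_mem hq] at hu hu'
  have hbd : ∀ᶠ q in 𝓝[K] (x₀, 0), ‖f'' q‖ < ‖f'' (x₀, 0)‖ + 1 :=
    hf''C.continuousWithinAt.norm.eventually_lt_const (lt_add_one _)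
  have hev : ∀ᶠ q in 𝓝[K] (x₀, 0), (q ∈ u ∧ q ∈ u') ∧ ‖f'' q‖ < ‖f'' (x₀, 0)‖ + 1 :=
    (Filter.Eventually.and hu hu').and hbd
  obtain ⟨ε, hε, hball⟩ := Metric.mem_nhdsWithin_iff.1 hev
  refine ⟨ε, hε, ‖f'' (x₀, 0)‖ + 1, fun x hx hxx ξ hξ hξε => ?_⟩
  set B := ‖f'' (x₀, 0)‖ + 1
  have hcK : ∀ s : ℝ, (x, s • ξ) ∈ K := fun s => ⟨hx, tangent_smul s hξ⟩
  have hcb : ∀ s ∈ Set.Icc (0 : ℝ) 1, ((x, s • ξ) ∈ u ∧ (x, s • ξ) ∈ u') ∧ ‖f'' (x, s • ξ)‖ < B := by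
    intro s hs
    refine hball ⟨?_, hcK s⟩
    rw [Metric.mem_ball, Prod.dist_eq, dist_eq_norm, dist_zero_right, norm_smul, Real.norm_eq_abs,
      abs_of_nonneg hs.1]
    exact max_lt hxx (by nlinarith [norm_nonneg ξ, hs.2])
  have hc : ∀ s : ℝ, HasDerivWithinAt (fun s : ℝ => ((x, s • ξ) : Mat d r × Mat d r)) (0, ξ)
      (Set.Icc 0 1) s := by
    intro s
    have := (hasDerivWithinAt_id s (Set.Icc (0 : ℝ) 1)).smul_const ξ
    simpa using (hasDerivWithinAt_const s (Set.Icc (0 : ℝ) 1) x).prodMk this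
  have hd1 : ∀ s ∈ Set.Icc (0 : ℝ) 1, HasDerivWithinAt (fun s : ℝ => R x (s • ξ))
      (f' (x, s • ξ) (0, ξ)) (Set.Icc 0 1) s := by
    intro s hs
    have := (hf' _ (hcb s hs).1.1).comp_hasDerivWithinAt s (hc s) fun t _ => hcK t
    exact this
  have hd2 : ∀ s ∈ Set.Icc (0 : ℝ) 1, HasDerivWithinAt (fun s : ℝ => f' (x, s • ξ) (0, ξ))
      (f'' (x, s • ξ) (0, ξ) (0, ξ)) (Set.Icc 0 1) s := by
    intro s hs
    have := (hf'' _ (hcb s hs).1.2).comp_hasDerivWithinAt s (hc s) fun t _ => hcK t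
    simpa using this.clm_apply (hasDerivWithinAt_const s (Set.Icc (0 : ℝ) 1) ((0 : Mat d r), ξ))
  have hnorm : ‖((0 : Mat d r), ξ)‖ = ‖ξ‖ := by simp [Prod.norm_def]
  have hB2 : ∀ s ∈ Set.Icc (0 : ℝ) 1, ‖f'' (x, s • ξ) (0, ξ) (0, ξ)‖ ≤ B * ‖ξ‖ ^ 2 := by
    intro s hs
    calc ‖f'' (x, s • ξ) (0, ξ) (0, ξ)‖ ≤ ‖f'' (x, s • ξ)‖ * ‖((0 : Mat d r), ξ)‖ * ‖((0 : Mat d r), ξ)‖ :=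
          ContinuousLinearMap.le_opNorm₂ _ _ _
      _ ≤ B * ‖ξ‖ * ‖ξ‖ := by rw [hnorm]; gcongr; exact (hcb s hs).2.le
      _ = B * ‖ξ‖ ^ 2 := by ring
  -- Derivatives on an interval are unique, so the chosen `f'` must agree here with the derivative
  -- prescribed for the retraction.
  have hzero : f' (x, (0 : ℝ) • ξ) (0, ξ) = ξ :=
    ((uniqueDiffOn_Icc one_pos).uniqueDiffWithinAt (Set.left_mem_Icc.2 zero_le_one)).eq_deriv _
      (hd1 0 (Set.left_mem_Icc.2 zero_le_one)) (hR.deriv x hx ξ hξ).hasDerivWithinAt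
  have hB1 : ∀ s ∈ Set.Icc (0 : ℝ) 1, ‖f' (x, s • ξ) (0, ξ) - ξ‖ ≤ B * ‖ξ‖ ^ 2 := by
    intro s hs
    have := norm_image_sub_le_of_norm_deriv_le_segment' hd2
      (fun t ht => hB2 t (Set.Ico_subset_Icc_self ht)) s hs
    rw [hzero] at this
    refine this.trans ?_
    have : 0 ≤ B * ‖ξ‖ ^ 2 := by positivity
    nlinarith [hs.2]
  have hfin := norm_image_sub_le_of_norm_deriv_le_segment'
    (fun s hs => (hd1 s hs).sub ((hasDerivWithinAt_id s (Set.Icc (0 : ℝ) 1)).smul_const ξ))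
    (fun t ht => by simpa using hB1 t (Set.Ico_subset_Icc_self ht)) 1
    (Set.right_mem_Icc.2 zero_le_one)
  simp only [Pi.sub_apply, id, one_smul, zero_smul, hR.zero x hx] at hfin
  calc ‖R x ξ - x - ξ‖ = ‖R x ξ - ξ - (x - 0)‖ := by congr 1; abel
    _ ≤ B * ‖ξ‖ ^ 2 * (1 - 0) := hfin
    _ = B * ‖ξ‖ ^ 2 := by ring

/-- A smooth retraction agrees with the identity to second order, uniformly on the compact Stiefel
manifold. -/
lemma IsRetraction.exists_second_order_bound (hR : IsRetraction R) :
    ∃ ε > 0, ∃ M > 0, ∀ x ∈ stiefel d r, ∀ ξ ∈ tangent x, ‖ξ‖ < ε →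
      ‖R x ξ - x - ξ‖ ≤ M * ‖ξ‖ ^ 2 := by
  refine isCompact_stiefel.induction_on (p := fun S => ∃ ε > 0, ∃ M > 0, ∀ x ∈ S,
    ∀ ξ ∈ tangent x, ‖ξ‖ < ε → ‖R x ξ - x - ξ‖ ≤ M * ‖ξ‖ ^ 2) ?_ ?_ ?_ ?_
  · exact ⟨1, one_pos, 1, one_pos, fun x hx => hx.elim⟩
  · rintro s t hst ⟨ε, hε, M, hM, h⟩
    exact ⟨ε, hε, M, hM, fun x hx => h x (hst hx)⟩
  · rintro s t ⟨ε, hε, M, hM, h⟩ ⟨ε', hε', M', hM', h'⟩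
    refine ⟨min ε ε', lt_min hε hε', max M M', lt_max_of_lt_left hM, ?_⟩
    rintro x (hx | hx) ξ hξ hξε
    · exact (h x hx ξ hξ (hξε.trans_le (min_le_left _ _))).trans (by gcongr; exact le_max_left _ _)
    · exact (h' x hx ξ hξ (hξε.trans_le (min_le_right _ _))).trans
        (by gcongr; exact le_max_right _ _)
  · intro x₀ hx₀
    obtain ⟨ε, hε, M, h⟩ := hR.exists_local_second_order_bound hx₀
    refine ⟨_, inter_mem_nhdsWithin _ (Metric.ball_mem_nhds x₀ hε), ε, hε, max M 1,
      lt_max_of_lt_right one_pos, fun x hx ξ hξ hξε => ?_⟩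
    refine (h x hx.1 (by simpa [dist_eq_norm] using hx.2) ξ hξ hξε).trans ?_
    gcongr; exact le_max_left _ _

end Retraction

/-! ### Nearest-point projection and the descent lemma -/

section Nearest

open Topology

variable {d r : ℕ} {R : Mat d r → Mat d r → Mat d r}

/-- `c` is a point of the Stiefel manifold nearest to `A`. -/
def IsNearest (A c : Mat d r) : Prop :=
  c ∈ stiefel d r ∧ ∀ z ∈ stiefel d r, ‖A - c‖ ≤ ‖A - z‖

lemma exists_isNearest (hne : (stiefel d r).Nonempty) (A : Mat d r) : ∃ c, IsNearest A c := by
  obtain ⟨c, hc, hmin⟩ := isCompact_stiefel.exists_isMinOn hne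
    (f := fun z => ‖A - z‖) (by fun_prop)
  exact ⟨c, hc, fun z hz => hmin hz⟩

/-- First-order condition: moving from c along ξ, the tangential part of A − c, cannot reduce the
distance to A, which forces ‖ξ‖² = 0. -/
lemma IsNearest.normalProj_eq (hR : IsRetraction R) {A c : Mat d r} (h : IsNearest A c) :
    normalProj c (A - c) = A - c := by
  have hξ := tangentProj_mem_tangent h.1 (A - c)
  set ξ := tangentProj c (A - c) with hξd
  have horth : inner ℝ (A - c) ξ = 0 := by
    have hd := (hR.deriv c h.1 ξ hξ).const_sub A
    have hd2 := hd.norm_sq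
    have hmin : IsLocalMin (fun s : ℝ => ‖A - R c (s • ξ)‖ ^ 2) 0 := by
      refine Filter.Eventually.of_forall fun s => ?_
      simp only [zero_smul, hR.zero c h.1]
      gcongr
      exact h.2 _ (hR.mem c h.1 _ (tangent_smul s hξ))
    have := hmin.hasDerivAt_eq_zero hd2
    simpa [hR.zero c h.1] using this
  have : ξ = 0 := by
    rw [← norm_eq_zero, ← sq_eq_zero_iff, ← real_inner_self_eq_norm_sq]
    conv_lhs => rw [hξd, inner_tangentProj_comm, ← hξd, tangentProj_of_mem_tangent hξ]
    exact horth
  rw [hξd, tangentProj_eq, sub_eq_zero] at this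
  exact this.symm

/-- A − c is normal, so it only sees the normal part of z − c, which is quadratic. -/
lemma IsNearest.abs_inner_le (hR : IsRetraction R) {A c z : Mat d r} (h : IsNearest A c)
    (hz : z ∈ stiefel d r) : |inner ℝ (A - c) (z - c)| ≤ 1 / 2 * ‖A - c‖ * ‖z - c‖ ^ 2 := by
  rw [← h.normalProj_eq hR, inner_normalProj_comm, h.normalProj_eq hR]
  refine (abs_real_inner_le_norm _ _).trans ?_
  have := norm_normalProj_sub_le h.1 hz
  nlinarith [norm_nonneg (A - c)]

/-- The nearest-point projection is `4/3`-Lipschitz on the `1/4`-neighbourhood of the manifold. -/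
lemma IsNearest.norm_sub_le (hR : IsRetraction R) {A B c c' : Mat d r} (h : IsNearest A c)
    (h' : IsNearest B c') (hA : ‖A - c‖ ≤ 1 / 4) (hB : ‖B - c'‖ ≤ 1 / 4) :
    ‖c - c'‖ ≤ 4 / 3 * ‖A - B‖ := by
  have h1 := abs_le.1 (h.abs_inner_le hR h'.1)
  have h2 := abs_le.1 (h'.abs_inner_le hR h.1)
  -- Each of the two curvature terms is at most ‖c − c'‖²/8, so three quarters of ‖c − c'‖² survive;
  -- hence 4/3.
  have h3 : inner ℝ (A - B) (c - c') = ‖c - c'‖ ^ 2 - inner ℝ (A - c) (c' - c)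
      - inner ℝ (B - c') (c - c') := by
    rw [← real_inner_self_eq_norm_sq, ← neg_sub c c', inner_neg_right, sub_neg_eq_add,
      ← inner_add_left, ← inner_sub_left]
    congr 1; abel
  have h4 := real_inner_le_norm (A - B) (c - c')
  rw [norm_sub_rev c' c] at h1
  by_contra! hlt
  have h5 : 0 < ‖c - c'‖ := lt_of_le_of_lt (by positivity) hlt
  nlinarith [sq_nonneg ‖c - c'‖, norm_nonneg (A - c), norm_nonneg (B - c'), h1.2, h2.2,
    mul_le_mul_of_nonneg_right hA (sq_nonneg ‖c - c'‖),
    mul_le_mul_of_nonneg_right hB (sq_nonneg ‖c - c'‖)]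

lemma isNearest_self {x : Mat d r} (hx : x ∈ stiefel d r) : IsNearest x x :=
  ⟨hx, fun z _ => by simp⟩

/-- A Lipschitz curve in the Stiefel manifold joining two nearby points. -/
lemma exists_lipschitz_curve (hR : IsRetraction R) {x x' : Mat d r} (hx : x ∈ stiefel d r)
    (hx' : x' ∈ stiefel d r) (hd : ‖x' - x‖ ≤ 1 / 2) :
    ∃ γ : ℝ → Mat d r, γ 0 = x ∧ γ 1 = x' ∧ (∀ s, γ s ∈ stiefel d r) ∧
      ∀ s ∈ Set.Icc (0 : ℝ) 1, ∀ t ∈ Set.Icc (0 : ℝ) 1,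
        ‖γ s - γ t‖ ≤ 4 / 3 * ‖x' - x‖ * |s - t| := by
  -- The curve is the projection of the segment onto the manifold. The nearer endpoint is always
  -- within 1/4, which is the range of the Lipschitz bound.
  choose γ hγ using fun s : ℝ => exists_isNearest ⟨x, hx⟩ (x + s • (x' - x))
  have hclose : ∀ s ∈ Set.Icc (0 : ℝ) 1, ‖x + s • (x' - x) - γ s‖ ≤ 1 / 4 := by
    intro s hs
    rcases le_total s (1 / 2) with h | h
    · refine ((hγ s).2 x hx).trans ?_
      rw [add_sub_cancel_left, norm_smul, Real.norm_eq_abs, abs_of_nonneg hs.1]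
      nlinarith [norm_nonneg (x' - x), hs.1]
    · refine ((hγ s).2 x' hx').trans ?_
      rw [show x + s • (x' - x) - x' = (s - 1) • (x' - x) by module, norm_smul, Real.norm_eq_abs,
        abs_of_nonpos (by linarith [hs.2])]
      nlinarith [norm_nonneg (x' - x), hs.2]
  have hlip : ∀ s ∈ Set.Icc (0 : ℝ) 1, ∀ t ∈ Set.Icc (0 : ℝ) 1,
        ‖γ s - γ t‖ ≤ 4 / 3 * ‖x' - x‖ * |s - t| := by
    intro s hs t ht
    refine ((hγ s).norm_sub_le hR (hγ t) (hclose s hs) (hclose t ht)).trans (le_of_eq ?_)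
    rw [show x + s • (x' - x) - (x + t • (x' - x)) = (s - t) • (x' - x) by module, norm_smul,
      Real.norm_eq_abs]
    ring
  have hend : ∀ s ∈ Set.Icc (0 : ℝ) 1, x + s • (x' - x) ∈ stiefel d r →
      γ s = x + s • (x' - x) := by
    intro s hs hm
    have := (hγ s).norm_sub_le hR (isNearest_self hm) (hclose s hs) (by simp)
    rw [sub_self, norm_zero, mul_zero] at this
    exact sub_eq_zero.1 (norm_le_zero_iff.1 this)
  refine ⟨γ, ?_, ?_, fun s => (hγ s).1, hlip⟩
  · simpa using hend 0 (by simp) (by simpa using hx)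
  · simpa using hend 1 (by simp) (by simpa using hx')

/-- Descent lemma on the Stiefel manifold. -/
lemma le_of_riemannianGradient_lipschitz (hR : IsRetraction R) {φ : Mat d r → ℝ}
    {g : Mat d r → Mat d r} {L : ℝ} (hL : 0 ≤ L)
    (hg : ∀ z ∈ stiefel d r, IsRiemannianGradient φ (g z) z)
    (hlip : ∀ z ∈ stiefel d r, ∀ z' ∈ stiefel d r, ‖g z - g z'‖ ≤ L * ‖z - z'‖)
    {x x' : Mat d r} (hx : x ∈ stiefel d r) (hx' : x' ∈ stiefel d r) (hd : ‖x' - x‖ ≤ 1 / 2) :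
    φ x' ≤ φ x + inner ℝ (g x) (x' - x) + 2 * L * ‖x' - x‖ ^ 2 := by
  obtain ⟨γ, h0, h1, hmem, hγ⟩ := exists_lipschitz_curve hR hx hx' hd
  set Δ := ‖x' - x‖ with hΔ
  have hΔ0 : 0 ≤ Δ := norm_nonneg _
  have hγc : ContinuousOn γ (Set.Icc 0 1) := by
    have : LipschitzOnWith (4 / 3 * Δ).toNNReal γ (Set.Icc 0 1) :=
      LipschitzOnWith.of_dist_le_mul fun s hs t ht => by
        rw [dist_eq_norm, Real.dist_eq, Real.coe_toNNReal _ (by positivity)]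
        exact hγ s hs t ht
    exact this.continuousOn
  have hφc : ContinuousOn φ (stiefel d r) := fun z hz => (hg z hz).2.continuousWithinAt
  -- γ is only Lipschitz, so the mean value inequality is applied with right slopes. The factor 4/3
  -- enters twice, and 16/9 ≤ 2.
  have key := image_le_of_liminf_slope_right_le_deriv_boundary
    (f := fun s => φ (γ s) - inner ℝ (g x) (γ s)) (a := 0) (b := 1)
    (B := fun s => (φ x - inner ℝ (g x) x) + (2 * L * Δ ^ 2) * s) (B' := fun _ => 2 * L * Δ ^ 2)
    ((hφc.comp hγc fun s _ => hmem s).sub (continuousOn_const.inner hγc)) (by simp [h0])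
    (by fun_prop) (fun s _ => by
      simpa using (((hasDerivWithinAt_id s (Set.Ici s)).const_mul (2 * L * Δ ^ 2)).const_add
        (φ x - inner ℝ (g x) x))) ?_ (Set.right_mem_Icc.2 zero_le_one)
  · simp only [h1, mul_one] at key
    rw [inner_sub_right]; linarith
  intro t ht ρ hρ
  refine Filter.Eventually.frequently ?_
  have htI := Set.Ico_subset_Icc_self ht
  have hlt : 16 / 9 * L * Δ ^ 2 < ρ := lt_of_le_of_lt (by nlinarith [mul_nonneg hL (sq_nonneg Δ)]) hρ
  obtain ⟨ε, hε, hερ⟩ : ∃ ε > 0, 16 / 9 * L * Δ ^ 2 + ε * (4 / 3 * Δ) < ρ := by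
    refine ⟨(ρ - 16 / 9 * L * Δ ^ 2) / (2 * (4 / 3 * Δ + 1)), by
      apply div_pos <;> nlinarith, ?_⟩
    have h : 0 < 4 / 3 * Δ + 1 := by positivity
    have : (ρ - 16 / 9 * L * Δ ^ 2) / (2 * (4 / 3 * Δ + 1)) * (4 / 3 * Δ)
        ≤ (ρ - 16 / 9 * L * Δ ^ 2) / 2 := by
      rw [div_mul_eq_mul_div, div_le_div_iff₀ (by positivity) (by positivity)]
      nlinarith
    linarith
  have hlo := hasGradientWithinAt_iff_isLittleO.1 (hg (γ t) (hmem t)).2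
  have hev := hlo.def hε
  have hle : 𝓝[>] t ≤ 𝓝[Set.Icc 0 1] t := by
    refine nhdsWithin_le_of_mem ?_
    refine Filter.mem_of_superset (Ioo_mem_nhdsGT ht.2) fun s hs => ⟨ht.1.trans hs.1.le, hs.2.le⟩
  have htend : Filter.Tendsto γ (𝓝[>] t) (𝓝[stiefel d r] (γ t)) :=
    tendsto_nhdsWithin_iff.2 ⟨(hγc t htI).mono_left hle, Filter.Eventually.of_forall hmem⟩
  filter_upwards [htend.eventually hev, Ioo_mem_nhdsGT ht.2] with z hz hzI
  have hzt : 0 < z - t := sub_pos.2 hzI.1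
  have hzI' : z ∈ Set.Icc (0 : ℝ) 1 := ⟨ht.1.trans hzI.1.le, hzI.2.le⟩
  rw [slope_def_field, div_lt_iff₀ hzt]
  have hb := hγ z hzI' t htI
  rw [abs_of_pos hzt] at hb
  have hgt : ‖g (γ t) - g x‖ ≤ 4 / 3 * L * Δ := by
    have := hγ t htI 0 (by simp)
    rw [h0, sub_zero, abs_of_nonneg ht.1] at this
    have h2 := hlip _ (hmem t) _ hx
    have h3 : ‖γ t - x‖ ≤ 4 / 3 * Δ := this.trans (by nlinarith [ht.2])
    nlinarith
  have hin : inner ℝ (g (γ t) - g x) (γ z - γ t) ≤ 4 / 3 * L * Δ * (4 / 3 * Δ * (z - t)) :=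
    (real_inner_le_norm _ _).trans (by gcongr)
  rw [Real.norm_eq_abs] at hz
  have hz' := (abs_le.1 hz).2
  have hεb := mul_le_mul_of_nonneg_left hb hε.le
  rw [inner_sub_left, inner_sub_right, inner_sub_right] at hin
  rw [inner_sub_right] at hz'
  nlinarith

end Nearest

/-! ### Means and ℓ² norms of families of vectors -/

section Averages

variable {n : ℕ} {E : Type*} [NormedAddCommGroup E]

/-- The `ℓ²` norm of a family of vectors. -/
def l2norm (z : Fin n → E) : ℝ := ‖(WithLp.toLp 2 z : PiLp 2 fun _ : Fin n => E)‖

lemma l2norm_nonneg (z : Fin n → E) : 0 ≤ l2norm z := norm_nonneg _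

lemma l2norm_sq (z : Fin n → E) : l2norm z ^ 2 = ∑ i, ‖z i‖ ^ 2 := by
  rw [l2norm, PiLp.norm_sq_eq_of_L2]

lemma sqDist_eq_l2norm_sq (z : Fin n → E) (c : E) :
    sqDist z c = l2norm (fun i => z i - c) ^ 2 := (l2norm_sq _).symm

lemma sqrt_sqDist (z : Fin n → E) (c : E) : √(sqDist z c) = l2norm fun i => z i - c := by
  rw [sqDist_eq_l2norm_sq, Real.sqrt_sq (l2norm_nonneg _)]

lemma sqDist_nonneg (z : Fin n → E) (c : E) : 0 ≤ sqDist z c :=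
  Finset.sum_nonneg fun _ _ => sq_nonneg _

lemma l2norm_add_le (z w : Fin n → E) : l2norm (fun i => z i + w i) ≤ l2norm z + l2norm w :=
  norm_add_le (WithLp.toLp 2 z : PiLp 2 fun _ : Fin n => E) (WithLp.toLp 2 w)

lemma l2norm_sub_le (z w : Fin n → E) : l2norm (fun i => z i - w i) ≤ l2norm z + l2norm w :=
  norm_sub_le (WithLp.toLp 2 z : PiLp 2 fun _ : Fin n => E) (WithLp.toLp 2 w)

lemma l2norm_mono {F : Type*} [NormedAddCommGroup F] {z : Fin n → E}
    {w : Fin n → F} (h : ∀ i, ‖z i‖ ≤ ‖w i‖) : l2norm z ≤ l2norm w := by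
  refine abs_le_of_sq_le_sq' ?_ (l2norm_nonneg _) |>.2
  rw [l2norm_sq, l2norm_sq]
  gcongr with i
  exact h i

lemma norm_le_l2norm (z : Fin n → E) (i : Fin n) : ‖z i‖ ≤ l2norm z := by
  refine abs_le_of_sq_le_sq' ?_ (l2norm_nonneg _) |>.2
  rw [l2norm_sq]
  exact Finset.single_le_sum (f := fun i => ‖z i‖ ^ 2) (fun _ _ => sq_nonneg _) (Finset.mem_univ i)

lemma l2norm_le_of_norm_le {z : Fin n → E} {B : ℝ} (hB : 0 ≤ B) (h : ∀ i, ‖z i‖ ≤ B) :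
    l2norm z ≤ √n * B := by
  refine abs_le_of_sq_le_sq' ?_ (by positivity) |>.2
  rw [l2norm_sq, mul_pow, Real.sq_sqrt (Nat.cast_nonneg n)]
  calc ∑ i, ‖z i‖ ^ 2 ≤ ∑ _i : Fin n, B ^ 2 := by gcongr with i; exact h i
    _ = n * B ^ 2 := by simp

variable [InnerProductSpace ℝ E]

lemma l2norm_smul (c : ℝ) (z : Fin n → E) : l2norm (fun i => c • z i) = |c| * l2norm z :=
  norm_smul c (WithLp.toLp 2 z : PiLp 2 fun _ : Fin n => E)

lemma avg_add (z w : Fin n → E) : avg (fun i => z i + w i) = avg z + avg w := by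
  simp [avg, Finset.sum_add_distrib]

lemma avg_sub (z w : Fin n → E) : avg (fun i => z i - w i) = avg z - avg w := by
  simp [avg, Finset.sum_sub_distrib, smul_sub]

lemma avg_smul (c : ℝ) (z : Fin n → E) : avg (fun i => c • z i) = c • avg z := by
  simp [avg, ← Finset.smul_sum, smul_comm c]

lemma avg_map {F : Type*} [AddCommGroup F] [Module ℝ F] (f : E →ₗ[ℝ] F) (z : Fin n → E) :
    avg (fun i => f (z i)) = f (avg z) := by
  simp [avg]

lemma norm_avg_le (z : Fin n → E) : ‖avg z‖ ≤ (n : ℝ)⁻¹ * ∑ i, ‖z i‖ := by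
  rw [avg, norm_smul, Real.norm_of_nonneg (by positivity)]
  gcongr
  exact norm_sum_le _ _

variable (hn : 1 ≤ n)
include hn

lemma avg_const (c : E) : avg (fun _ : Fin n => c) = c := by
  have : (n : ℝ) ≠ 0 := by positivity
  simp [avg, ← Nat.cast_smul_eq_nsmul ℝ, smul_smul, this]

lemma inv_mul_sum_le {f : Fin n → ℝ} {B : ℝ} (h : ∀ i, f i ≤ B) : (n : ℝ)⁻¹ * ∑ i, f i ≤ B := by
  have h1 : ∑ i, f i ≤ n * B := by
    calc ∑ i, f i ≤ ∑ _i : Fin n, B := by gcongr with i; exact h i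
      _ = n * B := by simp
  rw [inv_mul_le_iff₀ (by positivity)]
  exact h1

lemma norm_avg_le_of_norm_le {z : Fin n → E} {B : ℝ} (h : ∀ i, ‖z i‖ ≤ B) : ‖avg z‖ ≤ B :=
  (norm_avg_le z).trans (inv_mul_sum_le hn h)

lemma sum_sub_avg (z : Fin n → E) : ∑ i, (z i - avg z) = 0 := by
  have : (n : ℝ) ≠ 0 := by positivity
  simp [avg, ← Nat.cast_smul_eq_nsmul ℝ, smul_smul, this]

/-- Parallel-axis identity: the cross term vanishes since deviations from the mean sum to zero. -/
lemma sqDist_eq_add (x : Fin n → E) (c : E) :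
    sqDist x c = sqDist x (avg x) + n * ‖avg x - c‖ ^ 2 := by
  have h : ∀ i, ‖x i - c‖ ^ 2 = ‖x i - avg x‖ ^ 2 + 2 * inner ℝ (x i - avg x) (avg x - c)
      + ‖avg x - c‖ ^ 2 := fun i => by
    rw [← norm_add_sq_real]; congr 2; abel
  simp only [sqDist, h, Finset.sum_add_distrib, ← Finset.mul_sum, ← sum_inner, sum_sub_avg hn]
  simp

lemma sqDist_avg_le (x : Fin n → E) (c : E) : sqDist x (avg x) ≤ sqDist x c := by
  rw [sqDist_eq_add hn x c]; nlinarith [sq_nonneg ‖avg x - c‖, Nat.cast_nonneg (α := ℝ) n]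

lemma l2norm_sq_eq_add (x : Fin n → E) : l2norm x ^ 2 = sqDist x (avg x) + n * ‖avg x‖ ^ 2 := by
  simpa [sqDist, l2norm_sq] using sqDist_eq_add hn x 0

lemma l2norm_sub_avg_le (x : Fin n → E) : l2norm (fun i => x i - avg x) ≤ l2norm x := by
  refine abs_le_of_sq_le_sq' ?_ (l2norm_nonneg _) |>.2
  rw [← sqDist_eq_l2norm_sq, l2norm_sq_eq_add hn x]
  have : 0 ≤ n * ‖avg x‖ ^ 2 := by positivity
  linarith

end Averages

/-! ### Averaging with a doubly stochastic matrix -/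

section Mixing

variable {n : ℕ} {E : Type*} [NormedAddCommGroup E] [InnerProductSpace ℝ E]
  {V : Matrix (Fin n) (Fin n) ℝ}

lemma mix_sub (V : Matrix (Fin n) (Fin n) ℝ) (z w : Fin n → E) (i : Fin n) :
    mix V (fun j => z j - w j) i = mix V z i - mix V w i := by
  simp [mix, smul_sub]

lemma mix_mul (V V' : Matrix (Fin n) (Fin n) ℝ) (z : Fin n → E) :
    mix (V * V') z = mix V (mix V' z) := by
  funext i
  simp only [mix, Matrix.mul_apply, Finset.sum_smul, Finset.smul_sum, smul_smul]
  exact Finset.sum_comm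

lemma mix_one (z : Fin n → E) : mix 1 z = z := by
  funext i; simp [mix, Matrix.one_apply]

lemma mix_map {F : Type*} [AddCommGroup F] [Module ℝ F] (f : E →ₗ[ℝ] F)
    (V : Matrix (Fin n) (Fin n) ℝ) (z : Fin n → E) (i : Fin n) :
    mix V (fun j => f (z j)) i = f (mix V z i) := by
  simp [mix]

variable (hV : V ∈ doublyStochastic ℝ (Fin n))
include hV

lemma mix_const (c : E) (i : Fin n) : mix V (fun _ => c) i = c := by
  rw [mix, ← Finset.sum_smul, sum_row_of_mem_doublyStochastic hV, one_smul]

lemma mix_sub_const (z : Fin n → E) (c : E) (i : Fin n) :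
    mix V (fun j => z j - c) i = mix V z i - c := by
  rw [mix_sub, mix_const hV]

lemma avg_mix (z : Fin n → E) : avg (mix V z) = avg z := by
  rw [avg, avg]
  congr 1
  simp only [mix]
  rw [Finset.sum_comm]
  refine Finset.sum_congr rfl fun j _ => ?_
  rw [← Finset.sum_smul, sum_col_of_mem_doublyStochastic hV, one_smul]

lemma norm_mix_le (z : Fin n → E) (i : Fin n) : ‖mix V z i‖ ≤ ∑ j, V i j * ‖z j‖ := by
  refine (norm_sum_le _ _).trans (le_of_eq (Finset.sum_congr rfl fun j _ => ?_))
  rw [norm_smul, Real.norm_of_nonneg (nonneg_of_mem_doublyStochastic hV)]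

lemma sum_row_mul_le {f : Fin n → ℝ} {B : ℝ} (h : ∀ j, f j ≤ B) (i : Fin n) :
    ∑ j, V i j * f j ≤ B := by
  calc ∑ j, V i j * f j ≤ ∑ j, V i j * B := Finset.sum_le_sum fun j _ =>
        mul_le_mul_of_nonneg_left (h j) (nonneg_of_mem_doublyStochastic hV)
    _ = B := by rw [← Finset.sum_mul, sum_row_of_mem_doublyStochastic hV, one_mul]

lemma norm_mix_sq_le (z : Fin n → E) (i : Fin n) : ‖mix V z i‖ ^ 2 ≤ ∑ j, V i j * ‖z j‖ ^ 2 := by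
  have h1 := norm_mix_le hV z i
  have h2 : (∑ j, V i j * ‖z j‖) ^ 2 ≤ ∑ j, V i j * ‖z j‖ ^ 2 := by
    have := (even_two.convexOn_pow (𝕜 := ℝ)).map_sum_le (t := Finset.univ) (w := V i)
      (p := fun j => ‖z j‖) (fun j _ => nonneg_of_mem_doublyStochastic hV)
      (sum_row_of_mem_doublyStochastic hV i) (fun _ _ => Set.mem_univ _)
    simpa using this
  exact (pow_le_pow_left₀ (norm_nonneg _) h1 2).trans h2

lemma sum_sum_mul_eq (f : Fin n → ℝ) : ∑ i, ∑ j, V i j * f j = ∑ j, f j := by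
  rw [Finset.sum_comm]
  refine Finset.sum_congr rfl fun j _ => ?_
  rw [← Finset.sum_mul, sum_col_of_mem_doublyStochastic hV, one_mul]

lemma l2norm_mix_le (z : Fin n → E) : l2norm (mix V z) ≤ l2norm z := by
  refine abs_le_of_sq_le_sq' ?_ (l2norm_nonneg _) |>.2
  rw [l2norm_sq, l2norm_sq, ← sum_sum_mul_eq hV fun j => ‖z j‖ ^ 2]
  exact Finset.sum_le_sum fun i _ => norm_mix_sq_le hV z i

end Mixing

/-! ### Spectral contraction on vectors of mean zero -/

section Lambda

variable {n : ℕ} {W : Matrix (Fin n) (Fin n) ℝ}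

lemma lambda₂_nonneg (W : Matrix (Fin n) (Fin n) ℝ) : 0 ≤ lambda₂ W :=
  LinearMap.singularValues_nonneg _ _

variable (hW : W ∈ doublyStochastic ℝ (Fin n)) (hWsymm : W.IsSymm) (hWconn : lambda₂ W < 1)
include hW hWsymm hWconn

/-- On vectors of mean zero, a symmetric doubly stochastic matrix has norm at most `λ₂`. -/
lemma norm_toEuclideanLin_le_lambda₂ (w : EuclideanSpace ℝ (Fin n)) (hw : ∑ i, w i = 0) :
    ‖Matrix.toEuclideanLin W w‖ ^ 2 ≤ lambda₂ W ^ 2 * ‖w‖ ^ 2 := by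
  rcases Nat.eq_zero_or_pos n with rfl | hn
  · simp [Subsingleton.elim w 0]
  set T := Matrix.toEuclideanLin W with hT
  have hsym := T.isSymmetric_adjoint_comp_self
  have hfin : Module.finrank ℝ (EuclideanSpace ℝ (Fin n)) = n := finrank_euclideanSpace_fin
  set b := hsym.eigenvectorBasis hfin with hb
  have hbA : ∀ i, (T.adjoint ∘ₗ T) (b i) = hsym.eigenvalues hfin i • b i := fun i =>
    hsym.apply_eigenvectorBasis hfin i
  have hadj : T.adjoint = T := by
    rw [hT, ← Matrix.toEuclideanLin_conjTranspose_eq_adjoint, Matrix.conjTranspose_eq_transpose_of_trivial,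
      hWsymm.eq]
  set e : EuclideanSpace ℝ (Fin n) := WithLp.toLp 2 1 with he
  have hTe : T e = e := by
    rw [he, hT, Matrix.toLpLin_toLp, Matrix.toLin'_apply, mulVec_one_of_mem_doublyStochastic hW]
  have hAe : (T.adjoint ∘ₗ T) e = e := by rw [LinearMap.comp_apply, hadj, hTe, hTe]
  have hi0 : ∀ i : Fin n, i ≠ ⟨0, hn⟩ → hsym.eigenvalues hfin i ≤ lambda₂ W ^ 2 := by
    intro i hi
    rw [← T.sq_singularValues_fin hfin i]
    have h1 : 1 ≤ (i : ℕ) := Nat.one_le_iff_ne_zero.2 fun h => hi (Fin.ext h)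
    exact pow_le_pow_left₀ (T.singularValues_nonneg _) (T.singularValues_antitone h1) 2
  have hlt : lambda₂ W ^ 2 < 1 := by nlinarith [lambda₂_nonneg W]
  -- For i ≠ 0, `b i` and `e` are eigenvectors of TᵀT for different eigenvalues, one at most λ₂² < 1
  -- and the other 1. So `e` is parallel to `b 0`, and a vector of mean zero has no component along
  -- `b 0`.
  have horth : ∀ i : Fin n, i ≠ ⟨0, hn⟩ → inner ℝ (b i) e = 0 := by
    intro i hi
    have h1 : hsym.eigenvalues hfin i * inner ℝ (b i) e = inner ℝ (b i) e := by
      rw [← real_inner_smul_left, ← hbA, hsym, hAe]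
    have h2 := hi0 i hi
    have h3 : (1 - hsym.eigenvalues hfin i) * inner ℝ (b i) e = 0 := by linarith
    exact (mul_eq_zero.1 h3).resolve_left (by linarith)
  have hew : inner ℝ e w = 0 := by
    simp [he, PiLp.inner_apply, hw]
  have hb0 : inner ℝ (b ⟨0, hn⟩) w = 0 := by
    have h1 := b.sum_inner_mul_inner e w
    rw [hew, Finset.sum_eq_single ⟨0, hn⟩ (fun i _ hi => by
      rw [real_inner_comm, horth i hi, zero_mul]) (by simp)] at h1
    refine (mul_eq_zero.1 h1).resolve_left fun h => ?_
    have h2 := b.sum_sq_inner_right e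
    rw [Finset.sum_eq_zero] at h2
    · have h4 : e = 0 := by simpa using h2.symm
      have h5 := congrArg (fun v : EuclideanSpace ℝ (Fin n) => v ⟨0, hn⟩) h4
      simp [he] at h5
    · intro i _
      by_cases hi : i = ⟨0, hn⟩
      · rw [hi, real_inner_comm, h]; norm_num
      · rw [horth i hi]; norm_num
  calc ‖T w‖ ^ 2 = inner ℝ ((T.adjoint ∘ₗ T) w) w := by
        rw [LinearMap.comp_apply, LinearMap.adjoint_inner_left, real_inner_self_eq_norm_sq]
    _ = ∑ i, inner ℝ ((T.adjoint ∘ₗ T) w) (b i) * inner ℝ (b i) w :=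
        (b.sum_inner_mul_inner _ _).symm
    _ = ∑ i, hsym.eigenvalues hfin i * inner ℝ (b i) w ^ 2 := by
        refine Finset.sum_congr rfl fun i _ => ?_
        rw [hsym, hbA, real_inner_smul_right, real_inner_comm w (b i)]; ring
    _ ≤ ∑ i, lambda₂ W ^ 2 * inner ℝ (b i) w ^ 2 := by
        refine Finset.sum_le_sum fun i _ => ?_
        by_cases hi : i = ⟨0, hn⟩
        · rw [hi, hb0]; norm_num
        · exact mul_le_mul_of_nonneg_right (hi0 i hi) (sq_nonneg _)
    _ = lambda₂ W ^ 2 * ‖w‖ ^ 2 := by rw [← Finset.mul_sum, b.sum_sq_inner_right]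

variable {ι : Type*} [Fintype ι]

lemma l2norm_mix_le_of_sum_eq_zero (z : Fin n → EuclideanSpace ℝ ι) (hz : ∑ i, z i = 0) :
    l2norm (mix W z) ≤ lambda₂ W * l2norm z := by
  refine abs_le_of_sq_le_sq' ?_ (mul_nonneg (lambda₂_nonneg W) (l2norm_nonneg _)) |>.2
  rw [mul_pow, l2norm_sq, l2norm_sq]
  simp only [EuclideanSpace.real_norm_sq_eq]
  rw [Finset.sum_comm, Finset.sum_comm (s := Finset.univ (α := Fin n)), Finset.mul_sum]
  refine Finset.sum_le_sum fun c _ => ?_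
  have h := norm_toEuclideanLin_le_lambda₂ hW hWsymm hWconn (WithLp.toLp 2 fun i => z i c) (by
    simpa using congrArg (fun v : EuclideanSpace ℝ ι => v c) hz)
  rw [EuclideanSpace.real_norm_sq_eq, EuclideanSpace.real_norm_sq_eq] at h
  refine le_trans (le_of_eq (Finset.sum_congr rfl fun i _ => ?_)) h
  simp [mix, Matrix.mulVec, dotProduct]

lemma l2norm_mix_pow_le_of_sum_eq_zero (k : ℕ) (z : Fin n → EuclideanSpace ℝ ι)
    (hz : ∑ i, z i = 0) : l2norm (mix (W ^ k) z) ≤ lambda₂ W ^ k * l2norm z := by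
  rcases Nat.eq_zero_or_pos n with rfl | hn
  · have h0 : ∀ w : Fin 0 → EuclideanSpace ℝ ι, l2norm w = 0 := fun w => by
      simpa using l2norm_sq w
    simp [h0]
  induction k with
  | zero => simp [mix_one]
  | succ k ih =>
    rw [pow_succ', mix_mul, pow_succ', mul_assoc]
    have hs : ∑ i, mix (W ^ k) z i = 0 := by
      have h1 := avg_mix (pow_mem hW k) z
      rw [avg, avg, hz, smul_zero] at h1
      exact (smul_eq_zero.1 h1).resolve_left (by positivity)
    exact (l2norm_mix_le_of_sum_eq_zero hW hWsymm hWconn _ hs).trans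
      (mul_le_mul_of_nonneg_left ih (lambda₂_nonneg W))

lemma l2norm_mix_pow_sub_avg_le (hn : 1 ≤ n) (k : ℕ) (z : Fin n → EuclideanSpace ℝ ι) :
    l2norm (fun i => mix (W ^ k) z i - avg z) ≤ lambda₂ W ^ k * l2norm fun i => z i - avg z := by
  have := l2norm_mix_pow_le_of_sum_eq_zero hW hWsymm hWconn k _ (sum_sub_avg hn z)
  simpa only [funext fun i => mix_sub_const (pow_mem hW k) z (avg z) i] using this

omit hW hWsymm in
lemma lambda₂_pow_le (hn : 1 ≤ n) {k : ℕ} (hk1 : 1 ≤ k)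
    (hk : ⌈Real.logb (lambda₂ W) (1 / (2 * √(n : ℝ)))⌉₊ ≤ k) :
    lambda₂ W ^ k ≤ 1 / (2 * √(n : ℝ)) := by
  have hn' : (0 : ℝ) < √n := Real.sqrt_pos.2 (by positivity)
  rcases (lambda₂_nonneg W).eq_or_lt with h | h
  -- For λ₂ = 0 the logarithmic hypothesis is empty, and `1 ≤ k` makes the power vanish.
  · rw [← h, zero_pow (by omega)]; positivity
  · have h1 := Nat.ceil_le.1 hk
    rw [Real.logb_le_iff_le_rpow_of_base_lt_one h hWconn (by positivity)] at h1
    simpa using h1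

end Lambda

/-! ### Induced mean versus Euclidean mean -/

section InducedMean

variable {n d r : ℕ}

/-- By the parallel-axis identity the objective is n‖x̄ − c‖² plus a constant. -/
lemma IsIAM.isNearest (hn : 1 ≤ n) {x : Fin n → Mat d r} {c : Mat d r} (h : IsIAM x c) :
    IsNearest (avg x) c := by
  refine ⟨h.1, fun z hz => ?_⟩
  have h1 := h.2 z hz
  rw [sqDist_eq_add hn x c, sqDist_eq_add hn x z] at h1
  have h2 : (n : ℝ) * ‖avg x - c‖ ^ 2 ≤ n * ‖avg x - z‖ ^ 2 := by linarith
  exact abs_le_of_sq_le_sq' (le_of_mul_le_mul_left h2 (by positivity)) (norm_nonneg _) |>.2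

/-- The induced mean differs from the Euclidean mean only to second order. -/
lemma IsIAM.norm_avg_sub_le (hn : 1 ≤ n) {R : Mat d r → Mat d r → Mat d r} (hR : IsRetraction R)
    {x : Fin n → Mat d r} (hx : ∀ i, x i ∈ stiefel d r) {c : Mat d r} (h : IsIAM x c) :
    ‖avg x - c‖ ≤ 1 / 2 * ((n : ℝ)⁻¹ * sqDist x c) := by
  -- x̄ − c is normal at c, so it is the average of the normal parts of the xᵢ − c, each of them
  -- quadratic.
  have h1 : avg x - c = avg fun i => normalProj c (x i - c) := by
    have h2 := avg_map (normalProjₗ c) fun i => x i - c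
    rw [avg_sub, avg_const hn, normalProjₗ_apply, (h.isNearest hn).normalProj_eq hR] at h2
    exact h2.symm
  rw [h1]
  refine (norm_avg_le _).trans ?_
  rw [sqDist, mul_left_comm]
  refine mul_le_mul_of_nonneg_left ?_ (by positivity)
  rw [Finset.mul_sum]
  exact Finset.sum_le_sum fun i _ => norm_normalProj_sub_le h.1 (hx i)

end InducedMean

/-! ### One perturbed consensus step in the local region -/

section Consensus

variable {n d r : ℕ} {V : Matrix (Fin n) (Fin n) ℝ} {R : Mat d r → Mat d r → Mat d r}
  {ε M α δ₁ δ₂ τ : ℝ}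

/-- `V` is doubly stochastic and contracts deviations from the mean by `1 / (2√n)`. -/
def IsHalfMixing (d r : ℕ) {n : ℕ} (V : Matrix (Fin n) (Fin n) ℝ) : Prop :=
  V ∈ doublyStochastic ℝ (Fin n) ∧ ∀ z : Fin n → Mat d r,
    l2norm (fun i => mix V z i - avg z) ≤ 1 / (2 * √n) * l2norm fun i => z i - avg z

lemma IsHalfMixing.half (hn : 1 ≤ n) (hV : IsHalfMixing d r V) (z : Fin n → Mat d r) :
    l2norm (fun i => mix V z i - avg z) ≤ 1 / 2 * l2norm fun i => z i - avg z := by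
  refine (hV.2 z).trans ?_
  have : (1 : ℝ) ≤ √n := Real.one_le_sqrt.2 (by exact_mod_cast hn)
  gcongr
  · exact l2norm_nonneg _
  · linarith

/-- The identity approximates the retraction to second order. -/
def HasSecondOrderBound (R : Mat d r → Mat d r → Mat d r) (ε M : ℝ) : Prop :=
  ∀ x ∈ stiefel d r, ∀ ξ ∈ tangent x, ‖ξ‖ < ε → ‖R x ξ - x - ξ‖ ≤ M * ‖ξ‖ ^ 2

/-- One Riemannian consensus step perturbed by the directions `w`. -/
def perturbedStep (V : Matrix (Fin n) (Fin n) ℝ) (R : Mat d r → Mat d r → Mat d r) (α : ℝ)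
    (x w : Fin n → Mat d r) (i : Fin n) : Mat d r :=
  R (x i) (α • tangentProj (x i) (mix V x i) - tangentProj (x i) (w i))

lemma perturbedStep_direction {x : Mat d r} (hx : x ∈ stiefel d r) (α : ℝ) (z w : Mat d r) :
    α • tangentProj x z - tangentProj x w = tangentProj x (α • (z - x) - w) := by
  simp only [← tangentProjₗ_apply, map_sub, map_smul]
  rw [tangentProjₗ_apply x x, tangentProj_self hx, sub_zero]

/-- Constants for which a perturbed step with step size `α` is well behaved. -/
structure StepConstants (R : Mat d r → Mat d r → Mat d r) (ε M α τ : ℝ) : Prop where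
  bound : HasSecondOrderBound R ε M
  ε_pos : 0 < ε
  M_pos : 0 < M
  α_pos : 0 < α
  α_le : α ≤ 1 / 10
  α_le_ε : α ≤ ε
  Mα_le : M * α ≤ 1 / 60
  τ_le_ε : τ ≤ ε / 2
  Mτ_le : 2 * M * τ ≤ 1

lemma StepConstants.expansion (h : StepConstants R ε M α τ) {x z w : Mat d r}
    (hx : x ∈ stiefel d r) (hz : ‖z - x‖ ≤ 1 / 3) (hw : ‖w‖ ≤ τ) :
    ‖R x (α • tangentProj x z - tangentProj x w) - x
      - (α • tangentProj x (z - x) - tangentProj x w)‖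
      ≤ 2 * M * (α ^ 2 * ‖z - x‖ ^ 2 + ‖w‖ ^ 2) := by
  have h1 : α • tangentProj x (z - x) - tangentProj x w = tangentProj x (α • (z - x) - w) := by
    rw [← perturbedStep_direction hx]
    simp only [← tangentProjₗ_apply, map_sub]
    rw [tangentProjₗ_apply x x, tangentProj_self hx, sub_zero]
  rw [h1, perturbedStep_direction hx]
  have hα := h.α_pos
  have hn : ‖tangentProj x (α • (z - x) - w)‖ ≤ α * ‖z - x‖ + ‖w‖ := by
    refine (norm_tangentProj_le hx _).trans ((norm_sub_le _ _).trans ?_)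
    rw [norm_smul, Real.norm_of_nonneg hα.le]
  -- The norm is at most α/3 + τ ≤ ε/3 + ε/2.
  have hlt : ‖tangentProj x (α • (z - x) - w)‖ < ε := by
    nlinarith [h.α_le_ε, h.τ_le_ε, h.ε_pos]
  refine (h.bound x hx _ (tangentProj_mem_tangent hx _) hlt).trans ?_
  have h2 : ‖tangentProj x (α • (z - x) - w)‖ ^ 2 ≤ 2 * (α ^ 2 * ‖z - x‖ ^ 2 + ‖w‖ ^ 2) := by
    have := pow_le_pow_left₀ (norm_nonneg _) hn 2
    nlinarith [sq_nonneg (α * ‖z - x‖ - ‖w‖)]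
  calc M * ‖tangentProj x (α • (z - x) - w)‖ ^ 2
      ≤ M * (2 * (α ^ 2 * ‖z - x‖ ^ 2 + ‖w‖ ^ 2)) := by gcongr; exact h.M_pos.le
    _ = _ := by ring

/-- Smallness of Mα and Mτ turns the quadratic remainder into a linear one; ‖w‖ is counted once for
its projection and once for the remainder. -/
lemma StepConstants.coarse_expansion (h : StepConstants R ε M α τ) {x z w : Mat d r}
    (hx : x ∈ stiefel d r) (hz : ‖z - x‖ ≤ 1 / 3) (hw : ‖w‖ ≤ τ) :
    ‖R x (α • tangentProj x z - tangentProj x w) - x - α • tangentProj x (z - x)‖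
      ≤ α / 60 * ‖z - x‖ + 2 * ‖w‖ := by
  have h1 := h.expansion hx hz hw
  have h2 : ‖tangentProj x w‖ ≤ ‖w‖ := norm_tangentProj_le hx w
  have h3 := norm_sub_le (R x (α • tangentProj x z - tangentProj x w) - x
      - (α • tangentProj x (z - x) - tangentProj x w)) (tangentProj x w)
  rw [show R x (α • tangentProj x z - tangentProj x w) - x
      - (α • tangentProj x (z - x) - tangentProj x w) - tangentProj x w
      = R x (α • tangentProj x z - tangentProj x w) - x - α • tangentProj x (z - x) by abel] at h3
  have h4 : 2 * M * (α ^ 2 * ‖z - x‖ ^ 2) ≤ α / 60 * ‖z - x‖ := by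
    have e1 : M * α * (2 * ‖z - x‖) ≤ 1 / 60 * 1 := by
      gcongr
      · exact h.Mα_le
      · linarith
    have := mul_le_mul_of_nonneg_right e1 (mul_nonneg h.α_pos.le (norm_nonneg (z - x)))
    nlinarith
  have h5 : 2 * M * ‖w‖ ^ 2 ≤ ‖w‖ := by
    have e1 : 2 * M * ‖w‖ ≤ 1 := le_trans (by gcongr; linarith [h.M_pos]) h.Mτ_le
    nlinarith [norm_nonneg w]
  linarith

lemma StepConstants.norm_step_sub_le (h : StepConstants R ε M α τ) {x z w : Mat d r}
    (hx : x ∈ stiefel d r) (hz : ‖z - x‖ ≤ 1 / 3) (hw : ‖w‖ ≤ τ) :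
    ‖R x (α • tangentProj x z - tangentProj x w) - x‖ ≤ 2 * α * ‖z - x‖ + 2 * ‖w‖ := by
  have h1 := h.coarse_expansion hx hz hw
  have h2 : ‖α • tangentProj x (z - x)‖ ≤ α * ‖z - x‖ := by
    rw [norm_smul, Real.norm_of_nonneg h.α_pos.le]
    gcongr
    · exact h.α_pos.le
    · exact norm_tangentProj_le hx _
  have h3 := norm_add_le (R x (α • tangentProj x z - tangentProj x w) - x
    - α • tangentProj x (z - x)) (α • tangentProj x (z - x))
  rw [sub_add_cancel] at h3
  nlinarith [h.α_pos, norm_nonneg (z - x), mul_nonneg h.α_pos.le (norm_nonneg (z - x))]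

lemma norm_normalProj_mix_sub_le (hV : V ∈ doublyStochastic ℝ (Fin n)) {x : Fin n → Mat d r}
    (hx : ∀ i, x i ∈ stiefel d r) (i : Fin n) :
    ‖normalProj (x i) (mix V x i - x i)‖ ≤ 1 / 2 * ∑ j, V i j * ‖x j - x i‖ ^ 2 := by
  rw [← mix_sub_const hV, ← normalProjₗ_apply, ← mix_map]
  refine (norm_mix_le hV _ i).trans ?_
  rw [Finset.mul_sum]
  refine Finset.sum_le_sum fun j _ => ?_
  have := mul_le_mul_of_nonneg_left (norm_normalProj_sub_le (hx i) (hx j))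
    (nonneg_of_mem_doublyStochastic hV (i := i) (j := j))
  rw [normalProjₗ_apply]; linarith

lemma avg_norm_normalProj_mix_sub_le (hV : V ∈ doublyStochastic ℝ (Fin n)) {x : Fin n → Mat d r}
    (hx : ∀ i, x i ∈ stiefel d r) (c : Mat d r) :
    (n : ℝ)⁻¹ * ∑ i, ‖normalProj (x i) (mix V x i - x i)‖ ≤ 2 * ((n : ℝ)⁻¹ * sqDist x c) := by
  rw [mul_left_comm]
  refine mul_le_mul_of_nonneg_left ?_ (by positivity)
  calc ∑ i, ‖normalProj (x i) (mix V x i - x i)‖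
      ≤ ∑ i, ∑ j, (V i j * ‖x j - c‖ ^ 2 + V i j * ‖x i - c‖ ^ 2) := by
        refine Finset.sum_le_sum fun i _ => (norm_normalProj_mix_sub_le hV hx i).trans ?_
        rw [Finset.mul_sum]
        refine Finset.sum_le_sum fun j _ => ?_
        have h1 : ‖x j - x i‖ ≤ ‖x j - c‖ + ‖x i - c‖ := by
          rw [← sub_sub_sub_cancel_right (x j) (x i) c]; exact norm_sub_le _ _
        have h2 := pow_le_pow_left₀ (norm_nonneg _) h1 2
        have h3 : 1 / 2 * ‖x j - x i‖ ^ 2 ≤ ‖x j - c‖ ^ 2 + ‖x i - c‖ ^ 2 := by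
          nlinarith [sq_nonneg (‖x j - c‖ - ‖x i - c‖)]
        have := mul_le_mul_of_nonneg_left h3
          (nonneg_of_mem_doublyStochastic hV (i := i) (j := j))
        linarith
    _ = 2 * sqDist x c := by
        simp only [Finset.sum_add_distrib]
        rw [sum_sum_mul_eq hV fun j => ‖x j - c‖ ^ 2]
        simp only [← Finset.sum_mul, sum_row_of_mem_doublyStochastic hV, one_mul]
        rw [sqDist]; ring

lemma l2norm_mix_sub_le (hV : V ∈ doublyStochastic ℝ (Fin n)) (x : Fin n → Mat d r) (c : Mat d r) :
    l2norm (fun i => mix V x i - x i) ≤ 2 * l2norm fun i => x i - c := by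
  have h := l2norm_sub_le (mix V fun j => x j - c) fun i => x i - c
  have h2 := l2norm_mix_le hV fun j => x j - c
  simp only [funext (mix_sub_const hV x c), sub_sub_sub_cancel_right] at h h2
  linarith

/-- Double stochasticity makes the mean of mix V x − x zero, so the average feels mixing only
through its normal component and the retraction remainder. -/
lemma avg_perturbedStep_sub (hV : V ∈ doublyStochastic ℝ (Fin n)) (α : ℝ) (x w : Fin n → Mat d r) :
    avg (perturbedStep V R α x w) - avg x
      = avg fun i => (perturbedStep V R α x w i - x i - α • tangentProj (x i) (mix V x i - x i))
        - α • normalProj (x i) (mix V x i - x i) := by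
  have h : (fun i => (perturbedStep V R α x w i - x i
      - α • tangentProj (x i) (mix V x i - x i)) - α • normalProj (x i) (mix V x i - x i))
      = fun i => (perturbedStep V R α x w i - x i) - α • (mix V x i - x i) := by
    funext i; rw [tangentProj_eq]; module
  rw [h, avg_sub, avg_sub, avg_smul, avg_sub, avg_mix hV]; simp

/-- Points of the consensus region, with the bounds on the two radii. -/
structure RegionPoint (δ₁ δ₂ : ℝ) (x : Fin n → Mat d r) : Prop where
  n_pos : 1 ≤ n
  δ₁_pos : 0 < δ₁
  δ₁_le : δ₁ ≤ δ₂ / 5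
  δ₂_le : δ₂ ≤ 1 / 6
  mem : x ∈ consensusRegion n d r δ₁ δ₂

namespace RegionPoint

variable {x : Fin n → Mat d r} (hx : RegionPoint δ₁ δ₂ x)
include hx

lemma l2norm_le : l2norm (fun i => x i - avg x) ≤ √n * δ₁ := by
  refine abs_le_of_sq_le_sq' ?_ (mul_nonneg (Real.sqrt_nonneg _) hx.δ₁_pos.le) |>.2
  rw [← sqDist_eq_l2norm_sq, mul_pow, Real.sq_sqrt (Nat.cast_nonneg n)]
  exact hx.mem.2.1

/-- The factor 1/(2√n) turns the ℓ² radius √n δ₁ into a bound at each single node; this is what the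
number k of rounds is for. -/
lemma norm_mix_sub_avg_le (hV : IsHalfMixing d r V) (i : Fin n) :
    ‖mix V x i - avg x‖ ≤ δ₁ / 2 := by
  refine (norm_le_l2norm (fun i => mix V x i - avg x) i).trans ((hV.2 x).trans ?_)
  have hn : 0 < √(n : ℝ) := Real.sqrt_pos.2 (by have := hx.n_pos; positivity)
  calc 1 / (2 * √n) * l2norm (fun i => x i - avg x) ≤ 1 / (2 * √n) * (√n * δ₁) := by
        gcongr; exact hx.l2norm_le
    _ = δ₁ / 2 := by field_simp

lemma norm_mix_sub_le (hV : IsHalfMixing d r V) (i : Fin n) :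
    ‖mix V x i - x i‖ ≤ 2 * δ₂ := by
  have h1 := hx.norm_mix_sub_avg_le hV i
  have h2 := hx.mem.2.2 i
  have h3 := norm_sub_le (mix V x i - avg x) (x i - avg x)
  rw [sub_sub_sub_cancel_right] at h3
  linarith [hx.δ₁_pos, hx.δ₁_le]

lemma norm_mix_sub_le_third (hV : IsHalfMixing d r V) (i : Fin n) :
    ‖mix V x i - x i‖ ≤ 1 / 3 := by
  linarith [hx.norm_mix_sub_le hV i, hx.δ₂_le]

lemma norm_sub_le (i j : Fin n) : ‖x j - x i‖ ≤ 2 * δ₂ := by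
  have h3 := _root_.norm_sub_le (x j - avg x) (x i - avg x)
  rw [sub_sub_sub_cancel_right] at h3
  linarith [hx.mem.2.2 i, hx.mem.2.2 j]

lemma norm_normalProj_le (hV : IsHalfMixing d r V) (i : Fin n) :
    ‖normalProj (x i) (mix V x i - x i)‖ ≤ δ₂ / 3 := by
  have h := sum_row_mul_le hV.1 (f := fun j => ‖x j - x i‖ ^ 2) (B := (2 * δ₂) ^ 2)
    (fun j => pow_le_pow_left₀ (norm_nonneg _) (hx.norm_sub_le i j) 2) i
  have h2 := norm_normalProj_mix_sub_le hV.1 hx.mem.1 i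
  nlinarith [hx.δ₂_le, hx.δ₁_pos, hx.δ₁_le]

/-- One of the two factors of ‖x j − x i‖² is bounded by 2δ₂ ≤ 1/3, so the quadratic normal part
becomes linear with a small factor. -/
lemma l2norm_normalProj_le (hV : IsHalfMixing d r V) :
    l2norm (fun i => normalProj (x i) (mix V x i - x i))
      ≤ 1 / 3 * l2norm fun i => x i - avg x := by
  have hδ : 0 < δ₂ := by linarith [hx.δ₁_pos, hx.δ₁_le]
  have h1 : l2norm (fun i => normalProj (x i) (mix V x i - x i))
      ≤ l2norm (fun i => δ₂ • (mix V (fun j => ‖x j - avg x‖) i + ‖x i - avg x‖)) := by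
    refine l2norm_mono fun i => (norm_normalProj_mix_sub_le hV.1 hx.mem.1 i).trans ?_
    refine le_trans ?_ (Real.le_norm_self _)
    have h2 : ∑ j, V i j * ‖x j - x i‖ ^ 2 ≤ ∑ j, 2 * δ₂ * (V i j * ‖x j - avg x‖
        + V i j * ‖x i - avg x‖) := by
      refine Finset.sum_le_sum fun j _ => ?_
      have h3 := _root_.norm_sub_le (x j - avg x) (x i - avg x)
      rw [sub_sub_sub_cancel_right] at h3
      have h4 : ‖x j - x i‖ ^ 2 ≤ 2 * δ₂ * (‖x j - avg x‖ + ‖x i - avg x‖) := by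
        rw [sq]; exact mul_le_mul (hx.norm_sub_le i j) h3 (norm_nonneg _) (by linarith)
      have := mul_le_mul_of_nonneg_left h4
        (nonneg_of_mem_doublyStochastic hV.1 (i := i) (j := j))
      linarith
    rw [← Finset.mul_sum, Finset.sum_add_distrib, ← Finset.sum_mul,
      sum_row_of_mem_doublyStochastic hV.1, one_mul] at h2
    simp only [mix, smul_eq_mul]
    linarith
  refine h1.trans ?_
  rw [l2norm_smul, abs_of_pos hδ]
  have h2 := l2norm_add_le (mix V fun j => ‖x j - avg x‖) fun i => ‖x i - avg x‖
  have h3 := l2norm_mix_le hV.1 fun j => ‖x j - avg x‖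
  have h4 : l2norm (fun j => ‖x j - avg x‖) ≤ l2norm fun j => x j - avg x :=
    l2norm_mono fun i => by simp
  nlinarith [hx.δ₂_le, l2norm_nonneg fun i => x i - avg x]

variable (hV : IsHalfMixing d r V) (hc : StepConstants R ε M α τ) {w : Fin n → Mat d r}
  (hw : ∀ i, ‖w i‖ ≤ τ)
include hV hc hw

/-- 11/30 = 1/30 + 1/3: the retraction error is α/60 times ‖mix V x − x‖ ≤ 2‖x − x̄‖, and the normal
part costs α/3. -/
lemma l2norm_step_sub_le (c : Mat d r) :
    l2norm (fun i => perturbedStep V R α x w i - c)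
      ≤ l2norm (fun i => (x i - c) + α • (mix V x i - x i))
        + α * (11 / 30) * l2norm (fun i => x i - avg x) + 2 * l2norm w := by
  set a : Fin n → Mat d r := fun i => mix V x i - x i with ha
  set N : Fin n → Mat d r := fun i => normalProj (x i) (a i) with hN
  set q : Fin n → Mat d r := fun i => perturbedStep V R α x w i - x i
    - α • tangentProj (x i) (a i) with hq
  have hα := hc.α_pos
  have h1 : (fun i => perturbedStep V R α x w i - c)
      = fun i => ((x i - c) + α • a i) + (q i - α • N i) := by
    funext i
    simp only [hq, hN, tangentProj_eq]; module
  have h2 : l2norm q ≤ α / 60 * l2norm a + 2 * l2norm w := by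
    have : l2norm q ≤ l2norm fun i => (α / 60) • ‖a i‖ + (2 : ℝ) • ‖w i‖ := by
      refine l2norm_mono fun i => le_trans ?_ (Real.le_norm_self _)
      exact hc.coarse_expansion (hx.mem.1 i) (hx.norm_mix_sub_le_third hV i) (hw i)
    refine this.trans ((l2norm_add_le _ _).trans ?_)
    rw [l2norm_smul, l2norm_smul, abs_of_pos (by positivity), abs_of_pos two_pos]
    have e1 : l2norm (fun i => ‖a i‖) ≤ l2norm a := l2norm_mono fun i => by simp
    have e2 : l2norm (fun i => ‖w i‖) ≤ l2norm w := l2norm_mono fun i => by simp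
    gcongr
  have h3 := l2norm_mix_sub_le hV.1 x (avg x)
  have h4 := hx.l2norm_normalProj_le hV
  have h5 := l2norm_add_le (fun i => (x i - c) + α • a i) fun i => q i - α • N i
  have h6 := l2norm_sub_le q fun i => α • N i
  rw [l2norm_smul, abs_of_pos hα] at h6
  rw [h1]
  nlinarith [l2norm_nonneg fun i => x i - avg x]

/-- Mixing gains α/2, the errors cost 11α/30, and 2α/15 remains. -/
lemma l2norm_step_sub_avg_le :
    l2norm (fun i => perturbedStep V R α x w i - avg x)
      ≤ (1 - 2 / 15 * α) * l2norm (fun i => x i - avg x) + 2 * l2norm w := by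
  have h := hx.l2norm_step_sub_le hV hc hw (avg x)
  have h1 : (fun i => (x i - avg x) + α • (mix V x i - x i))
      = fun i => (1 - α) • (x i - avg x) + α • (mix V x i - avg x) := by funext i; module
  have h2 := l2norm_add_le (fun i => (1 - α) • (x i - avg x)) fun i => α • (mix V x i - avg x)
  rw [l2norm_smul, l2norm_smul, abs_of_pos hc.α_pos, abs_of_nonneg (by linarith [hc.α_le]), ← h1]
    at h2
  have h3 := mul_le_mul_of_nonneg_left (hV.half hx.n_pos x) hc.α_pos.le
  linarith

/-- The perturbed step contracts the distance to the induced mean. -/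
lemma l2norm_step_sub_iam_le (hR : IsRetraction R) {c : Mat d r} (hcx : IsIAM x c) :
    l2norm (fun i => perturbedStep V R α x w i - c)
      ≤ (1 - α / 30) * l2norm (fun i => x i - c) + 2 * l2norm w := by
  have hn : (0 : ℝ) < n := by have := hx.n_pos; positivity
  have h := hx.l2norm_step_sub_le hV hc hw c
  have hα := hc.α_pos
  have hα1 := hc.α_le
  set b := l2norm fun i => x i - avg x
  set e := l2norm fun i => x i - c with he
  have hb0 : 0 ≤ b := l2norm_nonneg _
  have he0 : 0 ≤ e := l2norm_nonneg _
  have hsq : e ^ 2 = b ^ 2 + n * ‖avg x - c‖ ^ 2 := by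
    rw [he, ← sqDist_eq_l2norm_sq, sqDist_eq_add hx.n_pos, sqDist_eq_l2norm_sq]
  have hbe : b ≤ e := abs_le_of_sq_le_sq' (by rw [hsq]; nlinarith [sq_nonneg ‖avg x - c‖]) he0 |>.2
  have hm1 : ‖avg x - c‖ ≤ 1 / 2 * ((n : ℝ)⁻¹ * e ^ 2) := by
    rw [he, ← sqDist_eq_l2norm_sq]; exact hcx.norm_avg_sub_le hx.n_pos hR hx.mem.1
  have hm2 : ‖avg x - c‖ ≤ 1 / 6 := by
    obtain ⟨i⟩ : Nonempty (Fin n) := ⟨⟨0, hx.n_pos⟩⟩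
    refine ((hcx.isNearest hx.n_pos).2 (x i) (hx.mem.1 i)).trans ?_
    rw [norm_sub_rev]; exact (hx.mem.2.2 i).trans hx.δ₂_le
  -- The second-order bound gives n‖x̄ − c‖ ≤ e²/2, and the other factor ‖x̄ − c‖ is at most 1/6.
  have hm : n * ‖avg x - c‖ ^ 2 ≤ 1 / 12 * e ^ 2 := by
    have h1 : n * ‖avg x - c‖ ≤ 1 / 2 * e ^ 2 := by
      have := mul_le_mul_of_nonneg_left hm1 hn.le
      rwa [mul_left_comm, mul_inv_cancel_left₀ hn.ne'] at this
    nlinarith [norm_nonneg (avg x - c)]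
  -- Mixing leaves the mean part alone and contracts the deviation, which makes up at least 11/12 of
  -- e². The resulting gain 2α/5 exceeds the error 11α/30 by α/30.
  have hcentre : l2norm (fun i => (x i - c) + α • (mix V x i - x i)) ≤ (1 - 2 / 5 * α) * e := by
    have hav : avg (fun i => (x i - c) + α • (mix V x i - x i)) = avg x - c := by
      rw [avg_add, avg_smul, avg_sub, avg_sub, avg_mix hV.1, avg_const hx.n_pos]; simp
    refine abs_le_of_sq_le_sq' ?_ (mul_nonneg (by linarith) he0) |>.2
    rw [l2norm_sq_eq_add hx.n_pos, hav, sqDist_eq_l2norm_sq]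
    have h1 : (fun i => (x i - c) + α • (mix V x i - x i) - (avg x - c))
      = fun i => (1 - α) • (x i - avg x) + α • (mix V x i - avg x) := by funext i; module
    have h2 := l2norm_add_le (fun i => (1 - α) • (x i - avg x)) fun i => α • (mix V x i - avg x)
    rw [l2norm_smul, l2norm_smul, abs_of_pos hα, abs_of_nonneg (by linarith)] at h2
    have h3 := mul_le_mul_of_nonneg_left (hV.half hx.n_pos x) hα.le
    have h4 : l2norm (fun i => (1 - α) • (x i - avg x) + α • (mix V x i - avg x))
        ≤ (1 - α / 2) * b := by linarith
    rw [h1]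
    have h5 := pow_le_pow_left₀ (l2norm_nonneg _) h4 2
    have h6 : (1 - α / 2) ^ 2 ≤ 1 - 39 / 40 * α := by nlinarith
    have h7 : (1 - α / 2) ^ 2 * b ^ 2 ≤ (1 - 39 / 40 * α) * b ^ 2 := by gcongr
    have h8 : 11 / 12 * e ^ 2 ≤ b ^ 2 := by linarith
    have h9 := mul_le_mul_of_nonneg_left h8 hα.le
    nlinarith [mul_nonneg hα.le (sq_nonneg e), mul_nonneg (sq_nonneg α) (sq_nonneg e)]
  have := mul_le_mul_of_nonneg_left hbe hα.le
  linarith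

/-- The consensus region is invariant under slightly perturbed steps. -/
lemma perturbedStep_mem (hR : IsRetraction R) (hτ : τ ≤ α * δ₁ / 15) :
    perturbedStep V R α x w ∈ consensusRegion n d r δ₁ δ₂ := by
  have hα := hc.α_pos
  have hα1 := hc.α_le
  have hδ : 0 < δ₂ := by linarith [hx.δ₁_pos, hx.δ₁_le]
  obtain ⟨i₀⟩ : Nonempty (Fin n) := ⟨⟨0, hx.n_pos⟩⟩
  have hτ0 : 0 ≤ τ := (norm_nonneg _).trans (hw i₀)
  have hαδ : α * δ₁ ≤ α * (δ₂ / 5) := mul_le_mul_of_nonneg_left hx.δ₁_le hα.le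
  refine ⟨fun i => hR.mem _ (hx.mem.1 i) _ ?_, ?_, fun i => ?_⟩
  · rw [perturbedStep_direction (hx.mem.1 i)]
    exact tangentProj_mem_tangent (hx.mem.1 i) _
  · refine (sqDist_avg_le hx.n_pos _ (avg x)).trans ?_
    rw [sqDist_eq_l2norm_sq]
    have h1 := hx.l2norm_step_sub_avg_le hV hc hw
    have h2 := l2norm_le_of_norm_le hτ0 hw
    have h3 : (1 - 2 / 15 * α) * l2norm (fun i => x i - avg x) ≤ (1 - 2 / 15 * α) * (√n * δ₁) :=
      mul_le_mul_of_nonneg_left hx.l2norm_le (by linarith)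
    -- The bound on τ is chosen so that 2τ does not exceed the gain (2α/15)δ₁.
    have h4 : √n * τ ≤ √n * (α * δ₁ / 15) := mul_le_mul_of_nonneg_left hτ (Real.sqrt_nonneg _)
    have h5 : l2norm (fun i => perturbedStep V R α x w i - avg x) ≤ √n * δ₁ := by linarith
    have h6 := pow_le_pow_left₀ (l2norm_nonneg _) h5 2
    rwa [mul_pow, Real.sq_sqrt (Nat.cast_nonneg n)] at h6
  · have hq : ∀ j, ‖perturbedStep V R α x w j - x j - α • tangentProj (x j) (mix V x j - x j)‖
        ≤ α / 30 * δ₂ + 2 * τ := fun j => by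
      have e1 := hc.coarse_expansion (hx.mem.1 j) (hx.norm_mix_sub_le_third hV j) (hw j)
      have e2 := mul_le_mul_of_nonneg_left (hx.norm_mix_sub_le hV j) hα.le
      have e3 := hw j
      rw [perturbedStep]; linarith
    have hN : ∀ j, ‖α • normalProj (x j) (mix V x j - x j)‖ ≤ α * (δ₂ / 3) := fun j => by
      rw [norm_smul, Real.norm_of_nonneg hα.le]
      exact mul_le_mul_of_nonneg_left (hx.norm_normalProj_le hV j) hα.le
    have hav : ‖avg (perturbedStep V R α x w) - avg x‖ ≤ α * (11 / 30) * δ₂ + 2 * τ := by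
      rw [avg_perturbedStep_sub hV.1]
      refine norm_avg_le_of_norm_le hx.n_pos fun j => (_root_.norm_sub_le _ _).trans ?_
      linarith [hq j, hN j]
    -- In units of αδ₂ the losses are 1/10 from δ₁/2, twice 11/30 from the errors at the node and in
    -- the mean, and 4/75 from τ: less than the gain 1.
    have hsplit : perturbedStep V R α x w i - avg (perturbedStep V R α x w)
        = ((1 - α) • (x i - avg x) + α • (mix V x i - avg x))
          + ((perturbedStep V R α x w i - x i - α • tangentProj (x i) (mix V x i - x i))
            - α • normalProj (x i) (mix V x i - x i))
          - (avg (perturbedStep V R α x w) - avg x) := by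
      rw [tangentProj_eq]; module
    have e1 : ‖(1 - α) • (x i - avg x) + α • (mix V x i - avg x)‖
        ≤ (1 - α) * δ₂ + α * (δ₁ / 2) := by
      refine (norm_add_le _ _).trans ?_
      rw [norm_smul, norm_smul, Real.norm_of_nonneg hα.le, Real.norm_of_nonneg (by linarith)]
      refine add_le_add (mul_le_mul_of_nonneg_left (hx.mem.2.2 i) (by linarith)) ?_
      exact mul_le_mul_of_nonneg_left (hx.norm_mix_sub_avg_le hV i) hα.le
    have e2 := norm_add_le ((1 - α) • (x i - avg x) + α • (mix V x i - avg x))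
      ((perturbedStep V R α x w i - x i - α • tangentProj (x i) (mix V x i - x i))
            - α • normalProj (x i) (mix V x i - x i))
    have e3 := _root_.norm_sub_le (perturbedStep V R α x w i - x i
      - α • tangentProj (x i) (mix V x i - x i)) (α • normalProj (x i) (mix V x i - x i))
    have e4 := mul_pos hα hδ
    rw [hsplit]
    refine (_root_.norm_sub_le _ _).trans ?_
    linarith [hq i, hN i]

lemma l2norm_step_displacement_le (c : Mat d r) :
    l2norm (fun i => perturbedStep V R α x w i - x i)
      ≤ 4 * l2norm (fun i => x i - c) + 2 * l2norm w := by
  have h1 : l2norm (fun i => perturbedStep V R α x w i - x i)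
      ≤ l2norm fun i => (2 * α) • ‖mix V x i - x i‖ + (2 : ℝ) • ‖w i‖ := by
    refine l2norm_mono fun i => le_trans ?_ (Real.le_norm_self _)
    exact hc.norm_step_sub_le (hx.mem.1 i) (hx.norm_mix_sub_le_third hV i) (hw i)
  refine h1.trans ((l2norm_add_le _ _).trans ?_)
  rw [l2norm_smul, l2norm_smul, abs_of_pos (by linarith [hc.α_pos]), abs_of_pos two_pos]
  have e1 : l2norm (fun i => ‖mix V x i - x i‖) ≤ l2norm fun i => mix V x i - x i :=
    l2norm_mono fun i => by simp
  have e2 : l2norm (fun i => ‖w i‖) ≤ l2norm w := l2norm_mono fun i => by simp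
  have e3 := l2norm_mix_sub_le hV.1 x c
  have e4 : 0 ≤ l2norm fun i => ‖mix V x i - x i‖ := l2norm_nonneg _
  nlinarith [hc.α_le, hc.α_pos]

lemma norm_avg_step_sub_le (hτ : τ ≤ α * δ₁ / 15) :
    ‖avg (perturbedStep V R α x w) - avg x‖ ≤ 1 / 10 := by
  rw [← avg_sub]
  refine norm_avg_le_of_norm_le hx.n_pos fun i => ?_
  have h := hc.norm_step_sub_le (hx.mem.1 i) (hx.norm_mix_sub_le_third hV i) (hw i)
  have h2 := mul_le_mul hc.α_le (hx.norm_mix_sub_le_third hV i) (norm_nonneg _) (by norm_num)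
  have h3 : α * δ₁ ≤ 1 / 10 * (1 / 30) :=
    mul_le_mul hc.α_le (by linarith [hx.δ₁_le, hx.δ₂_le]) hx.δ₁_pos.le (by norm_num)
  have h4 := hw i
  rw [perturbedStep]; linarith

/-- First-order expansion of the motion of the Euclidean mean. -/
lemma norm_avg_step_expansion_le (c : Mat d r) :
    ‖avg (perturbedStep V R α x w) - avg x + avg (fun i => tangentProj (x i) (w i))‖
      ≤ 3 * ((n : ℝ)⁻¹ * sqDist x c) + 2 * M * ((n : ℝ)⁻¹ * l2norm w ^ 2) := by
  have hα := hc.α_pos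
  have hn : (0 : ℝ) ≤ (n : ℝ)⁻¹ := by positivity
  rw [avg_perturbedStep_sub hV.1, ← avg_add]
  refine (norm_avg_le _).trans ?_
  have h1 : ∀ i, ‖perturbedStep V R α x w i - x i - α • tangentProj (x i) (mix V x i - x i)
      - α • normalProj (x i) (mix V x i - x i) + tangentProj (x i) (w i)‖
      ≤ 2 * M * α ^ 2 * ‖mix V x i - x i‖ ^ 2 + 2 * M * ‖w i‖ ^ 2
        + α * ‖normalProj (x i) (mix V x i - x i)‖ := fun i => by
    have e1 := hc.expansion (hx.mem.1 i) (hx.norm_mix_sub_le_third hV i) (hw i)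
    have e2 := _root_.norm_sub_le (R (x i) (α • tangentProj (x i) (mix V x i)
      - tangentProj (x i) (w i)) - x i
      - (α • tangentProj (x i) (mix V x i - x i) - tangentProj (x i) (w i)))
      (α • normalProj (x i) (mix V x i - x i))
    rw [norm_smul, Real.norm_of_nonneg hα.le] at e2
    rw [perturbedStep]
    refine le_trans (le_of_eq ?_) (e2.trans ?_)
    · congr 1; abel
    · linarith
  refine (mul_le_mul_of_nonneg_left (Finset.sum_le_sum fun i _ => h1 i) hn).trans ?_
  simp only [Finset.sum_add_distrib, ← Finset.mul_sum]
  rw [← l2norm_sq fun i => mix V x i - x i, ← l2norm_sq w]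
  have h2 := avg_norm_normalProj_mix_sub_le hV.1 hx.mem.1 c
  have h3 := pow_le_pow_left₀ (l2norm_nonneg _) (l2norm_mix_sub_le hV.1 x c) 2
  rw [mul_pow, ← sqDist_eq_l2norm_sq] at h3
  have h4 := mul_le_mul_of_nonneg_left h3 hn
  have hX : 0 ≤ (n : ℝ)⁻¹ * sqDist x c := mul_nonneg hn (sqDist_nonneg _ _)
  have h5 : 2 * M * α ^ 2 ≤ 1 / 60 := by nlinarith [hc.Mα_le, hc.α_le, hc.M_pos]
  have h6 : 2 * M * α ^ 2 * ((n : ℝ)⁻¹ * l2norm (fun i => mix V x i - x i) ^ 2)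
      ≤ 1 / 60 * (4 * ((n : ℝ)⁻¹ * sqDist x c)) :=
    mul_le_mul h5 (by linarith) (by positivity) (by norm_num)
  have h7 : α * ((n : ℝ)⁻¹ * ∑ i, ‖normalProj (x i) (mix V x i - x i)‖)
      ≤ 1 / 10 * (2 * ((n : ℝ)⁻¹ * sqDist x c)) :=
    mul_le_mul hc.α_le h2 (by positivity) (by norm_num)
  linarith

end RegionPoint

end Consensus

/-! ### First-order conditions for concave functions on a convex set -/

section Concave

open Topology

variable {E : Type*} [NormedAddCommGroup E] [InnerProductSpace ℝ E] [CompleteSpace E]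
  {Y : Set E} {φ : E → ℝ} {g y y' : E} {μ : ℝ}

/-- Y may have empty interior and y may be a boundary point, so the gradient is used only through
slopes along segments in Y. -/
lemma tendsto_slope_of_hasGradientWithinAt (hY : Convex ℝ Y) (hg : HasGradientWithinAt φ g Y y)
    (hy : y ∈ Y) (hy' : y' ∈ Y) :
    Filter.Tendsto (fun s : ℝ => s⁻¹ * (φ (y + s • (y' - y)) - φ y)) (𝓝[>] 0)
      (𝓝 (inner ℝ g (y' - y))) := by
  have hc : HasDerivWithinAt (fun s : ℝ => y + s • (y' - y)) (y' - y) (Set.Icc 0 1) 0 := by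
    simpa using ((hasDerivWithinAt_id (0 : ℝ) (Set.Icc (0 : ℝ) 1)).smul_const (y' - y)).const_add y
  have hg' := hg.hasFDerivWithinAt
  have h := HasFDerivWithinAt.comp_hasDerivWithinAt (l := φ) (t := Y)
    (f := fun s : ℝ => y + s • (y' - y)) (0 : ℝ) (by simpa using hg') hc
    fun s hs => hY.add_smul_sub_mem hy hy' hs
  rw [hasDerivWithinAt_iff_tendsto_slope, InnerProductSpace.toDual_apply_apply] at h
  have hle : 𝓝[>] (0 : ℝ) ≤ 𝓝[Set.Icc 0 1 \ {0}] 0 := by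
    refine nhdsWithin_le_of_mem (Filter.mem_of_superset (Ioo_mem_nhdsGT one_pos) fun s hs => ?_)
    exact ⟨⟨hs.1.le, hs.2.le⟩, hs.1.ne'⟩
  refine (h.mono_left hle).congr fun s => ?_
  simp [slope_def_field, div_eq_inv_mul]

lemma le_add_inner_of_strongConcaveOn (hφ : StrongConcaveOn Y μ φ) (hg : HasGradientWithinAt φ g Y y)
    (hy : y ∈ Y) (hy' : y' ∈ Y) :
    φ y' ≤ φ y + inner ℝ g (y' - y) - μ / 2 * ‖y' - y‖ ^ 2 := by
  have h1 := tendsto_slope_of_hasGradientWithinAt hφ.1 hg hy hy'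
  have h2 : Filter.Tendsto (fun s : ℝ => φ y' - φ y + (1 - s) * (μ / 2 * ‖y' - y‖ ^ 2)) (𝓝[>] 0)
      (𝓝 (φ y' - φ y + (1 - 0) * (μ / 2 * ‖y' - y‖ ^ 2))) := by
    refine Filter.Tendsto.mono_left ?_ nhdsWithin_le_nhds
    exact Continuous.tendsto (by fun_prop) 0
  have h3 := le_of_tendsto_of_tendsto h2 h1 ?_
  · linarith
  filter_upwards [Ioo_mem_nhdsGT (zero_lt_one (α := ℝ))] with s hs
  have h4 := hφ.2 hy' hy hs.1.le (sub_nonneg.2 hs.2.le) (by ring)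
  rw [show s • y' + (1 - s) • y = y + s • (y' - y) by module, smul_eq_mul, smul_eq_mul] at h4
  rw [le_inv_mul_iff₀ hs.1]
  linarith

lemma inner_nonpos_of_isMaxOn (hY : Convex ℝ Y) (hg : HasGradientWithinAt φ g Y y)
    (hmax : IsMaxOn φ Y y) (hy : y ∈ Y) (hy' : y' ∈ Y) : inner ℝ g (y' - y) ≤ 0 := by
  refine le_of_tendsto (tendsto_slope_of_hasGradientWithinAt hY hg hy hy') ?_
  filter_upwards [Ioo_mem_nhdsGT (zero_lt_one (α := ℝ))] with s hs
  have h1 : φ (y + s • (y' - y)) ≤ φ y := hmax (hY.add_smul_sub_mem hy hy' ⟨hs.1.le, hs.2.le⟩)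
  exact mul_nonpos_of_nonneg_of_nonpos (inv_nonneg.2 hs.1.le) (by linarith)

lemma hasGradientWithinAt_inv_mul_sum {n : ℕ} {f : Fin n → E → ℝ} {G : Fin n → E}
    (h : ∀ i, HasGradientWithinAt (f i) (G i) Y y) :
    HasGradientWithinAt (fun z => (n : ℝ)⁻¹ * ∑ i, f i z) (avg G) Y y := by
  rw [hasGradientWithinAt_iff_hasFDerivWithinAt]
  have := (HasFDerivWithinAt.fun_sum (u := Finset.univ) fun i _ =>
    (h i).hasFDerivWithinAt).const_mul (n : ℝ)⁻¹
  have h2 : InnerProductSpace.toDual ℝ E (avg G)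
      = (n : ℝ)⁻¹ • ∑ i, InnerProductSpace.toDual ℝ E (G i) := by
    simp only [avg, map_smulₛₗ, map_sum, conj_trivial]
  rw [h2]
  exact this

end Concave

/-! ### The maximizer and the value function -/

namespace Problem

variable {n d r p : ℕ} {L₁₁ L₁₂ L₂₁ L₂₂ μ D : ℝ} (P : Problem n d r p L₁₁ L₁₂ L₂₁ L₂₂ μ D)
  {x x' : Mat d r} {y y' : EuclideanSpace ℝ (Fin p)}

local notation "𝐋" => maxLip L₁₁ L₁₂ L₂₁ L₂₂

/-- The Riemannian gradient of `F(·, y)`. -/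
def gX (x : Mat d r) (y : EuclideanSpace ℝ (Fin p)) : Mat d r := avg fun i => P.gradX i x y

/-- The gradient of `F(x, ·)`. -/
def gY (x : Mat d r) (y : EuclideanSpace ℝ (Fin p)) : EuclideanSpace ℝ (Fin p) :=
  avg fun i => P.gradY i x y

lemma gY_spec (hx : x ∈ stiefel d r) (hy : y ∈ P.Y) :
    HasGradientWithinAt (P.F x) (P.gY x y) P.Y y :=
  hasGradientWithinAt_inv_mul_sum fun i => P.gradY_spec i x hx y hy

lemma gX_spec (hx : x ∈ stiefel d r) (hy : y ∈ P.Y) :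
    IsRiemannianGradient (fun z => P.F z y) (P.gX x y) x := by
  refine ⟨?_, hasGradientWithinAt_inv_mul_sum fun i => (P.gradX_spec i x hx y hy).2⟩
  exact tangent_smul _ (tangent_sum _ _ fun i => (P.gradX_spec i x hx y hy).1)

omit P in
lemma one_le_maxLip : 1 ≤ 𝐋 := le_max_left _ _

lemma norm_gradX_sub_le (i : Fin n) (hx : x ∈ stiefel d r) (hx' : x' ∈ stiefel d r) (hy : y ∈ P.Y)
    (hy' : y' ∈ P.Y) :
    ‖P.gradX i x y - P.gradX i x' y'‖ ≤ 𝐋 * (‖x - x'‖ + ‖y - y'‖) := by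
  have h1 := P.lip₁₁ i x hx x' hx' y hy
  have h2 := P.lip₁₂ i x' hx' y hy y' hy'
  have h3 := norm_sub_le_norm_sub_add_norm_sub (P.gradX i x y) (P.gradX i x' y) (P.gradX i x' y')
  have h4 : L₁₁ ≤ 𝐋 := by simp [maxLip]
  have h5 : L₁₂ ≤ 𝐋 := by simp [maxLip]
  nlinarith [mul_le_mul_of_nonneg_right h4 (norm_nonneg (x - x')),
    mul_le_mul_of_nonneg_right h5 (norm_nonneg (y - y'))]

lemma norm_gradY_sub_le (i : Fin n) (hx : x ∈ stiefel d r) (hx' : x' ∈ stiefel d r) (hy : y ∈ P.Y)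
    (hy' : y' ∈ P.Y) :
    ‖P.gradY i x y - P.gradY i x' y'‖ ≤ 𝐋 * (‖x - x'‖ + ‖y - y'‖) := by
  have h1 := P.lip₂₁ i x hx x' hx' y hy
  have h2 := P.lip₂₂ i x' hx' y hy y' hy'
  have h3 := norm_sub_le_norm_sub_add_norm_sub (P.gradY i x y) (P.gradY i x' y) (P.gradY i x' y')
  have h4 : L₂₁ ≤ 𝐋 := by simp [maxLip]
  have h5 : L₂₂ ≤ 𝐋 := by simp [maxLip]
  nlinarith [mul_le_mul_of_nonneg_right h4 (norm_nonneg (x - x')),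
    mul_le_mul_of_nonneg_right h5 (norm_nonneg (y - y'))]

variable (hn : 1 ≤ n)
include hn

lemma norm_gX_sub_le (hx : x ∈ stiefel d r) (hx' : x' ∈ stiefel d r) (hy : y ∈ P.Y)
    (hy' : y' ∈ P.Y) : ‖P.gX x y - P.gX x' y'‖ ≤ 𝐋 * (‖x - x'‖ + ‖y - y'‖) := by
  rw [gX, gX, ← avg_sub]
  exact norm_avg_le_of_norm_le hn fun i => P.norm_gradX_sub_le i hx hx' hy hy'

lemma norm_gY_sub_le (hx : x ∈ stiefel d r) (hx' : x' ∈ stiefel d r) (hy : y ∈ P.Y)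
    (hy' : y' ∈ P.Y) : ‖P.gY x y - P.gY x' y'‖ ≤ 𝐋 * (‖x - x'‖ + ‖y - y'‖) := by
  rw [gY, gY, ← avg_sub]
  exact norm_avg_le_of_norm_le hn fun i => P.norm_gradY_sub_le i hx hx' hy hy'

lemma norm_gX_le (hx : x ∈ stiefel d r) (hy : y ∈ P.Y) : ‖P.gX x y‖ ≤ D :=
  norm_avg_le_of_norm_le hn fun i => P.bound i x hx y hy

omit hn in
lemma inner_gY_sub_le (hx : x ∈ stiefel d r) (hy : y ∈ P.Y) (hy' : y' ∈ P.Y) :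
    inner ℝ (P.gY x y - P.gY x y') (y - y') ≤ -μ * ‖y - y'‖ ^ 2 := by
  have hF : StrongConcaveOn P.Y μ (P.F x) := P.strongConcave x hx
  have h1 := le_add_inner_of_strongConcaveOn hF (P.gY_spec hx hy) hy hy'
  have h2 := le_add_inner_of_strongConcaveOn hF (P.gY_spec hx hy') hy' hy
  rw [norm_sub_rev y' y, ← neg_sub y y', inner_neg_right] at h1
  rw [inner_sub_left]
  linarith

omit hn in
lemma inner_gY_yStar_le (hx : x ∈ stiefel d r) (hy : y ∈ P.Y) :
    inner ℝ (P.gY x (P.yStar x)) (y - P.yStar x) ≤ 0 :=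
  inner_nonpos_of_isMaxOn P.convex_Y (P.gY_spec hx (P.yStar_mem x hx)) (P.yStar_max x hx)
    (P.yStar_mem x hx) hy

/-- The maximizer is Lipschitz in `x`. -/
lemma norm_yStar_sub_le (hμ : 0 < μ) (hx : x ∈ stiefel d r) (hx' : x' ∈ stiefel d r) :
    ‖P.yStar x - P.yStar x'‖ ≤ 𝐋 / μ * ‖x - x'‖ := by
  have hA := P.yStar_mem x hx
  have hB := P.yStar_mem x' hx'
  -- Adding the variational inequalities at both maximizers to strong monotonicity at x gives
  -- μ‖Δy*‖² ≤ L‖Δx‖‖Δy*‖.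
  have h1 := P.inner_gY_yStar_le hx hB
  have h2 := P.inner_gY_yStar_le hx' hA
  have h3 := P.inner_gY_sub_le hx hA hB
  have h4 := real_inner_le_norm (P.gY x (P.yStar x') - P.gY x' (P.yStar x'))
    (P.yStar x - P.yStar x')
  have h5 := P.norm_gY_sub_le hn hx hx' hB hB
  rw [sub_self, norm_zero, add_zero] at h5
  rw [← neg_sub, inner_neg_right] at h1
  rw [inner_sub_left] at h3 h4
  have h6 := mul_le_mul_of_nonneg_right h5 (norm_nonneg (P.yStar x - P.yStar x'))
  rw [div_mul_eq_mul_div, le_div_iff₀ hμ]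
  by_contra! hlt
  have h7 : 0 < ‖P.yStar x - P.yStar x'‖ := by
    by_contra! h
    have h8 : ‖P.yStar x - P.yStar x'‖ = 0 := le_antisymm h (norm_nonneg _)
    rw [h8, zero_mul] at hlt
    exact absurd hlt (not_lt.2 (mul_nonneg (zero_le_one.trans one_le_maxLip) (norm_nonneg _)))
  nlinarith

omit hn in
-- Convexity of the square with weights 1 − a, a at the points A, B/a.
lemma _root_.sq_convex_combination_le {a A B : ℝ} (ha : 0 < a) (ha1 : a ≤ 1) :
    ((1 - a) * A + B) ^ 2 ≤ (1 - a) * A ^ 2 + B ^ 2 / a := by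
  have h : (1 - a) * A ^ 2 + B ^ 2 / a - ((1 - a) * A + B) ^ 2
      = (1 - a) / a * (a * A - B) ^ 2 := by
    field_simp; ring
  have : 0 ≤ (1 - a) / a * (a * A - B) ^ 2 := by
    have : 0 ≤ (1 - a) / a := div_nonneg (by linarith) ha.le
    positivity
  linarith

/-- An inexact ascent step that stays in `Y` approaches the maximizer. -/
lemma norm_ascent_sub_sq_le (hμ : 0 < μ) {η : ℝ} (hη : 0 < η) (hημ : η * μ ≤ 1)
    (hηL : η * 𝐋 ^ 2 ≤ μ) (hx : x ∈ stiefel d r) {v : EuclideanSpace ℝ (Fin p)} (hy : y ∈ P.Y)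
    (hyv : y + η • v ∈ P.Y) :
    ‖y + η • v - P.yStar x‖ ^ 2 ≤ (1 - η * μ / 2) * ‖y - P.yStar x‖ ^ 2
      + 2 * η / μ * ‖v - P.gY x y‖ ^ 2 := by
  set ys := P.yStar x with hys
  have hysm : ys ∈ P.Y := P.yStar_mem x hx
  have h1 := P.inner_gY_yStar_le hx hyv
  rw [← hys] at h1
  set z := y + η • v - ys with hz
  -- The gradient at the maximizer need not vanish when it lies on the boundary of Y. Since the step
  -- stays in Y, the variational inequality shows that subtracting that gradient can only lengthen
  -- z.
  have h2 : ‖z‖ ≤ ‖z - η • P.gY x ys‖ := by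
    have e1 := real_inner_le_norm (z - η • P.gY x ys) z
    rw [inner_sub_left, real_inner_self_eq_norm_sq, real_inner_smul_left] at e1
    have e2 : ‖z‖ ^ 2 ≤ ‖z - η • P.gY x ys‖ * ‖z‖ := by nlinarith
    by_contra! hlt
    nlinarith [norm_nonneg (z - η • P.gY x ys), norm_nonneg z]
  have h3 : z - η • P.gY x ys
      = ((y - ys) + η • (P.gY x y - P.gY x ys)) + η • (v - P.gY x y) := by
    rw [hz]; module
  -- 1 − 2ημ + η²L² ≤ 1 − ημ ≤ (1 − ημ/2)².
  have h4 : ‖(y - ys) + η • (P.gY x y - P.gY x ys)‖ ≤ (1 - η * μ / 2) * ‖y - ys‖ := by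
    refine abs_le_of_sq_le_sq' ?_ (mul_nonneg (by linarith) (norm_nonneg _)) |>.2
    rw [norm_add_sq_real, real_inner_smul_right, norm_smul, Real.norm_of_nonneg hη.le]
    have e1 := P.inner_gY_sub_le hx hy hysm
    rw [real_inner_comm] at e1
    have e2 := P.norm_gY_sub_le hn hx hx hy hysm
    rw [sub_self, norm_zero, zero_add] at e2
    have e3 : (η * ‖P.gY x y - P.gY x ys‖) ^ 2 ≤ (η * (𝐋 * ‖y - ys‖)) ^ 2 :=
      pow_le_pow_left₀ (by positivity) (mul_le_mul_of_nonneg_left e2 hη.le) 2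
    have e4 := mul_le_mul_of_nonneg_left e1 hη.le
    have e5 := mul_le_mul_of_nonneg_right (mul_le_mul_of_nonneg_left hηL hη.le)
      (sq_nonneg ‖y - ys‖)
    nlinarith [mul_nonneg (sq_nonneg (η * μ)) (sq_nonneg ‖y - ys‖)]
  have h5 : ‖z‖ ≤ (1 - η * μ / 2) * ‖y - ys‖ + η * ‖v - P.gY x y‖ := by
    refine h2.trans ?_
    rw [h3]
    refine (norm_add_le _ _).trans (add_le_add h4 ?_)
    rw [norm_smul, Real.norm_of_nonneg hη.le]
  refine (pow_le_pow_left₀ (norm_nonneg _) h5 2).trans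
    ((sq_convex_combination_le (by positivity) (by linarith)).trans (le_of_eq ?_))
  field_simp

/-- Young's inequality with weight a = ημ/4 moves the target from y*(x) to y*(x'), since (1 + a)(1 −
2a) ≤ 1 − a. -/
lemma norm_ascent_sub_moved_sq_le (hμ : 0 < μ) {η : ℝ} (hη : 0 < η) (hημ : η * μ ≤ 1)
    (hηL : η * 𝐋 ^ 2 ≤ μ) (hx : x ∈ stiefel d r) (hx' : x' ∈ stiefel d r)
    {v : EuclideanSpace ℝ (Fin p)} (hy : y ∈ P.Y) (hyv : y + η • v ∈ P.Y) :
    ‖y + η • v - P.yStar x'‖ ^ 2 ≤ (1 - η * μ / 4) * ‖y - P.yStar x‖ ^ 2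
      + 5 / 2 * (η / μ) * ‖v - P.gY x y‖ ^ 2 + 5 / (η * μ) * (𝐋 / μ) ^ 2 * ‖x' - x‖ ^ 2 := by
  have h1 := P.norm_ascent_sub_sq_le hn hμ hη hημ hηL hx hy hyv
  have h2 := P.norm_yStar_sub_le hn hμ hx hx'
  have h3 : ‖y + η • v - P.yStar x'‖ ≤ ‖y + η • v - P.yStar x‖ + 𝐋 / μ * ‖x' - x‖ := by
    rw [norm_sub_rev x' x]
    exact (norm_sub_le_norm_sub_add_norm_sub _ (P.yStar x) _).trans (by linarith)
  set a := η * μ / 4 with ha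
  have ha0 : 0 < a := by positivity
  have ha4 : a ≤ 1 / 4 := by linarith
  set A := ‖y + η • v - P.yStar x‖
  set B := 𝐋 / μ * ‖x' - x‖
  have hB0 : 0 ≤ B := mul_nonneg (div_nonneg (zero_le_one.trans one_le_maxLip) hμ.le) (norm_nonneg _)
  have h4 := pow_le_pow_left₀ (norm_nonneg _) h3 2
  have h5 : (A + B) ^ 2 ≤ (1 + a) * A ^ 2 + (1 + 1 / a) * B ^ 2 := by
    have : (1 + a) * A ^ 2 + (1 + 1 / a) * B ^ 2 - (A + B) ^ 2 = 1 / a * (a * A - B) ^ 2 := by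
      field_simp; ring
    have : 0 ≤ 1 / a * (a * A - B) ^ 2 := by positivity
    linarith
  have h6 : (1 + 1 / a) * B ^ 2 ≤ 5 / (η * μ) * (𝐋 / μ) ^ 2 * ‖x' - x‖ ^ 2 := by
    have : 5 / (η * μ) * (𝐋 / μ) ^ 2 * ‖x' - x‖ ^ 2 = 5 / (η * μ) * B ^ 2 := by
      simp only [B]; ring
    rw [this]
    refine mul_le_mul_of_nonneg_right ?_ (sq_nonneg B)
    have e1 : 1 / a = 4 / (η * μ) := by rw [ha]; field_simp
    have e2 : 1 ≤ 1 / (η * μ) := by rw [le_div_iff₀ (by positivity)]; linarith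
    have e3 : 5 / (η * μ) = 4 / (η * μ) + 1 / (η * μ) := by ring
    rw [e1, e3]; linarith
  have h7 := mul_le_mul_of_nonneg_left h1 (by linarith : 0 ≤ 1 + a)
  have h8 : (1 + a) * ((1 - η * μ / 2) * ‖y - P.yStar x‖ ^ 2) ≤ (1 - a) * ‖y - P.yStar x‖ ^ 2 := by
    rw [← mul_assoc]
    refine mul_le_mul_of_nonneg_right ?_ (sq_nonneg _)
    nlinarith
  have h9 : (1 + a) * (2 * η / μ * ‖v - P.gY x y‖ ^ 2)
      ≤ 5 / 2 * (η / μ) * ‖v - P.gY x y‖ ^ 2 := by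
    have : 0 ≤ η / μ * ‖v - P.gY x y‖ ^ 2 := by positivity
    have e : (1 + a) * (2 * η / μ * ‖v - P.gY x y‖ ^ 2)
      = (1 + a) * 2 * (η / μ * ‖v - P.gY x y‖ ^ 2) := by ring
    rw [e]; nlinarith
  linarith

/-- Descent of the value function. -/
lemma Phi_le (hμ : 0 < μ) {R : Mat d r → Mat d r → Mat d r} (hR : IsRetraction R)
    (hx : x ∈ stiefel d r) (hx' : x' ∈ stiefel d r) (hd : ‖x' - x‖ ≤ 1 / 2) :
    P.Phi x' ≤ P.Phi x + inner ℝ (P.gX x (P.yStar x)) (x' - x)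
      + (2 * 𝐋 + 𝐋 ^ 2 / μ) * ‖x' - x‖ ^ 2 := by
  have hL : 0 ≤ 𝐋 := zero_le_one.trans one_le_maxLip
  have hA := P.yStar_mem x hx
  have hB := P.yStar_mem x' hx'
  -- No differentiability of Φ or y* is needed: freeze y at y*(x'), descend in x, bound F(x, y*(x'))
  -- by Φ(x), and pass to the gradient at y*(x) at cost L · L/μ.
  have h1 := le_of_riemannianGradient_lipschitz hR hL (fun z hz => P.gX_spec hz hB)
    (fun z hz z' hz' => by simpa using P.norm_gX_sub_le hn hz hz' hB hB) hx hx' hd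
  have h2 : P.F x (P.yStar x') ≤ P.F x (P.yStar x) := P.yStar_max x hx hB
  have h3 := P.norm_gX_sub_le hn hx hx hB hA
  rw [sub_self, norm_zero, zero_add] at h3
  have h4 := P.norm_yStar_sub_le hn hμ hx' hx
  have h5 := real_inner_le_norm (P.gX x (P.yStar x') - P.gX x (P.yStar x)) (x' - x)
  rw [inner_sub_left] at h5
  have h6 : ‖P.gX x (P.yStar x') - P.gX x (P.yStar x)‖ * ‖x' - x‖
      ≤ 𝐋 * (𝐋 / μ * ‖x' - x‖) * ‖x' - x‖ := by gcongr; exact h3.trans (by gcongr)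
  have h7 : 𝐋 * (𝐋 / μ * ‖x' - x‖) * ‖x' - x‖ = 𝐋 ^ 2 / μ * ‖x' - x‖ ^ 2 := by ring
  rw [Phi, Phi]
  linarith

omit hn in
-- Φ dominates F(·, y₁) for a fixed y₁ ∈ Y, a continuous function on a compact set.
lemma exists_le_Phi : ∃ m, ∀ x ∈ stiefel d r, m ≤ P.Phi x := by
  rcases (stiefel d r).eq_empty_or_nonempty with h | ⟨x₁, hx₁⟩
  · exact ⟨0, by simp [h]⟩
  have hy₁ := P.yStar_mem x₁ hx₁
  have hc : ContinuousOn (fun z => P.F z (P.yStar x₁)) (stiefel d r) := fun z hz =>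
    (P.gX_spec hz hy₁).2.continuousWithinAt
  obtain ⟨z, -, hz⟩ := isCompact_stiefel.exists_isMinOn ⟨x₁, hx₁⟩ hc
  exact ⟨P.F z (P.yStar x₁), fun x hx => (hz hx).trans (P.yStar_max x hx hy₁)⟩

end Problem

/-! ### Mean squares and deviations -/

section MeanSquare

variable {n : ℕ} {E F : Type*} [NormedAddCommGroup E] [NormedAddCommGroup F]

/-- The mean square `(1/n) ∑ᵢ ‖zᵢ‖²`. -/
def meanSq (z : Fin n → E) : ℝ := (n : ℝ)⁻¹ * l2norm z ^ 2

lemma meanSq_nonneg (z : Fin n → E) : 0 ≤ meanSq z := by unfold meanSq; positivity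

lemma meanSq_sub (z : Fin n → E) (c : E) :
    meanSq (fun i => z i - c) = (n : ℝ)⁻¹ * sqDist z c := by
  rw [meanSq, sqDist_eq_l2norm_sq]

lemma meanSq_eq_sum (z : Fin n → E) : meanSq z = (n : ℝ)⁻¹ * ∑ i, ‖z i‖ ^ 2 := by
  rw [meanSq, l2norm_sq]

lemma meanSq_le_of_norm_le_add {G : Type*} [NormedAddCommGroup G] {L : ℝ}
    {z : Fin n → E} {a : Fin n → F} {b : Fin n → G} (h : ∀ i, ‖z i‖ ≤ L * (‖a i‖ + ‖b i‖)) :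
    meanSq z ≤ 2 * L ^ 2 * (meanSq a + meanSq b) := by
  have h1 : ∑ i, ‖z i‖ ^ 2 ≤ 2 * L ^ 2 * (∑ i, ‖a i‖ ^ 2 + ∑ i, ‖b i‖ ^ 2) := by
    rw [← Finset.sum_add_distrib, Finset.mul_sum]
    refine Finset.sum_le_sum fun i _ => ?_
    have := pow_le_pow_left₀ (norm_nonneg _) (h i) 2
    nlinarith [mul_nonneg (sq_nonneg L) (sq_nonneg (‖a i‖ - ‖b i‖))]
  rw [meanSq_eq_sum, meanSq_eq_sum, meanSq_eq_sum, ← mul_add, mul_left_comm]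
  exact mul_le_mul_of_nonneg_left h1 (by positivity)

variable [InnerProductSpace ℝ E]

/-- The mean square deviation from the mean. -/
def dev (z : Fin n → E) : ℝ := meanSq fun i => z i - avg z

lemma dev_nonneg (z : Fin n → E) : 0 ≤ dev z := meanSq_nonneg _

lemma meanSq_smul (c : ℝ) (z : Fin n → E) : meanSq (fun i => c • z i) = c ^ 2 * meanSq z := by
  rw [meanSq, l2norm_smul, mul_pow, sq_abs, meanSq]; ring

lemma dev_smul (c : ℝ) (z : Fin n → E) : dev (fun i => c • z i) = c ^ 2 * dev z := by
  rw [dev, avg_smul, dev, ← meanSq_smul]; simp only [smul_sub]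

variable (hn : 1 ≤ n)
include hn

lemma meanSq_eq_add (z : Fin n → E) : meanSq z = dev z + ‖avg z‖ ^ 2 := by
  have : (n : ℝ) ≠ 0 := by positivity
  rw [dev, meanSq_sub, meanSq, l2norm_sq_eq_add hn]; field_simp

lemma norm_avg_sq_le_meanSq (z : Fin n → E) : ‖avg z‖ ^ 2 ≤ meanSq z := by
  rw [meanSq_eq_add hn]; linarith [dev_nonneg z]

lemma dev_le_meanSq (z : Fin n → E) : dev z ≤ meanSq z := by
  rw [meanSq_eq_add hn]; nlinarith [sq_nonneg ‖avg z‖]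

omit [InnerProductSpace ℝ E] in
lemma meanSq_le_of_norm_le {z : Fin n → E} {B : ℝ} (h : ∀ i, ‖z i‖ ≤ B) : meanSq z ≤ B ^ 2 := by
  rw [meanSq_eq_sum]
  exact inv_mul_sum_le hn fun i => pow_le_pow_left₀ (norm_nonneg _) (h i) 2

/-- Convexity of the square with a = 1 − q keeps the rate q after squaring and charges only 1/(1 −
q) for the increment. -/
lemma dev_mix_add_le {V : Matrix (Fin n) (Fin n) ℝ} (hV : V ∈ doublyStochastic ℝ (Fin n)) {q : ℝ}
    (hq : q < 1) (hq0 : 0 ≤ q) (z δ : Fin n → E)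
    (hz : l2norm (fun i => mix V z i - avg z) ≤ q * l2norm fun i => z i - avg z) :
    dev (fun i => mix V z i + δ i) ≤ q * dev z + dev δ / (1 - q) := by
  have h1 : (fun i => mix V z i + δ i - avg fun i => mix V z i + δ i)
      = fun i => (mix V z i - avg z) + (δ i - avg δ) := by
    funext i; rw [avg_add, avg_mix hV]; abel
  have h2 := l2norm_add_le (fun i => mix V z i - avg z) fun i => δ i - avg δ
  have h3 : l2norm (fun i => (mix V z i - avg z) + (δ i - avg δ))
      ≤ (1 - (1 - q)) * l2norm (fun i => z i - avg z) + l2norm fun i => δ i - avg δ := by linarith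
  have h4 := (pow_le_pow_left₀ (l2norm_nonneg _) h3 2).trans
    (sq_convex_combination_le (by linarith) (by linarith))
  rw [dev, h1, dev, dev, meanSq, meanSq, meanSq]
  have h5 := mul_le_mul_of_nonneg_left h4 (by positivity : (0 : ℝ) ≤ (n : ℝ)⁻¹)
  refine h5.trans (le_of_eq ?_)
  ring

end MeanSquare

/-! ### One-step recursions along a run -/

section Run

variable {n d r p : ℕ} {L₁₁ L₁₂ L₂₁ L₂₂ μ D : ℝ}

local notation "𝐋" => maxLip L₁₁ L₁₂ L₂₁ L₂₂

/-- A run of the algorithm together with the assumptions on the step sizes. -/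
structure ControlledRun (P : Problem n d r p L₁₁ L₁₂ L₂₁ L₂₂ μ D) (W : Matrix (Fin n) (Fin n) ℝ)
    (k : ℕ) (R : Mat d r → Mat d r → Mat d r) (ε M τ δ₁ δ₂ α β η : ℝ) (T : ℕ)
    (x : ℕ → Fin n → Mat d r) (y : ℕ → Fin n → EuclideanSpace ℝ (Fin p))
    (u : ℕ → Fin n → Mat d r) (v : ℕ → Fin n → EuclideanSpace ℝ (Fin p))
    (xhat : ℕ → Mat d r) : Prop where
  run : IsRun P W k R α β η T x y u v
  iam : ∀ t ≤ T, IsIAM (x t) (xhat t)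
  init : RegionPoint δ₁ δ₂ (x 0)
  stochastic : W ∈ doublyStochastic ℝ (Fin n)
  symm : W.IsSymm
  connected : lambda₂ W < 1
  mixing : IsHalfMixing d r (W ^ k)
  retraction : IsRetraction R
  const : StepConstants R ε M α τ
  τ_le : τ ≤ α * δ₁ / 15
  β_pos : 0 < β
  β_le : β ≤ 1
  β_le_τ : β * (5 * D * √n) ≤ τ
  D_nonneg : 0 ≤ D
  μ_pos : 0 < μ
  η_pos : 0 < η
  ημ_le : η * μ ≤ 1
  ηL_le : η * 𝐋 ^ 2 ≤ μ

namespace ControlledRun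

variable {P : Problem n d r p L₁₁ L₁₂ L₂₁ L₂₂ μ D} {W : Matrix (Fin n) (Fin n) ℝ}
    {k : ℕ} {R : Mat d r → Mat d r → Mat d r} {ε M τ δ₁ δ₂ α β η : ℝ} {T : ℕ}
    {x : ℕ → Fin n → Mat d r} {y : ℕ → Fin n → EuclideanSpace ℝ (Fin p)}
    {u : ℕ → Fin n → Mat d r} {v : ℕ → Fin n → EuclideanSpace ℝ (Fin p)}
    {xhat : ℕ → Mat d r} (h : ControlledRun P W k R ε M τ δ₁ δ₂ α β η T x y u v xhat)
    {t : ℕ}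
include h

lemma n_pos : 1 ≤ n := h.init.n_pos

lemma x_succ_eq (ht : t < T) : x (t + 1) = perturbedStep (W ^ k) R α (x t) fun i => β • u t i := by
  funext i
  rw [h.run.x_succ t ht i, perturbedStep]
  simp only [← tangentProjₗ_apply, map_smul]

lemma x_mem_stiefel (ht : t ≤ T) (i : Fin n) : x t i ∈ stiefel d r := by
  induction t with
  | zero => exact h.init.mem.1 i
  | succ t ih =>
    have hm := ih (by omega)
    rw [h.x_succ_eq (by omega), perturbedStep]
    refine h.retraction.mem _ hm _ ?_
    rw [perturbedStep_direction hm]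
    exact tangentProj_mem_tangent hm _

/-- Gradient tracking: mixing preserves averages, so the gradient increments telescope. -/
lemma avg_u (ht : t ≤ T) : avg (u t) = avg fun i => P.gradX i (x t i) (y t i) := by
  induction t with
  | zero => rw [funext h.run.u_zero]
  | succ t ih =>
    rw [funext (h.run.u_succ t (by omega)), avg_sub, avg_add, avg_mix (pow_mem h.stochastic k),
      ih (by omega)]
    abel

lemma avg_v (ht : t ≤ T) : avg (v t) = avg fun i => P.gradY i (x t i) (y t i) := by
  induction t with
  | zero => rw [funext h.run.v_zero]
  | succ t ih =>
    rw [funext (h.run.v_succ t (by omega)), avg_sub, avg_add, avg_mix h.stochastic, ih (by omega)]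
    abel

lemma norm_gradX_le (ht : t ≤ T) (i : Fin n) : ‖P.gradX i (x t i) (y t i)‖ ≤ D :=
  P.bound i _ (h.x_mem_stiefel ht i) _ (h.run.y_mem t ht i)

/-- 4D√n is the fixed point of s ↦ s/2 + 2D√n, where 2D√n bounds the gradient increments. Since only
D is used, invariance of the region can be proved before any descent. -/
lemma l2norm_u_sub_avg_le (ht : t ≤ T) : l2norm (fun i => u t i - avg (u t)) ≤ 4 * D * √n := by
  have hD := h.D_nonneg
  induction t with
  | zero =>
    have h1 := l2norm_le_of_norm_le (z := u 0) hD fun i => by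
      rw [h.run.u_zero i]; exact h.norm_gradX_le ht i
    have h2 := l2norm_sub_avg_le h.n_pos (u 0)
    have : 0 ≤ √(n : ℝ) * D := by positivity
    linarith
  | succ t ih =>
    have hi := ih (by omega)
    set δ : Fin n → Mat d r := fun i =>
      P.gradX i (x (t + 1) i) (y (t + 1) i) - P.gradX i (x t i) (y t i) with hδ
    have h0 : u (t + 1) = fun i => mix (W ^ k) (u t) i + δ i := by
      funext i; rw [h.run.u_succ t (by omega) i, hδ, add_sub_assoc]
    have h1 : (fun i => u (t + 1) i - avg (u (t + 1)))
        = fun i => (mix (W ^ k) (u t) i - avg (u t)) + (δ i - avg δ) := by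
      funext i; rw [h0, avg_add, avg_mix (pow_mem h.stochastic k), add_sub_add_comm]
    rw [h1]
    have h2 := l2norm_add_le (fun i => mix (W ^ k) (u t) i - avg (u t)) fun i => δ i - avg δ
    have h3 := h.mixing.half h.n_pos (u t)
    have h4 := l2norm_sub_avg_le h.n_pos δ
    have h5 : l2norm δ ≤ √n * (D + D) := l2norm_le_of_norm_le (by linarith) fun i =>
      (norm_sub_le _ _).trans (add_le_add (h.norm_gradX_le ht i) (h.norm_gradX_le (by omega) i))
    linarith

lemma norm_smul_u_le (ht : t ≤ T) (i : Fin n) : ‖β • u t i‖ ≤ τ := by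
  refine le_trans ?_ h.β_le_τ
  rw [norm_smul, Real.norm_of_nonneg h.β_pos.le]
  refine mul_le_mul_of_nonneg_left ?_ h.β_pos.le
  have h1 := (norm_le_l2norm (fun i => u t i - avg (u t)) i).trans (h.l2norm_u_sub_avg_le ht)
  have h2 : ‖avg (u t)‖ ≤ D := by
    rw [h.avg_u ht]; exact norm_avg_le_of_norm_le h.n_pos (h.norm_gradX_le ht)
  have h3 := norm_add_le (u t i - avg (u t)) (avg (u t))
  rw [sub_add_cancel] at h3
  have h4 : (1 : ℝ) ≤ √n := Real.one_le_sqrt.2 (by exact_mod_cast h.n_pos)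
  have h5 := mul_le_mul_of_nonneg_left h4 h.D_nonneg
  linarith

lemma regionPoint (ht : t ≤ T) : RegionPoint δ₁ δ₂ (x t) := by
  induction t with
  | zero => exact h.init
  | succ t ih =>
    have hm := ih (by omega)
    refine ⟨hm.n_pos, hm.δ₁_pos, hm.δ₁_le, hm.δ₂_le, ?_⟩
    rw [h.x_succ_eq (by omega)]
    exact hm.perturbedStep_mem h.mixing h.const (h.norm_smul_u_le (by omega)) h.retraction h.τ_le

lemma avg_y_mem (ht : t ≤ T) : avg (y t) ∈ P.Y := by
  rw [avg, Finset.smul_sum]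
  refine P.convex_Y.sum_mem (fun _ _ => by positivity) ?_ fun i _ => h.run.y_mem t ht i
  have : (n : ℝ) ≠ 0 := by have := h.n_pos; positivity
  simp [this]

lemma norm_avg_x_sub_le (ht : t ≤ T) : ‖avg (x t) - xhat t‖ ≤ 1 / 6 := by
  have hm := h.regionPoint ht
  refine (((h.iam t ht).isNearest h.n_pos).2 (x t ⟨0, h.n_pos⟩) (hm.mem.1 _)).trans ?_
  rw [norm_sub_rev]; exact (hm.mem.2.2 _).trans hm.δ₂_le

/-- `β² (1/n) ‖u‖²`, the mean square of the gradient perturbation. -/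
lemma meanSq_smul_u (ht : t ≤ T) : meanSq (fun i => β • u t i)
    = β ^ 2 * (‖avg fun i => P.gradX i (x t i) (y t i)‖ ^ 2 + dev (u t)) := by
  rw [meanSq_smul, meanSq_eq_add h.n_pos, h.avg_u ht]; ring

/-- By minimality the new induced mean may be replaced by the old one; 120/α is 2² · 30/α. -/
lemma meanSq_x_succ_le (ht : t < T) :
    meanSq (fun i => x (t + 1) i - xhat (t + 1)) ≤ (1 - α / 30) * meanSq (fun i => x t i - xhat t)
      + 120 / α * meanSq (fun i => β • u t i) := by
  have hα := h.const.α_pos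
  have hα1 := h.const.α_le
  have hm := h.regionPoint ht.le
  have h1 := hm.l2norm_step_sub_iam_le h.mixing h.const (h.norm_smul_u_le ht.le) h.retraction
    (h.iam t ht.le)
  rw [← h.x_succ_eq ht] at h1
  have h2 := (pow_le_pow_left₀ (l2norm_nonneg _) h1 2).trans
    (sq_convex_combination_le (by positivity) (by linarith))
  have h3 := (h.iam (t + 1) ht).2 _ (h.iam t ht.le).1
  rw [sqDist_eq_l2norm_sq, sqDist_eq_l2norm_sq] at h3
  have h4 := mul_le_mul_of_nonneg_left (h3.trans h2) (by positivity : (0 : ℝ) ≤ (n : ℝ)⁻¹)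
  rw [meanSq, meanSq, meanSq]
  refine h4.trans (le_of_eq ?_)
  field_simp; ring

lemma meanSq_x_displacement_le (ht : t < T) :
    meanSq (fun i => x (t + 1) i - x t i) ≤ 32 * meanSq (fun i => x t i - xhat t)
      + 8 * meanSq (fun i => β • u t i) := by
  have hm := h.regionPoint ht.le
  have h1 := hm.l2norm_step_displacement_le h.mixing h.const (h.norm_smul_u_le ht.le) (xhat t)
  rw [← h.x_succ_eq ht] at h1
  have h2 := pow_le_pow_left₀ (l2norm_nonneg _) h1 2
  have h3 : (4 * l2norm (fun i => x t i - xhat t) + 2 * l2norm fun i => β • u t i) ^ 2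
      ≤ 32 * l2norm (fun i => x t i - xhat t) ^ 2 + 8 * l2norm (fun i => β • u t i) ^ 2 := by
    nlinarith [sq_nonneg (4 * l2norm (fun i => x t i - xhat t) - 2 * l2norm fun i => β • u t i)]
  have h4 := mul_le_mul_of_nonneg_left (h2.trans h3) (by positivity : (0 : ℝ) ≤ (n : ℝ)⁻¹)
  rw [meanSq, meanSq, meanSq]
  linarith

lemma norm_avg_x_displacement_sq_le :
    ‖avg (x (t + 1)) - avg (x t)‖ ^ 2 ≤ meanSq fun i => x (t + 1) i - x t i := by
  rw [← avg_sub]; exact norm_avg_sq_le_meanSq h.n_pos _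

lemma norm_xhat_displacement_le (ht : t < T) :
    ‖xhat (t + 1) - xhat t‖ ≤ 4 / 3 * ‖avg (x (t + 1)) - avg (x t)‖ :=
  ((h.iam (t + 1) ht).isNearest h.n_pos).norm_sub_le h.retraction
    ((h.iam t ht.le).isNearest h.n_pos) ((h.norm_avg_x_sub_le ht).trans (by norm_num))
    ((h.norm_avg_x_sub_le ht.le).trans (by norm_num))

lemma norm_xhat_displacement_sq_le (ht : t < T) :
    ‖xhat (t + 1) - xhat t‖ ^ 2 ≤ 2 * meanSq fun i => x (t + 1) i - x t i := by
  have h1 := pow_le_pow_left₀ (norm_nonneg _) (h.norm_xhat_displacement_le ht) 2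
  have h2 := h.norm_avg_x_displacement_sq_le (t := t)
  nlinarith [sq_nonneg ‖avg (x (t + 1)) - avg (x t)‖]

lemma norm_xhat_displacement_le_half (ht : t < T) : ‖xhat (t + 1) - xhat t‖ ≤ 1 / 2 := by
  have h1 := h.norm_xhat_displacement_le ht
  have h2 := (h.regionPoint ht.le).norm_avg_step_sub_le h.mixing h.const
    (h.norm_smul_u_le ht.le) h.τ_le
  rw [← h.x_succ_eq ht] at h2
  linarith

lemma avg_y_succ (ht : t < T) : avg (y (t + 1)) = avg (y t) + η • avg (v t) := by
  rw [funext (h.run.y_succ t ht), avg_add, avg_mix h.stochastic, avg_smul]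

lemma contraction (z : Fin n → EuclideanSpace ℝ (Fin p)) :
    l2norm (fun i => mix W z i - avg z) ≤ lambda₂ W * l2norm fun i => z i - avg z := by
  simpa using l2norm_mix_pow_sub_avg_le h.stochastic h.symm h.connected h.n_pos 1 z

lemma dev_y_succ_le (ht : t < T) :
    dev (y (t + 1)) ≤ lambda₂ W * dev (y t) + η ^ 2 * dev (v t) / (1 - lambda₂ W) := by
  rw [funext (h.run.y_succ t ht), ← dev_smul]
  exact dev_mix_add_le h.n_pos h.stochastic h.connected (lambda₂_nonneg W) (y t) _
    (h.contraction _)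

lemma dev_v_succ_le (ht : t < T) :
    dev (v (t + 1)) ≤ lambda₂ W * dev (v t) + 2 * 𝐋 ^ 2 / (1 - lambda₂ W)
      * (meanSq (fun i => x (t + 1) i - x t i) + meanSq fun i => y (t + 1) i - y t i) := by
  have h0 : v (t + 1) = fun i => mix W (v t) i
      + (P.gradY i (x (t + 1) i) (y (t + 1) i) - P.gradY i (x t i) (y t i)) := by
    funext i; rw [h.run.v_succ t ht i, add_sub_assoc]
  rw [h0]
  have hpos : 0 < 1 - lambda₂ W := by linarith [h.connected]
  refine (dev_mix_add_le h.n_pos h.stochastic h.connected (lambda₂_nonneg W) (v t) _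
    (h.contraction _)).trans ?_
  rw [div_mul_eq_mul_div]
  gcongr
  refine (dev_le_meanSq h.n_pos _).trans (meanSq_le_of_norm_le_add fun i => ?_)
  exact P.norm_gradY_sub_le i (h.x_mem_stiefel ht i) (h.x_mem_stiefel ht.le i)
    (h.run.y_mem _ ht i) (h.run.y_mem _ ht.le i)

lemma dev_u_succ_le (ht : t < T) :
    dev (u (t + 1)) ≤ 1 / 2 * dev (u t) + 4 * 𝐋 ^ 2
      * (meanSq (fun i => x (t + 1) i - x t i) + meanSq fun i => y (t + 1) i - y t i) := by
  have h0 : u (t + 1) = fun i => mix (W ^ k) (u t) i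
      + (P.gradX i (x (t + 1) i) (y (t + 1) i) - P.gradX i (x t i) (y t i)) := by
    funext i; rw [h.run.u_succ t ht i, add_sub_assoc]
  rw [h0]
  have h1 := dev_mix_add_le h.n_pos (pow_mem h.stochastic k) (by norm_num : (1 / 2 : ℝ) < 1)
    (by norm_num) (u t) (fun i => P.gradX i (x (t + 1) i) (y (t + 1) i) - P.gradX i (x t i) (y t i))
    (h.mixing.half h.n_pos _)
  have h2 := (dev_le_meanSq h.n_pos (fun i =>
    P.gradX i (x (t + 1) i) (y (t + 1) i) - P.gradX i (x t i) (y t i))).trans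
    (meanSq_le_of_norm_le_add fun i => P.norm_gradX_sub_le i (h.x_mem_stiefel ht i)
      (h.x_mem_stiefel ht.le i) (h.run.y_mem _ ht i) (h.run.y_mem _ ht.le i))
  refine h1.trans (add_le_add le_rfl ?_)
  rw [show (1 : ℝ) - 1 / 2 = 1 / 2 by norm_num, div_le_iff₀ (by norm_num)]
  exact h2.trans (le_of_eq (by ring))

lemma norm_avg_v_sub_sq_le (ht : t ≤ T) :
    ‖avg (v t) - P.gY (xhat t) (avg (y t))‖ ^ 2
      ≤ 2 * 𝐋 ^ 2 * (meanSq (fun i => x t i - xhat t) + dev (y t)) := by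
  rw [h.avg_v ht, Problem.gY, ← avg_sub]
  refine (norm_avg_sq_le_meanSq h.n_pos _).trans (meanSq_le_of_norm_le_add fun i => ?_)
  exact P.norm_gradY_sub_le i (h.x_mem_stiefel ht i) (h.iam t ht).1 (h.run.y_mem _ ht i)
    (h.avg_y_mem ht)

/-- The step is bounded by the distances of its two endpoints to the maximizer; this avoids the
gradient there, which may be nonzero. -/
lemma norm_smul_avg_v_sq_le (ht : t < T) :
    ‖η • avg (v t)‖ ^ 2 ≤ 4 * ‖avg (y t) - P.yStar (xhat t)‖ ^ 2
      + 8 * (meanSq (fun i => x t i - xhat t) + dev (y t)) := by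
  have hy := h.avg_y_mem (t := t + 1) ht
  rw [h.avg_y_succ ht] at hy
  have h1 := P.norm_ascent_sub_sq_le h.n_pos h.μ_pos h.η_pos h.ημ_le h.ηL_le (h.iam t ht.le).1
    (h.avg_y_mem ht.le) hy
  have h2 := h.norm_avg_v_sub_sq_le ht.le
  set ys := P.yStar (xhat t)
  set N := meanSq (fun i => x t i - xhat t) + dev (y t)
  have hN : 0 ≤ N := add_nonneg (meanSq_nonneg _) (dev_nonneg _)
  have h3 : ‖η • avg (v t)‖ ≤ ‖avg (y t) + η • avg (v t) - ys‖ + ‖avg (y t) - ys‖ := by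
    have := norm_sub_le (avg (y t) + η • avg (v t) - ys) (avg (y t) - ys)
    rwa [sub_sub_sub_cancel_right, add_sub_cancel_left] at this
  have h4 := pow_le_pow_left₀ (norm_nonneg _) h3 2
  have h5 : 2 * η / μ * ‖avg (v t) - P.gY (xhat t) (avg (y t))‖ ^ 2 ≤ 4 * N := by
    have e1 : 2 * η / μ * ‖avg (v t) - P.gY (xhat t) (avg (y t))‖ ^ 2
        ≤ 2 * η / μ * (2 * 𝐋 ^ 2 * N) :=
      mul_le_mul_of_nonneg_left h2 (by have := h.μ_pos; have := h.η_pos; positivity)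
    refine e1.trans ?_
    rw [div_mul_eq_mul_div, div_le_iff₀ h.μ_pos]
    nlinarith [mul_le_mul_of_nonneg_right h.ηL_le hN]
  have h6 : 0 ≤ η * μ / 2 * ‖avg (y t) - ys‖ ^ 2 := by
    have := h.μ_pos; have := h.η_pos; positivity
  nlinarith [sq_nonneg (‖avg (y t) + η • avg (v t) - ys‖ - ‖avg (y t) - ys‖)]

lemma meanSq_y_displacement_le (ht : t < T) :
    meanSq (fun i => y (t + 1) i - y t i) ≤ 16 * dev (y t) + 2 * η ^ 2 * dev (v t)
      + 4 * ‖avg (y t) - P.yStar (xhat t)‖ ^ 2 + 8 * meanSq (fun i => x t i - xhat t) := by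
  have hav : avg (fun i => y (t + 1) i - y t i) = η • avg (v t) := by
    rw [avg_sub, h.avg_y_succ ht, add_sub_cancel_left]
  rw [meanSq_eq_add h.n_pos, hav]
  have h1 := h.norm_smul_avg_v_sq_le ht
  have h2 : dev (fun i => y (t + 1) i - y t i) ≤ 8 * dev (y t) + 2 * η ^ 2 * dev (v t) := by
    have e1 : (fun i => y (t + 1) i - y t i - avg fun i => y (t + 1) i - y t i)
        = fun i => ((mix W (y t) i - avg (y t)) - (y t i - avg (y t)))
          + η • (v t i - avg (v t)) := by
      funext i; rw [hav, h.run.y_succ t ht i]; module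
    have e2 := l2norm_add_le (fun i => (mix W (y t) i - avg (y t)) - (y t i - avg (y t)))
      fun i => η • (v t i - avg (v t))
    have e3 := l2norm_sub_le (fun i => mix W (y t) i - avg (y t)) fun i => y t i - avg (y t)
    have e4 := h.contraction (y t)
    rw [l2norm_smul, abs_of_pos h.η_pos] at e2
    have e5 : lambda₂ W * l2norm (fun i => y t i - avg (y t))
        ≤ 1 * l2norm fun i => y t i - avg (y t) :=
      mul_le_mul_of_nonneg_right h.connected.le (l2norm_nonneg _)
    rw [dev, e1, dev, dev, meanSq, meanSq, meanSq]
    have e6 : l2norm (fun i => ((mix W (y t) i - avg (y t)) - (y t i - avg (y t)))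
        + η • (v t i - avg (v t))) ≤ 2 * l2norm (fun i => y t i - avg (y t))
          + η * l2norm fun i => v t i - avg (v t) := by linarith
    have e7 := pow_le_pow_left₀ (l2norm_nonneg _) e6 2
    have e8 : (2 * l2norm (fun i => y t i - avg (y t)) + η * l2norm fun i => v t i - avg (v t)) ^ 2
        ≤ 8 * l2norm (fun i => y t i - avg (y t)) ^ 2
          + 2 * η ^ 2 * l2norm (fun i => v t i - avg (v t)) ^ 2 := by
      nlinarith [sq_nonneg (2 * l2norm (fun i => y t i - avg (y t))
        - η * l2norm fun i => v t i - avg (v t))]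
    have e9 := mul_le_mul_of_nonneg_left (e7.trans e8) (by positivity : (0 : ℝ) ≤ (n : ℝ)⁻¹)
    linarith
  linarith

lemma norm_yStar_gap_succ_sq_le (ht : t < T) :
    ‖avg (y (t + 1)) - P.yStar (xhat (t + 1))‖ ^ 2
      ≤ (1 - η * μ / 4) * ‖avg (y t) - P.yStar (xhat t)‖ ^ 2
        + 5 * (η / μ) * 𝐋 ^ 2 * (meanSq (fun i => x t i - xhat t) + dev (y t))
        + 10 / (η * μ) * (𝐋 / μ) ^ 2 * meanSq fun i => x (t + 1) i - x t i := by
  have hμ := h.μ_pos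
  have hη := h.η_pos
  have hy := h.avg_y_mem (t := t + 1) ht
  rw [h.avg_y_succ ht] at hy ⊢
  have h1 := P.norm_ascent_sub_moved_sq_le h.n_pos hμ hη h.ημ_le h.ηL_le (h.iam t ht.le).1
    (h.iam (t + 1) ht).1 (h.avg_y_mem ht.le) hy
  have h2 := mul_le_mul_of_nonneg_left (h.norm_avg_v_sub_sq_le ht.le)
    (by positivity : 0 ≤ 5 / 2 * (η / μ))
  have h3 := mul_le_mul_of_nonneg_left (h.norm_xhat_displacement_sq_le ht)
    (by positivity : 0 ≤ 5 / (η * μ) * (𝐋 / μ) ^ 2)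
  have h4 : 5 / (η * μ) * (𝐋 / μ) ^ 2 * (2 * meanSq fun i => x (t + 1) i - x t i)
      = 10 / (η * μ) * (𝐋 / μ) ^ 2 * meanSq fun i => x (t + 1) i - x t i := by ring
  linarith

lemma norm_gX_sub_avg_sq_le (ht : t ≤ T) :
    ‖P.gX (xhat t) (P.yStar (xhat t)) - avg fun i => P.gradX i (x t i) (y t i)‖ ^ 2
      ≤ 3 * 𝐋 ^ 2 * (meanSq (fun i => x t i - xhat t) + dev (y t)
        + ‖avg (y t) - P.yStar (xhat t)‖ ^ 2) := by
  rw [norm_sub_rev, Problem.gX, ← avg_sub]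
  refine (norm_avg_sq_le_meanSq h.n_pos _).trans ?_
  have hL : 0 ≤ 𝐋 := zero_le_one.trans Problem.one_le_maxLip
  set z := avg (y t) - P.yStar (xhat t)
  have h1 : ∑ i, ‖P.gradX i (x t i) (y t i) - P.gradX i (xhat t) (P.yStar (xhat t))‖ ^ 2
      ≤ 3 * 𝐋 ^ 2 * (∑ i, ‖x t i - xhat t‖ ^ 2 + ∑ i, ‖y t i - avg (y t)‖ ^ 2
        + ∑ _i : Fin n, ‖z‖ ^ 2) := by
    rw [← Finset.sum_add_distrib, ← Finset.sum_add_distrib, Finset.mul_sum]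
    refine Finset.sum_le_sum fun i _ => ?_
    have e1 := P.norm_gradX_sub_le i (h.x_mem_stiefel ht i) (h.iam t ht).1 (h.run.y_mem _ ht i)
      (P.yStar_mem _ (h.iam t ht).1)
    have e2 : ‖y t i - P.yStar (xhat t)‖ ≤ ‖y t i - avg (y t)‖ + ‖z‖ :=
      norm_sub_le_norm_sub_add_norm_sub _ _ _
    have e3 := e1.trans (mul_le_mul_of_nonneg_left (add_le_add_right e2 ‖x t i - xhat t‖) hL)
    have e4 := pow_le_pow_left₀ (norm_nonneg _) e3 2
    refine e4.trans ?_
    rw [mul_pow, mul_comm 3, mul_assoc]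
    refine mul_le_mul_of_nonneg_left ?_ (sq_nonneg _)
    nlinarith [sq_nonneg (‖x t i - xhat t‖ - ‖y t i - avg (y t)‖), sq_nonneg (‖x t i - xhat t‖ - ‖z‖),
      sq_nonneg (‖y t i - avg (y t)‖ - ‖z‖)]
  have hn : (n : ℝ) ≠ 0 := by have := h.n_pos; positivity
  have h2 := mul_le_mul_of_nonneg_left h1 (by positivity : (0 : ℝ) ≤ (n : ℝ)⁻¹)
  rw [dev, meanSq_eq_sum, meanSq_eq_sum, meanSq_eq_sum]
  refine h2.trans (le_of_eq ?_)
  simp only [Finset.sum_const, Finset.card_univ, Fintype.card_fin, nsmul_eq_mul]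
  field_simp

/-- First-order progress of the value function along the induced means. -/
lemma inner_gX_displacement_le (ht : t < T) :
    inner ℝ (P.gX (xhat t) (P.yStar (xhat t))) (xhat (t + 1) - xhat t)
      ≤ -(β / 2) * ‖avg fun i => P.gradX i (x t i) (y t i)‖ ^ 2
        + 3 / 2 * β * 𝐋 ^ 2 * (meanSq (fun i => x t i - xhat t) + dev (y t)
          + ‖avg (y t) - P.yStar (xhat t)‖ ^ 2)
        + 1 / 2 * (D ^ 2 * meanSq (fun i => x t i - xhat t) + meanSq (fun i => β • u t i))
        + D * (3 * meanSq (fun i => x t i - xhat t) + 2 * M * meanSq (fun i => β • u t i))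
        + D / 2 * (meanSq (fun i => x t i - xhat t)
          + meanSq fun i => x (t + 1) i - xhat (t + 1)) := by
  have hm := h.regionPoint ht.le
  have hc := h.iam t ht.le
  have hc' := h.iam (t + 1) ht
  have hys := P.yStar_mem _ hc.1
  set g := P.gX (xhat t) (P.yStar (xhat t)) with hg
  set G := avg fun i => P.gradX i (x t i) (y t i) with hG
  have hgD : ‖g‖ ≤ D := P.norm_gX_le h.n_pos hc.1 hys
  have hgt : g ∈ tangent (xhat t) := (P.gX_spec hc.1 hys).1
  set A := avg fun i => tangentProj (x t i) (β • u t i) with hA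
  have h1 : ‖avg (x t) - xhat t‖ ≤ 1 / 2 * meanSq fun i => x t i - xhat t := by
    rw [meanSq_sub]; exact hc.norm_avg_sub_le h.n_pos h.retraction hm.mem.1
  have h2 : ‖avg (x (t + 1)) - xhat (t + 1)‖
      ≤ 1 / 2 * meanSq fun i => x (t + 1) i - xhat (t + 1) := by
    rw [meanSq_sub]
    exact hc'.norm_avg_sub_le h.n_pos h.retraction (h.regionPoint ht).mem.1
  have h3 := hm.norm_avg_step_expansion_le h.mixing h.const (h.norm_smul_u_le ht.le) (xhat t)
  rw [← h.x_succ_eq ht, ← meanSq_sub, ← meanSq, ← hA] at h3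
  -- Only −A is of first order: the expansion error and both gaps between mean and induced mean are
  -- quadratic.
  have hsplit : xhat (t + 1) - xhat t = -A + (avg (x (t + 1)) - avg (x t) + A)
      + (avg (x t) - xhat t) - (avg (x (t + 1)) - xhat (t + 1)) := by abel
  have hb : ∀ (z : Mat d r) (B : ℝ), ‖z‖ ≤ B → |inner ℝ g z| ≤ D * B := fun z B hz =>
    (abs_real_inner_le_norm g z).trans (mul_le_mul hgD hz (norm_nonneg _) h.D_nonneg)
  have h1' := (abs_le.1 (hb _ _ h1)).2
  have h2' := (abs_le.1 (hb _ _ h2)).1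
  have h3' := (abs_le.1 (hb _ _ h3)).2
  -- The normal parts of the βuᵢ need not be of second order themselves, but g is tangent at x̂, so
  -- pairing with it gains a factor ‖xᵢ − x̂‖.
  have hA' : -inner ℝ g A ≤ -β * inner ℝ g G
      + 1 / 2 * (D ^ 2 * meanSq (fun i => x t i - xhat t) + meanSq (fun i => β • u t i)) := by
    have e1 : A = β • G - avg fun i => normalProj (x t i) (β • u t i) := by
      rw [hA, hG, ← h.avg_u ht.le, ← avg_smul, ← avg_sub]; rfl
    have e2 : inner ℝ g (avg fun i => normalProj (x t i) (β • u t i))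
        ≤ 1 / 2 * (D ^ 2 * meanSq (fun i => x t i - xhat t) + meanSq (fun i => β • u t i)) := by
      rw [avg, real_inner_smul_right, inner_sum, meanSq_eq_sum, meanSq_eq_sum]
      have e3 : ∑ i, inner ℝ g (normalProj (x t i) (β • u t i))
          ≤ ∑ i, 1 / 2 * (D ^ 2 * ‖x t i - xhat t‖ ^ 2 + ‖β • u t i‖ ^ 2) := by
        refine Finset.sum_le_sum fun i _ => ?_
        rw [← inner_normalProj_comm]
        have e4 := norm_normalProj_of_mem_tangent (hm.mem.1 i) hgt
        have e5 : ‖normalProj (x t i) g‖ ≤ ‖x t i - xhat t‖ * D :=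
          e4.trans (mul_le_mul_of_nonneg_left hgD (norm_nonneg _))
        have e6 := (real_inner_le_norm (normalProj (x t i) g) (β • u t i)).trans
          (mul_le_mul_of_nonneg_right e5 (norm_nonneg _))
        nlinarith [sq_nonneg (‖x t i - xhat t‖ * D - ‖β • u t i‖)]
      refine (mul_le_mul_of_nonneg_left e3 (by positivity)).trans (le_of_eq ?_)
      rw [← Finset.mul_sum, Finset.sum_add_distrib, ← Finset.mul_sum]; ring
    rw [e1, inner_sub_right, real_inner_smul_right]; linarith
  -- Polarization, dropping −(β/2)‖g‖².
  have hgG : -β * inner ℝ g G ≤ -(β / 2) * ‖G‖ ^ 2 + β / 2 * ‖g - G‖ ^ 2 := by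
    have e1 := norm_sub_sq_real g G
    have e2 := mul_nonneg h.β_pos.le (sq_nonneg ‖g‖)
    rw [e1]; linarith
  have h4 := mul_le_mul_of_nonneg_left (h.norm_gX_sub_avg_sq_le ht.le)
    (by linarith [h.β_pos] : 0 ≤ β / 2)
  rw [hsplit, inner_sub_right, inner_add_right, inner_add_right, inner_neg_right]
  linarith

/-- Most of the error in X has no factor β, so it is later absorbed by the weight of X in the
Lyapunov function and not by a small β. -/
lemma Phi_succ_le (ht : t < T) :
    P.Phi (xhat (t + 1)) ≤ P.Phi (xhat t)
      - β / 2 * ‖avg fun i => P.gradX i (x t i) (y t i)‖ ^ 2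
      + 3 / 2 * β * 𝐋 ^ 2 * (meanSq (fun i => x t i - xhat t) + dev (y t)
          + ‖avg (y t) - P.yStar (xhat t)‖ ^ 2)
      + (1 / 2 * (D ^ 2 + 1) + D * (3 + 2 * M) + D * (1 + 60 / α)
          + (4 * 𝐋 + 2 * 𝐋 ^ 2 / μ) * 32)
        * (meanSq (fun i => x t i - xhat t) + meanSq (fun i => β • u t i)) := by
  have hμ := h.μ_pos
  have hα := h.const.α_pos
  have hα1 := h.const.α_le
  have hD := h.D_nonneg
  have hM := h.const.M_pos
  have hL : 1 ≤ 𝐋 := Problem.one_le_maxLip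
  have h1 := P.Phi_le h.n_pos hμ h.retraction (h.iam t ht.le).1 (h.iam (t + 1) ht).1
    (h.norm_xhat_displacement_le_half ht)
  have h2 := h.inner_gX_displacement_le ht
  have h3 := h.norm_xhat_displacement_sq_le ht
  have h4 := h.meanSq_x_displacement_le ht
  have h5 := h.meanSq_x_succ_le ht
  set X := meanSq fun i => x t i - xhat t with hX
  set w := meanSq fun i => β • u t i with hw
  have hX0 : 0 ≤ X := meanSq_nonneg _
  have hw0 : 0 ≤ w := meanSq_nonneg _
  have e1 : (2 * 𝐋 + 𝐋 ^ 2 / μ) * ‖xhat (t + 1) - xhat t‖ ^ 2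
      ≤ (2 * 𝐋 + 𝐋 ^ 2 / μ) * (64 * (X + w)) :=
    mul_le_mul_of_nonneg_left (by linarith) (by positivity)
  have e2 : D / 2 * (X + meanSq fun i => x (t + 1) i - xhat (t + 1))
      ≤ D / 2 * (2 * X + 120 / α * w) :=
    mul_le_mul_of_nonneg_left (by nlinarith) (by positivity)
  have e3 : D / 2 * (2 * X + 120 / α * w) ≤ D * (1 + 60 / α) * (X + w) := by
    have : D * (1 + 60 / α) * (X + w) - D / 2 * (2 * X + 120 / α * w)
      = D * (60 / α) * X + D * w := by ring
    have : 0 ≤ D * (60 / α) * X + D * w := by positivity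
    linarith
  have e4 : D * (3 * X + 2 * M * w) ≤ D * (3 + 2 * M) * (X + w) := by
    have : 0 ≤ D * (2 * M) * X + D * 3 * w := by positivity
    linarith
  have e5 : 1 / 2 * (D ^ 2 * X + w) ≤ 1 / 2 * (D ^ 2 + 1) * (X + w) := by
    have : 0 ≤ D ^ 2 * w + X := by positivity
    linarith
  have e6 : (2 * 𝐋 + 𝐋 ^ 2 / μ) * (64 * (X + w))
      = (4 * 𝐋 + 2 * 𝐋 ^ 2 / μ) * 32 * (X + w) := by ring
  linarith

end ControlledRun

end Run

/-! ### Scalar inequalities for the Lyapunov function -/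

section Lyapunov

/-- These are the feedbacks into Z, S and V through the coupled recursions of y and v; a small η
keeps each below a quarter of the decay it competes with. -/
lemma step_size_bounds {L η κ Q : ℝ} (hL : 1 ≤ L) (hη : 0 < η) (hκ : 0 < κ) (hκ1 : κ ≤ 1)
    (hQ0 : 0 < Q) (h48 : 48 * (η * Q * L) ≤ κ) (h288 : 288 * L ^ 2 * η ≤ κ ^ 2) :
    η * Q * (2 * L ^ 2 / κ) * 12 ≤ L / 2 ∧ η * Q * (2 * L ^ 2 / κ) * 36 ≤ Q * κ / 4 ∧
      Q * η ^ 2 / κ ≤ η * Q * κ / 4 ∧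
      η * Q * (2 * L ^ 2 / κ) * (3 * η ^ 2) ≤ η * Q * κ / 4 := by
  have hηL : η ≤ L ^ 2 * η := le_mul_of_one_le_left hη.le (one_le_pow₀ hL)
  have hκ2 : κ ^ 2 ≤ 1 := pow_le_one₀ hκ.le hκ1
  have hη1 : η ≤ 1 := by linarith
  refine ⟨?_, ?_, ?_, ?_⟩
  · have e1 : η * Q * (2 * L ^ 2 / κ) * 12 = (48 * (η * Q * L)) / κ * (L / 2) := by ring
    have e2 := mul_le_mul_of_nonneg_right ((div_le_one hκ).2 h48) (by linarith : 0 ≤ L / 2)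
    rw [e1]; linarith
  · have e1 : η * Q * (2 * L ^ 2 / κ) * 36 = (288 * L ^ 2 * η) / κ * (Q / 4) := by ring
    have e2 : (288 * L ^ 2 * η) / κ ≤ κ := by rw [div_le_iff₀ hκ]; linarith
    have e3 := mul_le_mul_of_nonneg_right e2 (by linarith : 0 ≤ Q / 4)
    rw [e1]; linarith
  · rw [div_le_iff₀ hκ]
    have e1 := mul_le_mul_of_nonneg_left (by linarith : 4 * η ≤ κ ^ 2) (mul_pos hQ0 hη).le
    linarith
  · have e1 : η * Q * (2 * L ^ 2 / κ) * (3 * η ^ 2) = (24 * L ^ 2 * η ^ 2) / κ * (η * Q / 4) := by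
      ring
    have e2 : (24 * L ^ 2 * η ^ 2) / κ ≤ κ := by
      rw [div_le_iff₀ hκ]
      have := mul_le_mul_of_nonneg_left hη1 (by positivity : 0 ≤ L ^ 2 * η)
      linarith
    have e3 := mul_le_mul_of_nonneg_right e2 (by positivity : 0 ≤ η * Q / 4)
    rw [e1]; linarith

/-- One-step decrease of the potential, before the consensus and tracking errors are absorbed. -/
lemma potential_step {L μ η κ β Q c₅ c₆ c₇ X G S S' V V' Z Z' Φ Φ' w Δ : ℝ}
    (hL : 1 ≤ L) (hμ : 0 < μ) (hη : 0 < η) (hκ : 0 < κ) (hκ1 : κ ≤ 1) (hQ0 : 0 < Q)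
    (hQ : Q * κ = 80 * L ^ 3 / μ ^ 2 + 4) (h48 : 48 * (η * Q * L) ≤ κ)
    (h288 : 288 * L ^ 2 * η ≤ κ ^ 2)
    (hc₇ : c₇ = c₆ + 8 * L / (μ * η) * c₅ + 112 * (η * Q * L ^ 2 / κ))
    (hβL : β * (3 * L ^ 2) ≤ 1) (hS0 : 0 ≤ S) (hV0 : 0 ≤ V) (hZ0 : 0 ≤ Z)
    (hΔ : Δ ≤ 36 * S + 3 * η ^ 2 * V + 12 * Z + 56 * (X + w))
    (hS : S' ≤ (1 - κ) * S + η ^ 2 * V / κ)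
    (hV : V' ≤ (1 - κ) * V + 2 * L ^ 2 / κ * Δ)
    (hZ : Z' ≤ (1 - η * μ / 4) * Z + 5 * (η / μ) * L ^ 2 * S + c₅ * (X + w))
    (hΦ : Φ' ≤ Φ - β / 2 * G + 3 / 2 * β * L ^ 2 * (S + Z) + c₆ * (X + w)) :
    Φ' + 8 * L / (μ * η) * Z' + Q * S' + η * Q * V'
      ≤ Φ + 8 * L / (μ * η) * Z + Q * S + η * Q * V - β / 2 * G - L * Z - S
        - η * Q * κ / 2 * V + c₇ * (X + w) := by
  have hL0 : 0 < L := by linarith only [hL]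
  -- The weight 8L/(μη) turns the rate ημ/4 into the decay 2L Z and the error into 40L³/μ² · S; Qκ
  -- is twice the latter coefficient plus 4.
  have hZt : 8 * L / (μ * η) * Z' ≤ 8 * L / (μ * η) * Z - 2 * L * Z + 40 * L ^ 3 / μ ^ 2 * S
      + 8 * L / (μ * η) * c₅ * (X + w) := by
    refine (mul_le_mul_of_nonneg_left hZ (by positivity)).trans (le_of_eq ?_)
    field_simp; ring
  have hSt : Q * S' ≤ Q * S - Q * κ * S + Q * η ^ 2 / κ * V := by
    refine (mul_le_mul_of_nonneg_left hS hQ0.le).trans (le_of_eq ?_)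
    ring
  have hVt : η * Q * V' ≤ η * Q * V - η * Q * κ * V + η * Q * (2 * L ^ 2 / κ) * 36 * S
      + η * Q * (2 * L ^ 2 / κ) * (3 * η ^ 2) * V + η * Q * (2 * L ^ 2 / κ) * 12 * Z
      + 112 * (η * Q * L ^ 2 / κ) * (X + w) := by
    have e1 := mul_le_mul_of_nonneg_left hΔ (by positivity : 0 ≤ 2 * L ^ 2 / κ)
    have e2 := mul_le_mul_of_nonneg_left (hV.trans (add_le_add_right e1 _))
      (by positivity : 0 ≤ η * Q)
    refine e2.trans (le_of_eq ?_)
    ring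
  obtain ⟨k1, k2, k3, k4⟩ := step_size_bounds hL hη hκ hκ1 hQ0 h48 h288
  have k5 : 40 * L ^ 3 / μ ^ 2 = (Q * κ - 4) / 2 := by rw [hQ]; ring
  have k6 : 0 ≤ L ^ 3 / μ ^ 2 := by positivity
  have k7 : 4 ≤ Q * κ := by
    have e : 80 * L ^ 3 / μ ^ 2 = 80 * (L ^ 3 / μ ^ 2) := by ring
    rw [hQ, e]; linarith only [k6]
  have k8 : 3 / 2 * β * L ^ 2 * (S + Z) ≤ 1 / 2 * S + L / 2 * Z := by
    have e : 3 / 2 * β * L ^ 2 ≤ 1 / 2 := by linarith only [hβL]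
    have e1 := mul_le_mul_of_nonneg_right e hS0
    have e2 := mul_le_mul_of_nonneg_right (e.trans (by linarith only [hL] : 1 / 2 ≤ L / 2)) hZ0
    linarith only [e1, e2]
  have e1 := mul_le_mul_of_nonneg_right k1 hZ0
  have e2 := mul_le_mul_of_nonneg_right k2 hS0
  have e3 := mul_le_mul_of_nonneg_right k3 hV0
  have e4 := mul_le_mul_of_nonneg_right k4 hV0
  have e5 := mul_le_mul_of_nonneg_right k7 hS0
  rw [k5] at hZt
  have e6 : c₇ * (X + w) = c₆ * (X + w) + 8 * L / (μ * η) * c₅ * (X + w)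
    + 112 * (η * Q * L ^ 2 / κ) * (X + w) := by rw [hc₇]; ring
  rw [e6]
  linarith only [e1, e2, e3, e4, e5, hZt, hSt, hVt, hΦ, k8, hS0]

/-- The excess c₇(X + w) is paid as follows: the weight of X yields (c₇ + 2)X at the price c₈ w; the
weight B of β²U, halved in each step, yields the U-part of (c₇ + c₈ + 1)w; and a small β puts the
G-part below (β/4)G. -/
lemma lyapunov_step {L μ η κ α β Q B c₅ c₆ c₇ c₈ X X' G U U' S S' V V' Z Z' Φ Φ' w Δ : ℝ}
    (hL : 1 ≤ L) (hμ : 0 < μ) (hη : 0 < η) (hκ : 0 < κ) (hκ1 : κ ≤ 1) (hQ0 : 0 < Q)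
    (hQ : Q * κ = 80 * L ^ 3 / μ ^ 2 + 4) (h48 : 48 * (η * Q * L) ≤ κ)
    (h288 : 288 * L ^ 2 * η ≤ κ ^ 2) (hα : 0 < α) (hβ : 0 < β) (hβ1 : β ≤ 1)
    (hc₅ : 0 ≤ c₅) (hc₆ : 0 ≤ c₆)
    (hc₇ : c₇ = c₆ + 8 * L / (μ * η) * c₅ + 112 * (η * Q * L ^ 2 / κ))
    (hc₈ : c₈ = 3600 / α ^ 2 * (c₇ + 2)) (hB : B = 2 * (c₇ + c₈ + 1))
    (hβL : β * (3 * L ^ 2) ≤ 1) (hβB : β * (224 * B * L ^ 2) ≤ 1)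
    (hβV : β * (12 * B * L ^ 2 * η ^ 2) ≤ η * Q * κ / 2) (hβG : β * (4 * (c₇ + c₈ + 1)) ≤ 1)
    (hX0 : 0 ≤ X) (hG0 : 0 ≤ G) (hU0 : 0 ≤ U) (hS0 : 0 ≤ S) (hV0 : 0 ≤ V) (hZ0 : 0 ≤ Z)
    (hw : w = β ^ 2 * (G + U))
    (hΔ : Δ ≤ 36 * S + 3 * η ^ 2 * V + 12 * Z + 56 * (X + w))
    (hX : X' ≤ (1 - α / 30) * X + 120 / α * w)
    (hU : U' ≤ 1 / 2 * U + 4 * L ^ 2 * Δ)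
    (hS : S' ≤ (1 - κ) * S + η ^ 2 * V / κ)
    (hV : V' ≤ (1 - κ) * V + 2 * L ^ 2 / κ * Δ)
    (hZ : Z' ≤ (1 - η * μ / 4) * Z + 5 * (η / μ) * L ^ 2 * S + c₅ * (X + w))
    (hΦ : Φ' ≤ Φ - β / 2 * G + 3 / 2 * β * L ^ 2 * (S + Z) + c₆ * (X + w)) :
    Φ' + 8 * L / (μ * η) * Z' + Q * S' + η * Q * V' + 30 / α * (c₇ + 2) * X' + B * (β ^ 2 * U')
      ≤ Φ + 8 * L / (μ * η) * Z + Q * S + η * Q * V + 30 / α * (c₇ + 2) * X + B * (β ^ 2 * U)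
        - (β / 4 * G + X + L / 2 * Z) := by
  have hL0 : 0 < L := by linarith only [hL]
  have hw0 : 0 ≤ w := by rw [hw]; positivity
  have hc₇0 : 0 ≤ c₇ := by rw [hc₇]; positivity
  have hc₈0 : 0 ≤ c₈ := by rw [hc₈]; positivity
  have hB0 : 0 < B := by rw [hB]; positivity
  have hH := potential_step hL hμ hη hκ hκ1 hQ0 hQ h48 h288 hc₇ hβL hS0 hV0 hZ0 hΔ hS hV hZ hΦ
  have hXt : 30 / α * (c₇ + 2) * X' ≤ 30 / α * (c₇ + 2) * X - (c₇ + 2) * X + c₈ * w := by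
    refine (mul_le_mul_of_nonneg_left hX (by positivity)).trans (le_of_eq ?_)
    rw [hc₈]; field_simp; ring
  have hβ2 : β ^ 2 ≤ β := pow_le_of_le_one hβ.le hβ1 two_ne_zero
  have hUt : B * (β ^ 2 * U') ≤ B * (β ^ 2 * U) - (c₇ + c₈ + 1) * (β ^ 2 * U)
      + B * β ^ 2 * (4 * L ^ 2) * (36 * S + 3 * η ^ 2 * V + 12 * Z + 56 * (X + w)) := by
    have e1 := mul_le_mul_of_nonneg_left hΔ (by positivity : 0 ≤ 4 * L ^ 2)
    have e2 := mul_le_mul_of_nonneg_left (hU.trans (add_le_add_right e1 _))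
      (by positivity : 0 ≤ B * β ^ 2)
    rw [hB] at e2 ⊢
    linarith only [e2]
  -- The displacement feeds into the tracking term with factor Bβ² ≤ Bβ, which a small β makes
  -- harmless.
  have m1 : B * β ^ 2 * (4 * L ^ 2) * 56 ≤ 1 := by
    have := mul_le_mul_of_nonneg_right hβ2 (by positivity : 0 ≤ B * (4 * L ^ 2) * 56)
    linarith only [this, hβB]
  have m2 : B * β ^ 2 * (4 * L ^ 2) * (3 * η ^ 2) ≤ η * Q * κ / 2 := by
    have := mul_le_mul_of_nonneg_right hβ2 (by positivity : 0 ≤ B * (4 * L ^ 2) * (3 * η ^ 2))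
    linarith only [this, hβV]
  have m0 : 0 < B * β ^ 2 * L ^ 2 := by positivity
  have n1 := mul_le_mul_of_nonneg_right m1 (add_nonneg hX0 hw0)
  have n2 := mul_le_mul_of_nonneg_right m2 hV0
  have n3 : B * β ^ 2 * (4 * L ^ 2) * 36 * S ≤ 1 * S :=
    mul_le_mul_of_nonneg_right (by linarith only [m0, m1]) hS0
  have n4 : B * β ^ 2 * (4 * L ^ 2) * 12 * Z ≤ L / 2 * Z :=
    mul_le_mul_of_nonneg_right (by linarith only [m0, m1, hL]) hZ0
  have n5 : (c₇ + c₈ + 1) * (β ^ 2 * G) ≤ β / 4 * G := by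
    have := mul_le_mul_of_nonneg_right hβG (by positivity : 0 ≤ β / 4 * G)
    linarith only [this]
  have n6 : (c₇ + c₈ + 1) * w = (c₇ + c₈ + 1) * (β ^ 2 * G) + (c₇ + c₈ + 1) * (β ^ 2 * U) := by
    rw [hw]; ring
  linarith only [hH, hXt, hUt, n1, n2, n3, n4, n5, n6]

lemma sum_range_le_of_step {f g : ℕ → ℝ} {T : ℕ} (h : ∀ t < T, f (t + 1) ≤ f t - g t) :
    ∑ t ∈ Finset.range T, g t ≤ f 0 - f T := by
  induction T with
  | zero => simp
  | succ T ih =>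
    rw [Finset.sum_range_succ]
    have := ih fun t ht => h t (by omega)
    have := h T (by omega)
    linarith

end Lyapunov

/-! ### Summation along a run -/

section Main

variable {n d r p : ℕ} {L₁₁ L₁₂ L₂₁ L₂₂ μ D : ℝ}

local notation "𝐋" => maxLip L₁₁ L₁₂ L₂₁ L₂₂

/-- Error constant in the recursion for the distance to the maximizer. -/
def gapConst (L μ η : ℝ) : ℝ := 5 * (η / μ) * L ^ 2 + 320 / (η * μ) * (L / μ) ^ 2

/-- Error constant in the descent of the value function. -/
def descentConst (L μ D M α : ℝ) : ℝ :=
  3 / 2 * L ^ 2 + (1 / 2 * (D ^ 2 + 1) + D * (3 + 2 * M) + D * (1 + 60 / α)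
    + (4 * L + 2 * L ^ 2 / μ) * 32)

/-- Total error constant of the potential. -/
def potentialConst (L μ η κ Q D M α : ℝ) : ℝ :=
  descentConst L μ D M α + 8 * L / (μ * η) * gapConst L μ η + 112 * (η * Q * L ^ 2 / κ)

/-- Weight of the tracking error in the Lyapunov function. -/
def trackingWeight (α c : ℝ) : ℝ := 2 * (c + 3600 / α ^ 2 * (c + 2) + 1)

lemma gapConst_nonneg {L μ η : ℝ} (hμ : 0 < μ) (hη : 0 < η) : 0 ≤ gapConst L μ η := by
  unfold gapConst; positivity

lemma descentConst_nonneg {L μ D M α : ℝ} (hL : 1 ≤ L) (hμ : 0 < μ) (hD : 0 ≤ D) (hM : 0 < M)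
    (hα : 0 < α) : 0 ≤ descentConst L μ D M α := by
  unfold descentConst; positivity

lemma potentialConst_nonneg {L μ η κ Q D M α : ℝ} (hL : 1 ≤ L) (hμ : 0 < μ) (hη : 0 < η)
    (hκ : 0 < κ) (hQ : 0 < Q) (hD : 0 ≤ D) (hM : 0 < M) (hα : 0 < α) :
    0 ≤ potentialConst L μ η κ Q D M α := by
  have h1 := gapConst_nonneg (L := L) hμ hη
  have h2 := descentConst_nonneg hL hμ hD hM hα
  unfold potentialConst; positivity

lemma Problem.H_eq (P : Problem n d r p L₁₁ L₁₂ L₂₁ L₂₂ μ D) (Q η : ℝ) (xhat : Mat d r)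
    (y v : Fin n → EuclideanSpace ℝ (Fin p)) :
    P.H Q η xhat y v = P.Phi xhat + 8 * 𝐋 / (μ * η) * ‖avg y - P.yStar xhat‖ ^ 2
      + Q * dev y + η * Q * dev v := by
  rw [Problem.H, dev, dev, meanSq_sub, meanSq_sub]; ring

variable {P : Problem n d r p L₁₁ L₁₂ L₂₁ L₂₂ μ D} {W : Matrix (Fin n) (Fin n) ℝ}
    {k : ℕ} {R : Mat d r → Mat d r → Mat d r} {ε M τ δ₁ δ₂ α β η Q κ c B : ℝ} {T : ℕ}
    {x : ℕ → Fin n → Mat d r} {y : ℕ → Fin n → EuclideanSpace ℝ (Fin p)}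
    {u : ℕ → Fin n → Mat d r} {v : ℕ → Fin n → EuclideanSpace ℝ (Fin p)}
    {xhat : ℕ → Mat d r}

/-- The accumulated convergence measure is controlled by the decrease of the potential. -/
lemma ControlledRun.sum_M_le (h : ControlledRun P W k R ε M τ δ₁ δ₂ α β η T x y u v xhat)
    (hκ : κ = 1 - lambda₂ W) (hQ0 : 0 < Q) (hQ : Q * κ = 80 * 𝐋 ^ 3 / μ ^ 2 + 4)
    (h48 : 48 * (η * Q * 𝐋) ≤ κ) (h288 : 288 * 𝐋 ^ 2 * η ≤ κ ^ 2)
    (hc : c = potentialConst 𝐋 μ η κ Q D M α) (hB : B = trackingWeight α c)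
    (hβL : β * (3 * 𝐋 ^ 2) ≤ 1) (hβB : β * (224 * B * 𝐋 ^ 2) ≤ 1)
    (hβV : β * (12 * B * 𝐋 ^ 2 * η ^ 2) ≤ η * Q * κ / 2) (hβG : β * (2 * B) ≤ 1) :
    β * ∑ t ∈ Finset.range T, P.M (xhat t) (x t) (y t)
      ≤ 4 * (P.H Q η (xhat 0) (y 0) (v 0) - P.H Q η (xhat T) (y T) (v T)
        + (30 / α * (c + 2) + B * D ^ 2)) := by
  have hL : 1 ≤ 𝐋 := Problem.one_le_maxLip
  have hμ := h.μ_pos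
  have hη := h.η_pos
  have hα := h.const.α_pos
  have hκ0 : 0 < κ := by rw [hκ]; linarith [h.connected]
  have hκ1 : κ ≤ 1 := by rw [hκ]; linarith [lambda₂_nonneg W]
  have hc0 : 0 ≤ c := by
    rw [hc]; exact potentialConst_nonneg hL hμ hη hκ0 hQ0 h.D_nonneg h.const.M_pos hα
  have hB0 : 0 ≤ B := by rw [hB, trackingWeight]; positivity
  set X : ℕ → ℝ := fun t => meanSq fun i => x t i - xhat t with hX
  set G : ℕ → ℝ := fun t => ‖avg fun i => P.gradX i (x t i) (y t i)‖ ^ 2 with hG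
  set Z : ℕ → ℝ := fun t => ‖avg (y t) - P.yStar (xhat t)‖ ^ 2 with hZ
  -- The Lyapunov function: it is never below H, and at time 0 it exceeds H by at most the constant
  -- C₄.
  set J : ℕ → ℝ := fun t => P.Phi (xhat t) + 8 * 𝐋 / (μ * η) * Z t + Q * dev (y t)
    + η * Q * dev (v t) + 30 / α * (c + 2) * X t + B * (β ^ 2 * dev (u t)) with hJ
  have hX0 : ∀ t, 0 ≤ X t := fun t => meanSq_nonneg _
  have hG0 : ∀ t, 0 ≤ G t := fun t => sq_nonneg _
  have hZ0 : ∀ t, 0 ≤ Z t := fun t => sq_nonneg _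
  have hstep : ∀ t < T, J (t + 1) ≤ J t - (β / 4 * G t + X t + 𝐋 / 2 * Z t) := by
    intro t ht
    have hw := h.meanSq_smul_u ht.le
    have hw0 : 0 ≤ meanSq fun i => β • u t i := meanSq_nonneg _
    have hdx := h.meanSq_x_displacement_le ht
    have hdy := h.meanSq_y_displacement_le ht
    have hS := h.dev_y_succ_le ht
    have hV := h.dev_v_succ_le ht
    have hΦ := h.Phi_succ_le ht
    have hgap := h.norm_yStar_gap_succ_sq_le ht
    have hl : lambda₂ W = 1 - κ := by rw [hκ]; ring
    rw [← hκ, hl] at hS hV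
    have hβL2 : 3 / 2 * β * 𝐋 ^ 2 * X t ≤ 3 / 2 * 𝐋 ^ 2 * (X t + meanSq fun i => β • u t i) := by
      have e1 := mul_le_mul_of_nonneg_right h.β_le (by have := hX0 t; positivity : 0 ≤ 𝐋 ^ 2 * X t)
      have e2 : 0 ≤ 𝐋 ^ 2 * meanSq fun i => β • u t i := by positivity
      linarith
    have hV2 := mul_nonneg (sq_nonneg η) (dev_nonneg (v t))
    refine lyapunov_step (w := meanSq fun i => β • u t i) hL hμ hη hκ0 hκ1 hQ0 hQ h48 h288 hα
      h.β_pos h.β_le (gapConst_nonneg hμ hη)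
      (descentConst_nonneg hL hμ h.D_nonneg h.const.M_pos hα) hc rfl hB hβL hβB hβV ?_
      (hX0 t) (hG0 t) (dev_nonneg (u t)) (dev_nonneg (y t)) (dev_nonneg (v t)) (hZ0 t) hw ?_
      (h.meanSq_x_succ_le ht) (h.dev_u_succ_le ht) hS hV ?_ ?_
    · rw [hB, trackingWeight] at hβG; linarith
    · linarith [hX0 t, hZ0 t, dev_nonneg (y t)]
    · have e1 := mul_le_mul_of_nonneg_left hdx
        (by positivity : 0 ≤ 10 / (η * μ) * (𝐋 / μ) ^ 2)
      have e2 : 10 / (η * μ) * (𝐋 / μ) ^ 2 * (32 * X t + 8 * meanSq fun i => β • u t i)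
          ≤ 320 / (η * μ) * (𝐋 / μ) ^ 2 * (X t + meanSq fun i => β • u t i) := by
        have : 0 ≤ 1 / (η * μ) * (𝐋 / μ) ^ 2 * meanSq fun i => β • u t i := by positivity
        have e3 : 320 / (η * μ) * (𝐋 / μ) ^ 2 * (X t + meanSq fun i => β • u t i)
          - 10 / (η * μ) * (𝐋 / μ) ^ 2 * (32 * X t + 8 * meanSq fun i => β • u t i)
          = 240 * (1 / (η * μ) * (𝐋 / μ) ^ 2 * meanSq fun i => β • u t i) := by ring
        linarith
      have e4 : 0 ≤ 5 * (η / μ) * 𝐋 ^ 2 * meanSq fun i => β • u t i := by positivity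
      rw [gapConst]
      linarith
    · rw [descentConst]
      linarith
  have hsum := sum_range_le_of_step hstep
  -- The factor 4 comes from (β/4)G; the other two terms only need β ≤ 1 and n ≥ 1.
  have hM : ∀ t, β * P.M (xhat t) (x t) (y t) ≤ 4 * (β / 4 * G t + X t + 𝐋 / 2 * Z t) := by
    intro t
    have e1 : P.M (xhat t) (x t) (y t) = G t + X t + 𝐋 / n * Z t := by
      rw [Problem.M, hX]; simp only [meanSq_sub, one_div]; rfl
    have e2 : 𝐋 / n ≤ 𝐋 := div_le_self (by linarith) (by exact_mod_cast h.n_pos)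
    have e3 := mul_le_mul_of_nonneg_right e2 (hZ0 t)
    have e4 : 0 ≤ 𝐋 / n * Z t := by have := hZ0 t; positivity
    have e5 := mul_le_mul_of_nonneg_right h.β_le (add_nonneg (hX0 t) e4)
    have e6 : 0 ≤ 𝐋 * Z t := by have := hZ0 t; positivity
    rw [e1]
    linarith [hX0 t]
  have hX1 : X 0 ≤ 1 := by
    refine (meanSq_le_of_norm_le h.n_pos fun i => (?_ : ‖x 0 i - xhat 0‖ ≤ 1)).trans (by norm_num)
    refine (norm_sub_le_norm_sub_add_norm_sub _ (avg (x 0)) _).trans ?_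
    linarith [h.init.mem.2.2 i, h.init.δ₂_le, h.norm_avg_x_sub_le (Nat.zero_le T)]
  have hU1 : dev (u 0) ≤ D ^ 2 := by
    refine (dev_le_meanSq h.n_pos _).trans (meanSq_le_of_norm_le h.n_pos fun i => ?_)
    rw [h.run.u_zero]; exact h.norm_gradX_le (Nat.zero_le T) i
  have hβ2 : β ^ 2 ≤ 1 := pow_le_one₀ h.β_pos.le h.β_le
  have hJ0 : J 0 ≤ P.H Q η (xhat 0) (y 0) (v 0) + (30 / α * (c + 2) + B * D ^ 2) := by
    have e1 : 30 / α * (c + 2) * X 0 ≤ 30 / α * (c + 2) * 1 :=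
      mul_le_mul_of_nonneg_left hX1 (by positivity)
    have e2 : B * (β ^ 2 * dev (u 0)) ≤ B * (1 * D ^ 2) :=
      mul_le_mul_of_nonneg_left (mul_le_mul hβ2 hU1 (dev_nonneg _) zero_le_one) hB0
    rw [Problem.H_eq]
    linarith
  have hJT : P.H Q η (xhat T) (y T) (v T) ≤ J T := by
    have e1 : 0 ≤ 30 / α * (c + 2) * X T := by have := hX0 T; positivity
    have e2 : 0 ≤ B * (β ^ 2 * dev (u T)) := by have := dev_nonneg (u T); positivity
    rw [Problem.H_eq]
    linarith
  calc β * ∑ t ∈ Finset.range T, P.M (xhat t) (x t) (y t)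
      = ∑ t ∈ Finset.range T, β * P.M (xhat t) (x t) (y t) := Finset.mul_sum _ _ _
    _ ≤ ∑ t ∈ Finset.range T, 4 * (β / 4 * G t + X t + 𝐋 / 2 * Z t) :=
        Finset.sum_le_sum fun t _ => hM t
    _ = 4 * ∑ t ∈ Finset.range T, (β / 4 * G t + X t + 𝐋 / 2 * Z t) := (Finset.mul_sum _ _ _).symm
    _ ≤ _ := by linarith

lemma Problem.M_nonneg (P : Problem n d r p L₁₁ L₁₂ L₂₁ L₂₂ μ D) (xhat : Mat d r)
    (x : Fin n → Mat d r) (y : Fin n → EuclideanSpace ℝ (Fin p)) : 0 ≤ P.M xhat x y := by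
  have hL : 1 ≤ 𝐋 := Problem.one_le_maxLip
  have := sqDist_nonneg x xhat
  rw [Problem.M]; positivity

/-- The added 1 keeps the threshold for β positive when b = 0, for instance when D = 0. -/
lemma mul_le_of_le_div_add_one {a b β : ℝ} (hb : 0 ≤ b) (hβ : 0 < β) (h : β ≤ a / (b + 1)) :
    β * b ≤ a := by
  rw [le_div_iff₀ (by positivity)] at h
  linarith

end Main

/-! ### Assembling the constants -/

section Main

variable {n d r p : ℕ}

lemma isHalfMixing_pow {W : Matrix (Fin n) (Fin n) ℝ} (hn : 1 ≤ n)
    (hW : W ∈ doublyStochastic ℝ (Fin n)) (hWsymm : W.IsSymm) (hWconn : lambda₂ W < 1) {k : ℕ}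
    (hk1 : 1 ≤ k) (hk : ⌈Real.logb (lambda₂ W) (1 / (2 * √(n : ℝ)))⌉₊ ≤ k) :
    IsHalfMixing d r (W ^ k) :=
  ⟨pow_mem hW k, fun z => (l2norm_mix_pow_sub_avg_le hW hWsymm hWconn hn k z).trans
    (mul_le_mul_of_nonneg_right (lambda₂_pow_le hWconn hn hk1 hk) (l2norm_nonneg _))⟩

lemma regionPoint_of_mem {δ₁ δ₂ : ℝ} (hn : 1 ≤ n) (hr : 1 ≤ r) (hδ₁ : 0 < δ₁)
    (hδ₁₂ : δ₁ ≤ 1 / (5 * √(r : ℝ)) * δ₂) (hδ₂ : δ₂ ≤ 1 / 6) {x : Fin n → Mat d r}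
    (hx : x ∈ consensusRegion n d r δ₁ δ₂) : RegionPoint δ₁ δ₂ x := by
  have hr' : (1 : ℝ) ≤ √r := Real.one_le_sqrt.2 (by exact_mod_cast hr)
  have hpos : 0 < 1 / (5 * √(r : ℝ)) := by positivity
  have hδ : 0 < δ₂ := by
    by_contra! hneg
    have := mul_nonpos_of_nonneg_of_nonpos hpos.le hneg
    linarith
  refine ⟨hn, hδ₁, hδ₁₂.trans ?_, hδ₂, hx⟩
  have : 1 / (5 * √(r : ℝ)) ≤ 1 / 5 := one_div_le_one_div_of_le (by norm_num) (by linarith)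
  have := mul_le_mul_of_nonneg_right this hδ.le
  linarith

lemma StepConstants.isConsensusRate {W : Matrix (Fin n) (Fin n) ℝ} {k : ℕ}
    {R : Mat d r → Mat d r → Mat d r} {ε M α δ₁ δ₂ : ℝ} (hc : StepConstants R ε M α 0)
    (hR : IsRetraction R) (hV : IsHalfMixing d r (W ^ k)) (hδ₁ : 0 < δ₁)
    (hregion : ∀ x ∈ consensusRegion n d r δ₁ δ₂, RegionPoint δ₁ δ₂ x) :
    IsConsensusRate W k R δ₁ δ₂ α (1 - α / 30) := by
  intro x hx
  have hx' := hregion x hx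
  have hstep : consensusStep W k R α x = perturbedStep (W ^ k) R α x fun _ => 0 := by
    funext i
    rw [consensusStep, perturbedStep, ← tangentProjₗ_apply (x i) 0, map_zero, sub_zero]
  have hw : ∀ i : Fin n, ‖(fun _ => (0 : Mat d r)) i‖ ≤ 0 := fun i => by simp
  rw [hstep]
  refine ⟨hx'.perturbedStep_mem hV hc hw hR (by have := hc.α_pos; positivity), ?_⟩
  intro c c' hcx hcx'
  have h1 := hx'.l2norm_step_sub_iam_le hV hc hw hR hcx
  have h2 : l2norm (fun _ : Fin n => (0 : Mat d r)) = 0 := by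
    rw [← sq_eq_zero_iff, l2norm_sq]; simp
  rw [h2, mul_zero, add_zero, ← sqrt_sqDist, ← sqrt_sqDist] at h1
  exact (Real.sqrt_le_sqrt (hcx'.2 c hcx.1)).trans h1

/-- The Lipschitz bound of the projection with A = B. It makes the initial potential independent of
the choice of induced means. -/
lemma IsIAM.unique {R : Mat d r → Mat d r → Mat d r} (hR : IsRetraction R) {δ₁ δ₂ : ℝ}
    {x : Fin n → Mat d r} (hx : RegionPoint δ₁ δ₂ x) {c c' : Mat d r} (hc : IsIAM x c)
    (hc' : IsIAM x c') : c = c' := by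
  have hclose : ∀ {b}, IsIAM x b → ‖avg x - b‖ ≤ 1 / 4 := fun hb => by
    refine ((hb.isNearest hx.n_pos).2 (x ⟨0, hx.n_pos⟩) (hx.mem.1 _)).trans ?_
    rw [norm_sub_rev]
    linarith [hx.mem.2.2 ⟨0, hx.n_pos⟩, hx.δ₂_le]
  have := (hc.isNearest hx.n_pos).norm_sub_le hR (hc'.isNearest hx.n_pos) (hclose hc) (hclose hc')
  rw [sub_self, norm_zero, mul_zero] at this
  exact sub_eq_zero.1 (norm_le_zero_iff.1 this)

variable {L₁₁ L₁₂ L₂₁ L₂₂ μ D : ℝ}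

/-- K must be fixed before T and the run. The initial potential is determined by the initial data,
and the final one is at least the lower bound of Φ. -/
lemma Problem.exists_potential_gap_le (P : Problem n d r p L₁₁ L₁₂ L₂₁ L₂₂ μ D)
    {R : Mat d r → Mat d r → Mat d r} (hR : IsRetraction R) {δ₁ δ₂ : ℝ} {x₀ : Fin n → Mat d r}
    (hx₀ : RegionPoint δ₁ δ₂ x₀) (y₀ v₀ : Fin n → EuclideanSpace ℝ (Fin p)) {Q η : ℝ}
    (hμ : 0 < μ) (hη : 0 < η) (hQ : 0 < Q) :
    ∃ K, ∀ c c' : Mat d r, IsIAM x₀ c → c' ∈ stiefel d r →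
      ∀ y v : Fin n → EuclideanSpace ℝ (Fin p), P.H Q η c y₀ v₀ - P.H Q η c' y v ≤ K := by
  obtain ⟨m, hm⟩ := P.exists_le_Phi
  by_cases hex : ∃ c, IsIAM x₀ c
  · obtain ⟨c₀, hc₀⟩ := hex
    refine ⟨P.H Q η c₀ y₀ v₀ - m, fun c c' hc hc' y v => ?_⟩
    rw [hc.unique hR hx₀ hc₀]
    have h1 := hm c' hc'
    have hL : 1 ≤ maxLip L₁₁ L₁₂ L₂₁ L₂₂ := Problem.one_le_maxLip
    have h2 : P.Phi c' ≤ P.H Q η c' y v := by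
      rw [Problem.H_eq]
      have e1 : 0 ≤ 8 * maxLip L₁₁ L₁₂ L₂₁ L₂₂ / (μ * η) * ‖avg y - P.yStar c'‖ ^ 2 := by
        positivity
      have e2 : 0 ≤ Q * dev y := mul_nonneg hQ.le (dev_nonneg y)
      have e3 : 0 ≤ η * Q * dev v := mul_nonneg (mul_nonneg hη.le hQ.le) (dev_nonneg v)
      linarith
    linarith
  · exact ⟨0, fun c _ hc => absurd ⟨c, hc⟩ hex⟩

end Main

end DRGDA

end

open DRGDA in
theorem theorem1 {n d r : ℕ} (hn : 1 ≤ n) (hr : 1 ≤ r) (hrd : r ≤ d)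
    (W : Matrix (Fin n) (Fin n) ℝ) (hW : W ∈ doublyStochastic ℝ (Fin n)) (hWsymm : W.IsSymm)
    (hWconn : DRGDA.lambda₂ W < 1)
    (k : ℕ) (hk1 : 1 ≤ k) (hk : ⌈Real.logb (DRGDA.lambda₂ W) (1 / (2 * √(n : ℝ)))⌉₊ ≤ k)
    (R : DRGDA.Mat d r → DRGDA.Mat d r → DRGDA.Mat d r) (hR : DRGDA.IsRetraction R)
    (δ₁ δ₂ : ℝ) (hδ₁ : 0 < δ₁) (hδ₁₂ : δ₁ ≤ 1 / (5 * √(r : ℝ)) * δ₂) (hδ₂ : δ₂ ≤ 1 / 6) :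
    ∃ α₀ > 0, ∃ ρ : ℝ → ℝ,
      (∀ α, 0 < α → α ≤ α₀ →
        0 < ρ α ∧ ρ α < 1 ∧ DRGDA.IsConsensusRate W k R δ₁ δ₂ α (ρ α)) ∧
      ∀ L₁₁ L₁₂ L₂₁ L₂₂ μ : ℝ, 0 ≤ L₁₁ → 0 ≤ L₁₂ → 0 ≤ L₂₁ → 0 ≤ L₂₂ → 0 < μ →
      ∃ Q > 0, ∃ η₀ > 0, ∀ α, 0 < α → α ≤ α₀ → ∀ η, 0 < η → η ≤ η₀ →
      ∀ D : ℝ, 0 ≤ D → ∃ C₄ > 0, ∃ β₀ > 0, ∀ β, 0 < β → β ≤ β₀ →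
      ∀ (p : ℕ) (P : DRGDA.Problem n d r p L₁₁ L₁₂ L₂₁ L₂₂ μ D),
      ∀ x₀ ∈ DRGDA.consensusRegion n d r δ₁ δ₂, ∀ y₀ : Fin n → EuclideanSpace ℝ (Fin p),
      ∃ K : ℝ, ∀ T : ℕ, 1 ≤ T →
      ∀ (x : ℕ → Fin n → DRGDA.Mat d r) (y : ℕ → Fin n → EuclideanSpace ℝ (Fin p))
        (u : ℕ → Fin n → DRGDA.Mat d r) (v : ℕ → Fin n → EuclideanSpace ℝ (Fin p))
        (xhat : ℕ → DRGDA.Mat d r),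
      DRGDA.IsRun P W k R α β η T x y u v → x 0 = x₀ → y 0 = y₀ →
      (∀ t ≤ T, DRGDA.IsIAM (x t) (xhat t)) →
        1 / (T : ℝ) * ∑ t ∈ Finset.range T, P.M (xhat t) (x t) (y t)
          ≤ 10 * (P.H Q η (xhat 0) (y 0) (v 0) - P.H Q η (xhat T) (y T) (v T) + C₄) / (T * β)
            + 10 * β * (2 / (1 - ρ α) ^ 2)
              * (P.H Q η (xhat 0) (y 0) (v 0) - P.H Q η (xhat T) (y T) (v T) + C₄) / T ∧
        1 / (T : ℝ) * ∑ t ∈ Finset.range T, P.M (xhat t) (x t) (y t) ≤ K / T := by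
  obtain ⟨ε, hε, M, hM, hbound⟩ := hR.exists_second_order_bound
  have hV : IsHalfMixing d r (W ^ k) := isHalfMixing_pow hn hW hWsymm hWconn hk1 hk
  have hregion : ∀ x ∈ consensusRegion n d r δ₁ δ₂, RegionPoint δ₁ δ₂ x := fun x hx =>
    regionPoint_of_mem hn hr hδ₁ hδ₁₂ hδ₂ hx
  have hconst : ∀ α τ : ℝ, 0 < α → α ≤ min (1 / 10) (min ε (1 / (60 * M))) → τ ≤ ε / 2 →
      2 * M * τ ≤ 1 → StepConstants R ε M α τ := by
    intro α τ hα hα₀ hτ1 hτ2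
    have h1 := le_min_iff.1 hα₀
    have h2 := le_min_iff.1 h1.2
    refine ⟨hbound, hε, hM, hα, h1.1, h2.1, ?_, hτ1, hτ2⟩
    have := mul_le_mul_of_nonneg_left h2.2 hM.le
    calc M * α ≤ M * (1 / (60 * M)) := this
      _ = 1 / 60 := by field_simp
  refine ⟨min (1 / 10) (min ε (1 / (60 * M))), by positivity, fun α => 1 - α / 30, ?_, ?_⟩
  · intro α hα hα₀
    have h1 := (le_min_iff.1 hα₀).1
    exact ⟨by linarith, by linarith,
      (hconst α 0 hα hα₀ (by positivity) (by norm_num)).isConsensusRate hR hV hδ₁ hregion⟩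
  intro L₁₁ L₁₂ L₂₁ L₂₂ μ _ _ _ _ hμ
  set L := maxLip L₁₁ L₁₂ L₂₁ L₂₂ with hLdef
  have hL : 1 ≤ L := Problem.one_le_maxLip
  have hL0 : 0 < L := by linarith
  set κ := 1 - lambda₂ W with hκ
  have hκ0 : 0 < κ := by linarith
  set Q := (80 * L ^ 3 / μ ^ 2 + 4) / κ with hQdef
  have hQ0 : 0 < Q := by positivity
  have hQ : Q * κ = 80 * L ^ 3 / μ ^ 2 + 4 := div_mul_cancel₀ _ hκ0.ne'
  -- The four bounds encode ημ ≤ 1, ηL² ≤ μ, 48ηQL ≤ κ and 288L²η ≤ κ²; none involves α or D.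
  refine ⟨Q, hQ0, min (min (1 / μ) (μ / L ^ 2)) (min (κ / (48 * (Q * L))) (κ ^ 2 / (288 * L ^ 2))),
    by positivity, ?_⟩
  intro α hα hα₀ η hη hη₀ D hD
  obtain ⟨⟨hη1, hη2⟩, hη3, hη4⟩ : (η ≤ 1 / μ ∧ η ≤ μ / L ^ 2) ∧ η ≤ κ / (48 * (Q * L)) ∧
      η ≤ κ ^ 2 / (288 * L ^ 2) := by simpa only [le_min_iff] using hη₀
  rw [le_div_iff₀ (by positivity)] at hη1 hη2 hη3 hη4
  set c := potentialConst L μ η κ Q D M α with hc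
  have hc0 : 0 ≤ c := potentialConst_nonneg hL hμ hη hκ0 hQ0 hD hM hα
  set B := trackingWeight α c with hB
  have hB0 : 0 < B := by rw [hB, trackingWeight]; positivity
  -- The admissible size of β‖uᵢ‖: within the radius of the retraction bound, with linear remainder,
  -- and preserving the region.
  set τ := min (ε / 2) (min (1 / (2 * M)) (α * δ₁ / 15)) with hτ
  have hτ0 : 0 < τ := by positivity
  have hτ1 : τ ≤ ε / 2 := min_le_left _ _
  have hτ2 : 2 * M * τ ≤ 1 := by
    have : τ ≤ 1 / (2 * M) := (min_le_right _ _).trans (min_le_left _ _)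
    rw [le_div_iff₀ (by positivity)] at this
    linarith
  have hτ3 : τ ≤ α * δ₁ / 15 := (min_le_right _ _).trans (min_le_right _ _)
  -- C₄ covers the initial consensus and tracking errors, as X ≤ 1 and β²U ≤ D² at time 0.
  refine ⟨30 / α * (c + 2) + B * D ^ 2, by positivity,
    min (min 1 (τ / (5 * D * √n + 1))) (min (min (1 / (3 * L ^ 2 + 1)) (1 / (224 * B * L ^ 2 + 1)))
      (min (η * Q * κ / 2 / (12 * B * L ^ 2 * η ^ 2 + 1)) (1 / (2 * B + 1)))), by positivity, ?_⟩
  intro β hβ hβ₀ p P x₀ hx₀ y₀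
  obtain ⟨⟨hβ1, hβτ⟩, ⟨hβL, hβB⟩, hβV, hβG⟩ : (β ≤ 1 ∧ β ≤ τ / (5 * D * √n + 1)) ∧
      (β ≤ 1 / (3 * L ^ 2 + 1) ∧ β ≤ 1 / (224 * B * L ^ 2 + 1)) ∧
      β ≤ η * Q * κ / 2 / (12 * B * L ^ 2 * η ^ 2 + 1) ∧ β ≤ 1 / (2 * B + 1) := by
    simpa only [le_min_iff] using hβ₀
  obtain ⟨K, hK⟩ := P.exists_potential_gap_le hR (hregion x₀ hx₀) y₀
    (fun i => P.gradY i (x₀ i) (y₀ i)) hμ hη hQ0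
  refine ⟨4 * (K + (30 / α * (c + 2) + B * D ^ 2)) / β, ?_⟩
  intro T hT x y u v xhat hrun hx0 hy0 hiam
  have hT0 : (0 : ℝ) < T := by exact_mod_cast hT
  have hctrl : ControlledRun P W k R ε M τ δ₁ δ₂ α β η T x y u v xhat :=
    { run := hrun
      iam := hiam
      init := hx0 ▸ hregion x₀ hx₀
      stochastic := hW
      symm := hWsymm
      connected := hWconn
      mixing := hV
      retraction := hR
      const := hconst α τ hα hα₀ hτ1 hτ2
      τ_le := hτ3
      β_pos := hβ
      β_le := hβ1
      β_le_τ := mul_le_of_le_div_add_one (by positivity) hβ hβτ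
      D_nonneg := hD
      μ_pos := hμ
      η_pos := hη
      ημ_le := hη1
      ηL_le := hη2 }
  have hsum := hctrl.sum_M_le hκ hQ0 hQ (by linarith) (by linarith) hc hB
    (mul_le_of_le_div_add_one (by positivity) hβ hβL)
    (mul_le_of_le_div_add_one (by positivity) hβ hβB)
    (mul_le_of_le_div_add_one (by positivity) hβ hβV)
    (mul_le_of_le_div_add_one (by positivity) hβ hβG)
  have hv0 : v 0 = fun i => P.gradY i (x₀ i) (y₀ i) := by
    funext i; rw [hrun.v_zero i, hx0, hy0]
  have hgap := hK (xhat 0) (xhat T) (hx0 ▸ hiam 0 (Nat.zero_le T)) (hiam T le_rfl).1 (y T) (v T)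
  rw [← hv0, ← hy0] at hgap
  set E := P.H Q η (xhat 0) (y 0) (v 0) - P.H Q η (xhat T) (y T) (v T)
    + (30 / α * (c + 2) + B * D ^ 2) with hE
  set S := ∑ t ∈ Finset.range T, P.M (xhat t) (x t) (y t) with hS
  have hS0 : 0 ≤ S := Finset.sum_nonneg fun t _ => P.M_nonneg _ _ _
  have hE0 : 0 ≤ E := by linarith [mul_nonneg hβ.le hS0]
  have hSE : S ≤ 4 * E / β := by rw [le_div_iff₀ hβ]; linarith
  constructor
  · have h1 : 1 / (T : ℝ) * S ≤ 10 * E / (T * β) := by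
      rw [one_div, inv_mul_le_iff₀ hT0]
      refine hSE.trans ?_
      rw [mul_div_assoc', mul_div_mul_left _ _ hT0.ne']
      gcongr
      linarith
    -- The first term of the bound suffices, so the second only has to be nonnegative.
    have h2 : 0 ≤ 10 * β * (2 / (1 - (1 - α / 30)) ^ 2) * E / T := by positivity
    linarith
  · rw [one_div, inv_mul_le_iff₀ hT0, mul_div_cancel₀ _ hT0.ne']
    refine hSE.trans ?_
    gcongr
    linarith
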